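/- Let $R$ be a commutative Noetherian ring with unit, let $b\in R$ and $I=\langle b\rangle$. For $r\in R$ let $q(r)\in\mathbb N\cup\{\infty\}$ be the largest $n$ with $r\in I^n$ ($\infty$ if there is no largest one), and let $\bar q(r)=\lim_{n\to\infty}q(r^n)/n\in[0,\infty]$. Put $$\overline{gr}R=\bigoplus_{n\in\mathbb Q}\{r:\bar q(r)\ge n\}\big/\{r:\bar q(r)>n\},$$ a $\mathbb Q$-graded ring (its components of negative degree vanish, and its component of degree $0$ is $R/\sqrt I$). Let $\bar b\in\overline{gr}R_1$ be the class of $b$, and let $\widetilde{gr}R$ be the integral closure of the image of $\overline{gr}R$, i.e. of $\overline{gr}R/\mathrm{ann}(\bar b)$, in the localization $\overline{gr}R[\bar b^{-1}]$. (1) $\widetilde{gr}R$ is graded by $\mathbb Q$, as a subring of $\overline{gr}R[\bar b^{-1}]$. Place $R/\sqrt I$ in degree $0$. Then the natural map $$\overline{gr}R\to R/\sqrt I\oplus\widetilde{gr}R$$ (the projection to degree $0$ in the first component, the localization map in the second) is an injective homomorphism of graded rings. (2) Assume that $\overline{gr}R$ is Noetherian, or that for every minimal prime $p$ of $R$ the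 integral closure of $R/p$ in its field of fractions is a finite $R/p$-module. Then the map in (1) is an isomorphism in high degrees: there is an $N$ such that it is bijective in every rational degree $n\ge N$. (3) Multiplication by $\bar b$ is an isomorphism $\widetilde{gr}R_n\to\widetilde{gr}R_{n+1}$ for every rational $n\ge0$. (4) Assume moreover that $R=\bigoplus_{j\in\mathbb N}R^j$ is a graded ring, that $R^0=k$ is an algebraically closed field, and that $b$ is homogeneous. Then the map in (1) is an isomorphism in high degrees, without the assumption in (2). The grading of $R$ makes $\widetilde{gr}R$ doubly graded, by $(n,j)\in\mathbb Q\times\mathbb N$, with components written $\widetilde{gr}R_n^j$. There are an $m\ge0$ and orthogonal idempotents $e_1,\dots,e_m$ of $\widetilde{gr}R$ with sum $1$ such that, with $A_i=e_i\,\widetilde{gr}R$ (a ring with unit $e_i$), each $A_i$ is doubly graded by $(A_i)_n^j=A_i\cap\widetilde{gr}R_n^j$, $\widetilde{gr}R=\bigoplus_{i=1}^mA_i$ as doubly graded rings, and for every $i$ the part $(A_i)^0=\bigoplus_n(A_i)^0_n$ equals $(A_i)^0_0$ and is isomorphic to $k$ through the natural map $k\to A_i$. The family $(e_1,\dots,e_m)$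 with these properties is unique up to reordering. -/

import Mathlib

open Filter Topology
open scoped ENNReal DirectSum

/-! ### The order function of an ideal, its homogenization, and the filtrations -/

/-- `adicOrder I r` is the largest `n` with `r ∈ I ^ n`, and `∞` if there is no largest one. -/
noncomputable def adicOrder {R : Type*} [CommRing R] (I : Ideal R) (r : R) : ℕ∞ :=
  ⨆ (n : ℕ) (_ : r ∈ I ^ n), (n : ℕ∞)

/-- The homogenization `lim_n adicOrder I (r ^ n) / n`, with values in `[0, ∞]`.
The limit exists, see `tendsto_homOrder`. -/
noncomputable def homOrder {R : Type*} [CommRing R] (I : Ideal R) (r : R) : ℝ≥0∞ :=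
  limUnder atTop (fun n : ℕ => ((adicOrder I (r ^ n) : ℕ∞) : ℝ≥0∞) / (n : ℝ≥0∞))

section OrderFacts

variable {R : Type*} [CommRing R] (I : Ideal R)

theorem le_adicOrder_iff (r : R) (n : ℕ) : (n : ℕ∞) ≤ adicOrder I r ↔ r ∈ I ^ n := by
  constructor
  · intro h
    rcases n with _ | n
    · simp
    by_contra hn
    have h2 : adicOrder I r ≤ (n : ℕ∞) := by
      refine iSup₂_le fun m hm => ?_
      by_contra hlt
      have : n + 1 ≤ m := by
        by_contra hc
        exact hlt (by exact_mod_cast (by omega : m ≤ n))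
      exact hn (Ideal.pow_le_pow_right this hm)
    have h3 := h.trans h2
    have : n + 1 ≤ n := by exact_mod_cast h3
    omega
  · intro h
    exact le_iSup₂ (f := fun (n : ℕ) (_ : r ∈ I ^ n) => (n : ℕ∞)) n h

theorem le_adicOrder_of_forall {r : R} {c : ℕ∞}
    (h : ∀ n : ℕ, (n : ℕ∞) ≤ c → r ∈ I ^ n) : c ≤ adicOrder I r := by
  refine ENat.forall_natCast_le_iff_le.mp fun n hn => ?_
  exact (le_adicOrder_iff I r n).2 (h n hn)

theorem adicOrder_add (r s : R) :
    min (adicOrder I r) (adicOrder I s) ≤ adicOrder I (r + s) := by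
  refine le_adicOrder_of_forall I fun n hn => ?_
  rw [le_min_iff, le_adicOrder_iff, le_adicOrder_iff] at hn
  exact add_mem hn.1 hn.2

theorem adicOrder_mul (r s : R) :
    adicOrder I r + adicOrder I s ≤ adicOrder I (r * s) := by
  unfold adicOrder
  refine ENat.biSup_add_biSup_le' (p := fun n : ℕ => r ∈ I ^ n) (q := fun n : ℕ => s ∈ I ^ n)
    ⟨0, by simp⟩ ⟨0, by simp⟩ fun i hi j hj => ?_
  have := le_iSup₂ (f := fun (n : ℕ) (_ : r * s ∈ I ^ n) => (n : ℕ∞)) (i + j)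
    (by rw [pow_add]; exact Ideal.mul_mem_mul hi hj)
  simpa using this

theorem adicOrder_le_mul (a r : R) : adicOrder I r ≤ adicOrder I (a * r) :=
  le_add_self.trans (adicOrder_mul I a r)

theorem exists_adicOrder_le_sum {ι : Type*} (s : Finset ι) (hs : s.Nonempty) (f : ι → R) :
    ∃ i ∈ s, adicOrder I (f i) ≤ adicOrder I (∑ i ∈ s, f i) := by
  classical
  induction hs using Finset.Nonempty.cons_induction with
  | singleton a => exact ⟨a, by simp⟩
  | cons a s ha hs ih =>
    obtain ⟨i, hi, hle⟩ := ih
    rw [Finset.sum_cons]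
    rcases min_le_iff.1 (adicOrder_add I (f a) (∑ i ∈ s, f i)) with h | h
    · exact ⟨a, by simp, h⟩
    · exact ⟨i, by simp [hi], hle.trans h⟩

theorem adicOrder_pow_mul (r : R) (m k : ℕ) :
    (k : ℕ∞) * adicOrder I (r ^ m) ≤ adicOrder I (r ^ (m * k)) := by
  induction k with
  | zero => simp
  | succ k ih =>
    have h := adicOrder_mul I (r ^ (m * k)) (r ^ m)
    rw [← pow_add] at h
    push_cast
    rw [add_mul, one_mul, Nat.mul_succ]
    exact (add_le_add ih le_rfl).trans h

theorem adicOrder_pow_mono (r : R) {m n : ℕ} (h : m ≤ n) :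
    adicOrder I (r ^ m) ≤ adicOrder I (r ^ n) := by
  obtain ⟨k, rfl⟩ := Nat.exists_eq_add_of_le' h
  rw [pow_add]
  exact adicOrder_le_mul I _ _

theorem tendsto_iSup_adicOrder (r : R) :
    Tendsto (fun n : ℕ => ((adicOrder I (r ^ n) : ℕ∞) : ℝ≥0∞) / (n : ℝ≥0∞)) atTop
      (𝓝 (⨆ m : ℕ, ((adicOrder I (r ^ (m + 1)) : ℕ∞) : ℝ≥0∞) / ((m + 1 : ℕ) : ℝ≥0∞))) := by
  refine tendsto_order.2 ⟨fun a ha => ?_, fun a ha => ?_⟩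
  · obtain ⟨m, hm⟩ := lt_iSup_iff.1 ha
    have hfl : Tendsto (fun n : ℕ => ((n / (m + 1) : ℕ) : ℝ≥0∞) / (n : ℝ≥0∞)) atTop
        (𝓝 (((m + 1 : ℕ) : ℝ≥0∞)⁻¹)) := by
      have h1 : Tendsto (fun n : ℕ => ((n / (m + 1) : ℕ) : ℝ) / (n : ℝ)) atTop
          (𝓝 (((m + 1 : ℕ) : ℝ)⁻¹)) := by
        have h2 := (tendsto_nat_floor_mul_div_atTop (R := ℝ) (a := (((m + 1 : ℕ) : ℝ)⁻¹))
          (by positivity)).comp tendsto_natCast_atTop_atTop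
        refine h2.congr fun n => ?_
        simp only [Function.comp]
        rw [inv_mul_eq_div, Nat.floor_div_natCast, Nat.floor_natCast]
      have h3 := ENNReal.tendsto_ofReal h1
      rw [ENNReal.ofReal_inv_of_pos (by positivity), ENNReal.ofReal_natCast] at h3
      refine h3.congr' ?_
      filter_upwards [eventually_gt_atTop 0] with n hn
      rw [ENNReal.ofReal_div_of_pos (by exact_mod_cast hn), ENNReal.ofReal_natCast,
        ENNReal.ofReal_natCast]
    have hmul := ENNReal.Tendsto.mul_const (b := ((adicOrder I (r ^ (m + 1)) : ℕ∞) : ℝ≥0∞)) hfl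
      (Or.inl (by simp))
    rw [mul_comm, ← div_eq_mul_inv] at hmul
    filter_upwards [hmul.eventually_const_lt hm] with n hn
    refine hn.trans_le ?_
    rw [div_eq_mul_inv, div_eq_mul_inv, mul_right_comm]
    gcongr
    have h5 := (adicOrder_pow_mul I r (m + 1) (n / (m + 1))).trans
      (adicOrder_pow_mono I r (Nat.mul_div_le n (m + 1)))
    have h6 := ENat.toENNReal_le.2 h5
    simpa using h6
  · filter_upwards [eventually_gt_atTop 0] with n hn
    obtain ⟨m, rfl⟩ : ∃ m, n = m + 1 := ⟨n - 1, by omega⟩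
    exact (le_iSup (fun m : ℕ =>
      ((adicOrder I (r ^ (m + 1)) : ℕ∞) : ℝ≥0∞) / ((m + 1 : ℕ) : ℝ≥0∞)) m).trans_lt ha

/-- The limit in the definition of `homOrder` exists. -/
theorem tendsto_homOrder (r : R) :
    Tendsto (fun n : ℕ => ((adicOrder I (r ^ n) : ℕ∞) : ℝ≥0∞) / (n : ℝ≥0∞)) atTop
      (𝓝 (homOrder I r)) := by
  have h := tendsto_iSup_adicOrder I r
  unfold homOrder
  rw [h.limUnder_eq]
  exact h

theorem le_homOrder (r : R) (m : ℕ) (hm : 0 < m) :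
    ((adicOrder I (r ^ m) : ℕ∞) : ℝ≥0∞) / (m : ℝ≥0∞) ≤ homOrder I r := by
  rw [tendsto_nhds_unique (tendsto_homOrder I r) (tendsto_iSup_adicOrder I r)]
  obtain ⟨k, rfl⟩ : ∃ k, m = k + 1 := ⟨m - 1, by omega⟩
  exact le_iSup (fun m : ℕ =>
      ((adicOrder I (r ^ (m + 1)) : ℕ∞) : ℝ≥0∞) / ((m + 1 : ℕ) : ℝ≥0∞)) k

theorem adicOrder_le_homOrder (r : R) : ((adicOrder I r : ℕ∞) : ℝ≥0∞) ≤ homOrder I r := by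
  simpa using le_homOrder I r 1 one_pos

theorem homOrder_zero : homOrder I (0 : R) = ∞ := by
  have h : adicOrder I (0 : R) = ⊤ :=
    top_le_iff.1 (le_adicOrder_of_forall I fun n _ => zero_mem _)
  have := adicOrder_le_homOrder I (0 : R)
  rw [h] at this
  simpa using this

theorem homOrder_mul (r s : R) : homOrder I r + homOrder I s ≤ homOrder I (r * s) := by
  refine le_of_tendsto_of_tendsto' ((tendsto_homOrder I r).add (tendsto_homOrder I s))
    (tendsto_homOrder I (r * s)) fun n => ?_
  rw [← ENNReal.add_div, mul_pow]
  gcongr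
  have := ENat.toENNReal_le.2 (adicOrder_mul I (r ^ n) (s ^ n))
  simpa using this

theorem homOrder_add (r s : R) :
    min (homOrder I r) (homOrder I s) ≤ homOrder I (r + s) := by
  refine le_of_forall_lt fun c hc => ?_
  obtain ⟨α, hcα, hα⟩ := exists_between hc
  refine hcα.trans_le ?_
  have hαtop : α ≠ ∞ := ne_top_of_lt hα
  have key : ∀ t : R, α < homOrder I t → ∃ M : ℕ, ∀ i : ℕ,
      α * i ≤ ((adicOrder I (t ^ i) : ℕ∞) : ℝ≥0∞) + α * M := by
    intro t ht
    obtain ⟨M, hM⟩ := eventually_atTop.1 ((tendsto_homOrder I t).eventually_const_lt ht)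
    refine ⟨M + 1, fun i => ?_⟩
    rcases le_or_gt (M + 1) i with h | h
    · refine le_trans ?_ le_self_add
      have h1 := (hM i (by omega)).le
      rwa [ENNReal.le_div_iff_mul_le (Or.inl (by simp; omega)) (Or.inl (by simp))] at h1
    · refine le_trans ?_ le_add_self
      gcongr
  obtain ⟨M₁, h₁⟩ := key r (hα.trans_le (min_le_left _ _))
  obtain ⟨M₂, h₂⟩ := key s (hα.trans_le (min_le_right _ _))
  set C : ℝ≥0∞ := α * M₁ + α * M₂ with hC
  have hCtop : C ≠ ∞ := by
    rw [hC]
    exact ENNReal.add_ne_top.2 ⟨ENNReal.mul_ne_top hαtop (by simp),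
      ENNReal.mul_ne_top hαtop (by simp)⟩
  have hN : ∀ N : ℕ, α * N ≤ ((adicOrder I ((r + s) ^ N) : ℕ∞) : ℝ≥0∞) + C := by
    intro N
    obtain ⟨i, hi, hle⟩ := exists_adicOrder_le_sum I (Finset.range (N + 1)) (by simp)
      (fun m => r ^ m * s ^ (N - m) * (N.choose m : R))
    rw [← add_pow] at hle
    have hiN : i ≤ N := by simpa [Nat.lt_succ_iff] using hi
    have h3 : adicOrder I (r ^ i) + adicOrder I (s ^ (N - i)) ≤ adicOrder I ((r + s) ^ N) := by
      refine (adicOrder_mul I _ _).trans (le_trans ?_ hle)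
      rw [mul_comm (r ^ i * s ^ (N - i))]
      exact adicOrder_le_mul I _ _
    have h4 := ENat.toENNReal_le.2 h3
    rw [ENat.toENNReal_add] at h4
    calc α * N = α * i + α * (N - i : ℕ) := by
          rw [← mul_add]; congr 1; exact_mod_cast (by omega : N = i + (N - i))
      _ ≤ (((adicOrder I (r ^ i) : ℕ∞) : ℝ≥0∞) + α * M₁)
            + (((adicOrder I (s ^ (N - i)) : ℕ∞) : ℝ≥0∞) + α * M₂) := add_le_add (h₁ _) (h₂ _)
      _ = (((adicOrder I (r ^ i) : ℕ∞) : ℝ≥0∞) + ((adicOrder I (s ^ (N - i)) : ℕ∞) : ℝ≥0∞))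
            + C := by rw [hC]; ring
      _ ≤ _ := by gcongr
  have hlim : Tendsto (fun N : ℕ => ((adicOrder I ((r + s) ^ N) : ℕ∞) : ℝ≥0∞) / (N : ℝ≥0∞)
      + C / (N : ℝ≥0∞)) atTop (𝓝 (homOrder I (r + s) + 0)) := by
    refine (tendsto_homOrder I (r + s)).add ?_
    have := ENNReal.Tendsto.const_mul (a := C) ENNReal.tendsto_inv_nat_nhds_zero (Or.inr hCtop)
    simpa [div_eq_mul_inv] using this
  rw [add_zero] at hlim
  refine ge_of_tendsto hlim ?_
  filter_upwards [eventually_gt_atTop 0] with N hNpos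
  rw [← ENNReal.add_div, ENNReal.le_div_iff_mul_le (Or.inl (by simp; omega)) (Or.inl (by simp))]
  exact hN N

theorem mem_radical_of_homOrder_pos {r : R} (h : 0 < homOrder I r) : r ∈ I.radical := by
  obtain ⟨n, hn, hn0⟩ := (((tendsto_homOrder I r).eventually_const_lt h).and
    (eventually_gt_atTop 0)).exists
  refine ⟨n, ?_⟩
  have h1 : adicOrder I (r ^ n) ≠ 0 := by
    intro h0
    simp [h0] at hn
  have h2 : ((1 : ℕ) : ℕ∞) ≤ adicOrder I (r ^ n) := by
    simpa using Order.one_le_iff_ne_zero.2 h1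
  simpa using (le_adicOrder_iff I _ 1).1 h2

end OrderFacts

/-- The ideal `{r : homOrder I r ≥ n}`, for a rational number `n`. -/
noncomputable def homGE {R : Type*} [CommRing R] (I : Ideal R) (n : ℚ) : Ideal R where
  carrier := {r | ((n : ℝ) : EReal) ≤ ((homOrder I r : ℝ≥0∞) : EReal)}
  zero_mem' := by simp [homOrder_zero]
  add_mem' {r s} hr hs := by
    have h := EReal.coe_ennreal_le_coe_ennreal_iff.2 (homOrder_add I r s)
    refine le_trans ?_ h
    rcases min_choice (homOrder I r) (homOrder I s) with h' | h' <;> rw [h'] <;> assumption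
  smul_mem' a r hr :=
    le_trans hr (EReal.coe_ennreal_le_coe_ennreal_iff.2
      (le_add_self.trans (homOrder_mul I a r)))

/-- The ideal `{r : homOrder I r > n}`, for a rational number `n`. -/
noncomputable def homGT {R : Type*} [CommRing R] (I : Ideal R) (n : ℚ) : Ideal R where
  carrier := {r | ((n : ℝ) : EReal) < ((homOrder I r : ℝ≥0∞) : EReal)}
  zero_mem' := by simp [homOrder_zero]
  add_mem' {r s} hr hs := by
    have h := EReal.coe_ennreal_le_coe_ennreal_iff.2 (homOrder_add I r s)
    refine lt_of_lt_of_le ?_ h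
    rcases min_choice (homOrder I r) (homOrder I s) with h' | h' <;> rw [h'] <;> assumption
  smul_mem' a r hr :=
    lt_of_lt_of_le hr (EReal.coe_ennreal_le_coe_ennreal_iff.2
      (le_add_self.trans (homOrder_mul I a r)))

section FiltrationFacts

variable {R : Type*} [CommRing R] (I : Ideal R)

theorem mem_homGE {n : ℚ} {r : R} :
    r ∈ homGE I n ↔ ((n : ℝ) : EReal) ≤ ((homOrder I r : ℝ≥0∞) : EReal) := Iff.rfl

theorem mem_homGT {n : ℚ} {r : R} :
    r ∈ homGT I n ↔ ((n : ℝ) : EReal) < ((homOrder I r : ℝ≥0∞) : EReal) := Iff.rfl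

theorem mul_mem_homGE {m n : ℚ} {r s : R} (hr : r ∈ homGE I m) (hs : s ∈ homGE I n) :
    r * s ∈ homGE I (m + n) := by
  rw [mem_homGE] at *
  have h := EReal.coe_ennreal_le_coe_ennreal_iff.2 (homOrder_mul I r s)
  rw [EReal.coe_ennreal_add] at h
  push_cast
  exact (add_le_add hr hs).trans h

theorem mul_mem_homGT_left {m n : ℚ} {r s : R} (hr : r ∈ homGT I m) (hs : s ∈ homGE I n) :
    r * s ∈ homGT I (m + n) := by
  rw [mem_homGE] at hs
  rw [mem_homGT] at *
  have h := EReal.coe_ennreal_le_coe_ennreal_iff.2 (homOrder_mul I r s)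
  rw [EReal.coe_ennreal_add] at h
  push_cast
  exact ((EReal.add_lt_add_right_coe hr (n : ℝ)).trans_le (add_le_add le_rfl hs)).trans_le h

theorem mul_mem_homGT_right {m n : ℚ} {r s : R} (hr : r ∈ homGE I m) (hs : s ∈ homGT I n) :
    r * s ∈ homGT I (m + n) := by
  rw [mul_comm, add_comm]
  exact mul_mem_homGT_left I hs hr

theorem mem_homGE_zero (r : R) : r ∈ homGE I 0 := by
  rw [mem_homGE]
  simpa using EReal.coe_ennreal_nonneg (homOrder I r)

theorem mem_homGT_of_neg {n : ℚ} (hn : n < 0) (r : R) : r ∈ homGT I n := by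
  rw [mem_homGT]
  refine lt_of_lt_of_le (b := (0 : EReal)) ?_ (EReal.coe_ennreal_nonneg _)
  exact_mod_cast hn

theorem mem_homGE_one {r : R} (hr : r ∈ I) : r ∈ homGE I 1 := by
  rw [mem_homGE]
  have h1 : ((1 : ℕ) : ℕ∞) ≤ adicOrder I r := (le_adicOrder_iff I r 1).2 (by simpa using hr)
  have h2 := (ENat.toENNReal_le.2 h1).trans (adicOrder_le_homOrder I r)
  have h3 := EReal.coe_ennreal_le_coe_ennreal_iff.2 h2
  simpa using h3

theorem homGT_zero_le_radical : homGT I 0 ≤ I.radical := by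
  intro r hr
  rw [mem_homGT] at hr
  exact mem_radical_of_homOrder_pos I (by simpa using hr)

end FiltrationFacts

/-! ### The balanced associated graded ring -/

/-- The degree `n` summand `{r : homOrder I r ≥ n} / {r : homOrder I r > n}`. -/
abbrev OgrPiece {R : Type*} [CommRing R] (I : Ideal R) (n : ℚ) : Type _ :=
  (homGE I n) ⧸ Submodule.comap (Submodule.subtype (homGE I n)) (homGT I n)

namespace OgrPiece

/-- The class in degree `n` of an element `r` with `homOrder I r ≥ n`. -/
noncomputable def mk {R : Type*} [CommRing R] (I : Ideal R) (n : ℚ) (r : homGE I n) :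
    OgrPiece I n :=
  Submodule.Quotient.mk r

/-- Multiplication of classes, induced from the multiplication of `R`. -/
noncomputable def mul {R : Type*} [CommRing R] (I : Ideal R) {m n : ℚ} (x : OgrPiece I m)
    (y : OgrPiece I n) : OgrPiece I (m + n) :=
  Quotient.liftOn₂' x y
    (fun r s => mk I (m + n) ⟨r.1 * s.1, mul_mem_homGE I r.2 s.2⟩) (by
      intro r₁ s₁ r₂ s₂ hr hs
      rw [Submodule.quotientRel_def] at hr hs
      refine (Submodule.Quotient.eq _).2 ?_
      have hr' : r₁.1 - r₂.1 ∈ homGT I m := hr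
      have hs' : s₁.1 - s₂.1 ∈ homGT I n := hs
      change r₁.1 * s₁.1 - r₂.1 * s₂.1 ∈ homGT I (m + n)
      have h : r₁.1 * s₁.1 - r₂.1 * s₂.1
          = (r₁.1 - r₂.1) * s₁.1 + r₂.1 * (s₁.1 - s₂.1) := by ring
      rw [h]
      exact add_mem (mul_mem_homGT_left I hr' s₁.2) (mul_mem_homGT_right I r₂.2 hs'))

section

variable {R : Type*} [CommRing R] (I : Ideal R)

theorem mk_surjective {n : ℚ} (x : OgrPiece I n) : ∃ r, mk I n r = x :=
  Submodule.Quotient.mk_surjective _ x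

theorem mul_mk {m n : ℚ} (r : homGE I m) (s : homGE I n) :
    mul I (mk I m r) (mk I n s) = mk I (m + n) ⟨r.1 * s.1, mul_mem_homGE I r.2 s.2⟩ := rfl

theorem mk_add {n : ℚ} (r s : homGE I n) : mk I n (r + s) = mk I n r + mk I n s := rfl

theorem mk_zero {n : ℚ} : mk I n 0 = 0 := rfl

theorem mk_eq_zero {n : ℚ} (r : homGE I n) : mk I n r = 0 ↔ r.1 ∈ homGT I n :=
  Submodule.Quotient.mk_eq_zero _

theorem sigma_ext {m n : ℚ} (h : m = n) (r : homGE I m) (s : homGE I n) (hrs : r.1 = s.1) :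
    (⟨m, mk I m r⟩ : GradedMonoid (OgrPiece I)) = ⟨n, mk I n s⟩ := by
  subst h
  have : r = s := Subtype.ext hrs
  rw [this]

end

noncomputable instance instGMul {R : Type*} [CommRing R] (I : Ideal R) :
    GradedMonoid.GMul (OgrPiece I) where
  mul x y := mul I x y

noncomputable instance instGOne {R : Type*} [CommRing R] (I : Ideal R) :
    GradedMonoid.GOne (OgrPiece I) where
  one := mk I 0 ⟨1, mem_homGE_zero I 1⟩

noncomputable instance instGCommRing {R : Type*} [CommRing R] (I : Ideal R) :
    DirectSum.GCommRing (OgrPiece I) where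
  mul_zero {m n} x := by
    obtain ⟨r, rfl⟩ := mk_surjective I x
    refine (mk_eq_zero I _).2 ?_
    simp
  zero_mul {m n} x := by
    obtain ⟨r, rfl⟩ := mk_surjective I x
    refine (mk_eq_zero I _).2 ?_
    simp
  mul_add {m n} x y z := by
    obtain ⟨r, rfl⟩ := mk_surjective I x
    obtain ⟨s, rfl⟩ := mk_surjective I y
    obtain ⟨t, rfl⟩ := mk_surjective I z
    rw [← mk_add]
    change mul I _ _ = mul I _ _ + mul I _ _
    rw [mul_mk, mul_mk, mul_mk, ← mk_add]
    congr 1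
    exact Subtype.ext (mul_add r.1 s.1 t.1)
  add_mul {m n} x y z := by
    obtain ⟨r, rfl⟩ := mk_surjective I x
    obtain ⟨s, rfl⟩ := mk_surjective I y
    obtain ⟨t, rfl⟩ := mk_surjective I z
    rw [← mk_add]
    change mul I _ _ = mul I _ _ + mul I _ _
    rw [mul_mk, mul_mk, mul_mk, ← mk_add]
    congr 1
    exact Subtype.ext (add_mul r.1 s.1 t.1)
  one_mul := by
    rintro ⟨n, x⟩
    obtain ⟨r, rfl⟩ := mk_surjective I x
    exact sigma_ext I (zero_add n) _ _ (one_mul r.1)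
  mul_one := by
    rintro ⟨n, x⟩
    obtain ⟨r, rfl⟩ := mk_surjective I x
    exact sigma_ext I (add_zero n) _ _ (mul_one r.1)
  mul_assoc := by
    rintro ⟨m, x⟩ ⟨n, y⟩ ⟨p, z⟩
    obtain ⟨r, rfl⟩ := mk_surjective I x
    obtain ⟨s, rfl⟩ := mk_surjective I y
    obtain ⟨t, rfl⟩ := mk_surjective I z
    exact sigma_ext I (add_assoc m n p) _ _ (mul_assoc r.1 s.1 t.1)
  mul_comm := by
    rintro ⟨m, x⟩ ⟨n, y⟩
    obtain ⟨r, rfl⟩ := mk_surjective I x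
    obtain ⟨s, rfl⟩ := mk_surjective I y
    exact sigma_ext I (add_comm m n) _ _ (mul_comm r.1 s.1)
  natCast k := mk I 0 ⟨k, mem_homGE_zero I _⟩
  natCast_zero := (mk_eq_zero I _).2 (by simp)
  natCast_succ k := by
    change mk I 0 _ = mk I 0 _ + mk I 0 _
    rw [← mk_add]
    congr 1
    exact Subtype.ext (Nat.cast_succ k)
  intCast k := mk I 0 ⟨k, mem_homGE_zero I _⟩
  intCast_ofNat k := by
    congr 1
    exact Subtype.ext (Int.cast_natCast k)
  intCast_negSucc_ofNat k := by
    change mk I 0 _ = -mk I 0 _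
    refine (Submodule.Quotient.eq _).2 ?_
    change ((Int.negSucc k : ℤ) : R) - -(((k + 1 : ℕ) : R)) ∈ homGT I 0
    simp

end OgrPiece

/-- The balanced associated graded ring
`⨁ n : ℚ, {r : homOrder I r ≥ n} / {r : homOrder I r > n}`
(the summands with `n < 0` vanish). -/
def Ogr {R : Type*} [CommRing R] (I : Ideal R) : Type _ := ⨁ n : ℚ, OgrPiece I n

namespace Ogr

noncomputable instance instCommRing {R : Type*} [CommRing R] (I : Ideal R) : CommRing (Ogr I) :=
  inferInstanceAs (CommRing (⨁ n : ℚ, OgrPiece I n))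

/-- The inclusion of the degree `n` summand. -/
noncomputable def of {R : Type*} [CommRing R] (I : Ideal R) (n : ℚ) : OgrPiece I n →+ Ogr I :=
  DirectSum.of (OgrPiece I) n

/-- The class in degree `n` of an element `r` with `homOrder I r ≥ n`, as an element of the
balanced associated graded ring. -/
noncomputable def symb {R : Type*} [CommRing R] (I : Ideal R) (n : ℚ) (r : R)
    (hr : r ∈ homGE I n) : Ogr I :=
  of I n (OgrPiece.mk I n ⟨r, hr⟩)

/-- The homogeneous elements of degree `n`. -/
noncomputable def deg {R : Type*} [CommRing R] (I : Ideal R) (n : ℚ) : AddSubgroup (Ogr I) :=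
  (of I n).range

section

variable {R : Type*} [CommRing R] (I : Ideal R)

theorem symb_mem_deg (n : ℚ) (r : R) (hr : r ∈ homGE I n) : symb I n r hr ∈ deg I n :=
  ⟨_, rfl⟩

theorem mem_deg_iff {n : ℚ} {x : Ogr I} :
    x ∈ deg I n ↔ ∃ (r : R) (hr : r ∈ homGE I n), symb I n r hr = x := by
  constructor
  · rintro ⟨y, rfl⟩
    obtain ⟨r, rfl⟩ := OgrPiece.mk_surjective I y
    exact ⟨r.1, r.2, rfl⟩
  · rintro ⟨r, hr, rfl⟩
    exact symb_mem_deg I n r hr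

theorem symb_mul (m n : ℚ) (r s : R) (hr : r ∈ homGE I m) (hs : s ∈ homGE I n) :
    symb I m r hr * symb I n s hs = symb I (m + n) (r * s) (mul_mem_homGE I hr hs) :=
  DirectSum.of_mul_of _ _

theorem symb_add (n : ℚ) (r s : R) (hr : r ∈ homGE I n) (hs : s ∈ homGE I n) :
    symb I n r hr + symb I n s hs = symb I n (r + s) (add_mem hr hs) :=
  ((of I n).map_add _ _).symm

theorem symb_eq_zero_of_mem {n : ℚ} {r : R} (hr : r ∈ homGE I n) (h : r ∈ homGT I n) :
    symb I n r hr = 0 := by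
  have : OgrPiece.mk I n ⟨r, hr⟩ = 0 := (OgrPiece.mk_eq_zero I _).2 h
  unfold symb
  rw [this, map_zero]

theorem symb_congr {m n : ℚ} (h : m = n) {r s : R} (hrs : r = s) (hr : r ∈ homGE I m)
    (hs : s ∈ homGE I n) : symb I m r hr = symb I n s hs := by
  subst h
  subst hrs
  rfl

theorem one_eq_symb : (1 : Ogr I) = symb I 0 1 (mem_homGE_zero I 1) := rfl

instance : SetLike.GradedMonoid (deg I) where
  one_mem := ⟨_, rfl⟩
  mul_mem m n x y hx hy := by
    obtain ⟨r, hr, rfl⟩ := (mem_deg_iff I).1 hx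
    obtain ⟨s, hs, rfl⟩ := (mem_deg_iff I).1 hy
    rw [symb_mul]
    exact symb_mem_deg I _ _ _

end

/-- The natural ring homomorphism from `R` onto the degree zero part. -/
noncomputable def fromBase {R : Type*} [CommRing R] (I : Ideal R) : R →+* Ogr I where
  toFun r := symb I 0 r (mem_homGE_zero I r)
  map_one' := rfl
  map_mul' r s := by
    rw [symb_mul]
    exact symb_congr I (add_zero 0).symm rfl _ _
  map_zero' := symb_eq_zero_of_mem I _ (zero_mem _)
  map_add' r s := (symb_add I 0 r s _ _).symm

/-- In degree zero the map `{r : homOrder I r ≥ 0} / {r : homOrder I r > 0} → R / √I`,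
in all other degrees the zero map. -/
noncomputable def toRadicalPiece {R : Type*} [CommRing R] (I : Ideal R) (n : ℚ) :
    OgrPiece I n →+ R ⧸ I.radical :=
  if h : n = 0 then
    (Submodule.liftQ _ ((Submodule.mkQ I.radical).comp (Submodule.subtype (homGE I n))) (by
      intro x hx
      subst h
      exact (Submodule.Quotient.mk_eq_zero _).2 (homGT_zero_le_radical I hx))).toAddMonoidHom
  else 0

theorem toRadicalPiece_zero {R : Type*} [CommRing R] (I : Ideal R) (r : homGE I 0) :
    toRadicalPiece I 0 (OgrPiece.mk I 0 r) = Ideal.Quotient.mk I.radical r.1 := by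
  unfold toRadicalPiece
  rw [dif_pos rfl]
  rfl

theorem toRadicalPiece_of_ne {R : Type*} [CommRing R] (I : Ideal R) {n : ℚ} (hn : n ≠ 0)
    (x : OgrPiece I n) : toRadicalPiece I n x = 0 := by
  unfold toRadicalPiece
  rw [dif_neg hn]
  rfl

/-- The projection onto the degree zero part, as a ring homomorphism to `R / √I`. It sends the
degree zero class of `r` to the class of `r`, and kills all other degrees. -/
noncomputable def toRadical {R : Type*} [CommRing R] (I : Ideal R) : Ogr I →+* R ⧸ I.radical :=
  DirectSum.toSemiring (toRadicalPiece I)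
    (by
      change toRadicalPiece I 0 (OgrPiece.mk I 0 ⟨1, mem_homGE_zero I 1⟩) = 1
      rw [toRadicalPiece_zero]
      rfl)
    (by
      intro m n x y
      obtain ⟨r, rfl⟩ := OgrPiece.mk_surjective I x
      obtain ⟨s, rfl⟩ := OgrPiece.mk_surjective I y
      change toRadicalPiece I (m + n) (OgrPiece.mk I (m + n)
        ⟨r.1 * s.1, mul_mem_homGE I r.2 s.2⟩) = _
      by_cases hm : m = 0
      · by_cases hn : n = 0
        · subst hm
          subst hn
          have h : ∀ (p : ℚ) (hp : p = 0) (t : homGE I p),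
              toRadicalPiece I p (OgrPiece.mk I p t) = Ideal.Quotient.mk I.radical t.1 := by
            intro p hp t
            subst hp
            exact toRadicalPiece_zero I t
          rw [h _ (add_zero 0), toRadicalPiece_zero, toRadicalPiece_zero, map_mul]
        · rw [toRadicalPiece_of_ne I hn, mul_zero,
            toRadicalPiece_of_ne I (by rw [hm, zero_add]; exact hn)]
      · rw [toRadicalPiece_of_ne I hm, zero_mul]
        by_cases hmn : m + n = 0
        · have h0 : OgrPiece.mk I (m + n) ⟨r.1 * s.1, mul_mem_homGE I r.2 s.2⟩ = 0 := by
            refine (OgrPiece.mk_eq_zero I _).2 ?_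
            rcases lt_or_gt_of_ne hm with h | h
            · exact mul_mem_homGT_left I (mem_homGT_of_neg I h r.1) s.2
            · exact mul_mem_homGT_right I r.2 (mem_homGT_of_neg I (by linarith) s.1)
          rw [h0, map_zero]
        · exact toRadicalPiece_of_ne I hmn _)

/-- The class of `b` in degree `1`, for the ideal generated by `b`. -/
noncomputable def bClass {R : Type*} [CommRing R] (b : R) : Ogr (Ideal.span {b}) :=
  symb (Ideal.span {b}) 1 b (mem_homGE_one _ (Ideal.mem_span_singleton_self b))

/-- The bihomogeneous elements of degree `p = (n, j)`: the classes in degree `n` of elements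
that are homogeneous of degree `j` for the given grading of `R`. -/
noncomputable def bideg {k R : Type*} [Field k] [CommRing R] [Algebra k R]
    (𝒜 : ℕ → Submodule k R) (I : Ideal R) (p : ℚ × ℕ) : AddSubgroup (Ogr I) where
  carrier := {x | ∃ (r : R) (hr : r ∈ homGE I p.1), r ∈ 𝒜 p.2 ∧ symb I p.1 r hr = x}
  zero_mem' := ⟨0, zero_mem _, zero_mem _, symb_eq_zero_of_mem I _ (zero_mem _)⟩
  add_mem' := by
    rintro _ _ ⟨r, hr, hr', rfl⟩ ⟨s, hs, hs', rfl⟩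
    exact ⟨r + s, add_mem hr hs, add_mem hr' hs', (symb_add I _ r s hr hs).symm⟩
  neg_mem' := by
    rintro _ ⟨r, hr, hr', rfl⟩
    refine ⟨-r, neg_mem hr, neg_mem hr', ?_⟩
    rw [eq_neg_iff_add_eq_zero, symb_add]
    exact symb_eq_zero_of_mem I _ (by simp)

instance {k R : Type*} [Field k] [CommRing R] [Algebra k R] (𝒜 : ℕ → Submodule k R)
    [SetLike.GradedMonoid 𝒜] (I : Ideal R) : SetLike.GradedMonoid (bideg 𝒜 I) where
  one_mem := ⟨1, mem_homGE_zero I 1, SetLike.GradedOne.one_mem, rfl⟩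
  mul_mem p q x y hx hy := by
    obtain ⟨r, hr, hr', rfl⟩ := hx
    obtain ⟨s, hs, hs', rfl⟩ := hy
    exact ⟨r * s, mul_mem_homGE I hr hs, SetLike.GradedMul.mul_mem hr' hs',
      (symb_mul I _ _ r s hr hs).symm⟩

theorem bClass_mem_deg {R : Type*} [CommRing R] (b : R) :
    bClass b ∈ deg (Ideal.span {b}) 1 :=
  symb_mem_deg _ _ _ _

theorem bClass_mem_bideg {k R : Type*} [Field k] [CommRing R] [Algebra k R]
    (𝒜 : ℕ → Submodule k R) {b : R} {d : ℕ} (hb : b ∈ 𝒜 d) :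
    bClass b ∈ bideg 𝒜 (Ideal.span {b}) (1, d) :=
  ⟨b, _, hb, rfl⟩

end Ogr

/-! ### Gradings on localizations and on corner rings -/

/-- The homogeneous elements of degree `i` in the localization `S[1/f]` of a graded ring `S` at a
homogeneous element `f` of degree `δ`: the fractions `s / f ^ l` with `s` homogeneous of degree
`i + l • δ`. -/
def awayDeg {ι S : Type*} [AddCommMonoid ι] [CommRing S] (𝒮 : ι → AddSubgroup S)
    [SetLike.GradedMonoid 𝒮] {δ : ι} {f : S} (hf : f ∈ 𝒮 δ) (i : ι) :
    AddSubgroup (Localization.Away f) where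
  carrier := {x | ∃ (l : ℕ) (s : S), s ∈ 𝒮 (i + l • δ) ∧
    x * algebraMap S (Localization.Away f) (f ^ l) = algebraMap S (Localization.Away f) s}
  zero_mem' := ⟨0, 0, zero_mem _, by simp⟩
  add_mem' := by
    rintro x y ⟨l, s, hs, hx⟩ ⟨m, t, ht, hy⟩
    refine ⟨l + m, s * f ^ m + t * f ^ l, add_mem ?_ ?_, ?_⟩
    · have := SetLike.GradedMul.mul_mem hs (SetLike.pow_mem_graded m hf)
      rwa [add_assoc, ← add_smul] at this
    · have := SetLike.GradedMul.mul_mem ht (SetLike.pow_mem_graded l hf)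
      rwa [add_assoc, ← add_smul, add_comm m l] at this
    · rw [map_add, map_mul, map_mul, ← hx, ← hy, pow_add, map_mul]
      ring
  neg_mem' := by
    rintro x ⟨l, s, hs, hx⟩
    exact ⟨l, -s, neg_mem hs, by rw [neg_mul, hx, map_neg]⟩

/-- The homogeneous elements of degree `i` in the ring `e S` with unit `e`, where `e` is an
idempotent of the graded ring `S`. -/
def cornerDeg {ι S : Type*} [CommRing S] (𝒮 : ι → AddSubgroup S) {e : S}
    (he : IsIdempotentElem e) (i : ι) : AddSubgroup he.Corner where
  carrier := {x | x.1 ∈ 𝒮 i}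
  zero_mem' := zero_mem (𝒮 i)
  add_mem' hx hy := add_mem (S := AddSubgroup S) hx hy
  neg_mem' hx := neg_mem (S := AddSubgroup S) hx

/-! ### The integral closure of the balanced associated graded ring -/

/-- The integral closure of the balanced associated graded ring for the ideal `(b)` in its
localization at the class of `b`. (An element of the localization is integral over this ring if
and only if it is integral over the image of this ring in the localization, which is its quotient
by the annihilator of the class of `b`.) -/
noncomputable abbrev ICogr {R : Type*} [CommRing R] (b : R) :
    Subalgebra (Ogr (Ideal.span {b})) (Localization.Away (Ogr.bClass b)) :=
  integralClosure (Ogr (Ideal.span {b})) (Localization.Away (Ogr.bClass b))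

namespace ICogr

/-- The natural map from the balanced associated graded ring to its integral closure. -/
noncomputable def fromOgr {R : Type*} [CommRing R] (b : R) :
    Ogr (Ideal.span {b}) →+* ICogr b :=
  algebraMap (Ogr (Ideal.span {b})) (ICogr b)

/-- The homogeneous elements of degree `n`. -/
noncomputable def deg {R : Type*} [CommRing R] (b : R) (n : ℚ) : AddSubgroup (ICogr b) :=
  (awayDeg (Ogr.deg (Ideal.span {b})) (Ogr.bClass_mem_deg b) n).comap
    (ICogr b).val.toRingHom.toAddMonoidHom

/-- The bihomogeneous elements of degree `p = (n, j)`, when `R` is graded and `b` is homogeneous: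
`n` is the degree defined by the filtration, and `j` comes from the grading of `R`. -/
noncomputable def bideg {k R : Type*} [Field k] [CommRing R] [Algebra k R]
    (𝒜 : ℕ → Submodule k R) [SetLike.GradedMonoid 𝒜] {b : R} {d : ℕ} (hb : b ∈ 𝒜 d)
    (p : ℚ × ℕ) : AddSubgroup (ICogr b) :=
  (awayDeg (Ogr.bideg 𝒜 (Ideal.span {b})) (Ogr.bClass_mem_bideg 𝒜 hb) p).comap
    (ICogr b).val.toRingHom.toAddMonoidHom

/-- The elements of degree `n` of the product ring `R / √(b) × ICogr b`, where `R / √(b)` is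
placed in degree zero. -/
noncomputable def prodDeg {R : Type*} [CommRing R] (b : R) (n : ℚ) :
    AddSubgroup ((R ⧸ (Ideal.span {b}).radical) × ICogr b) :=
  (if n = 0 then ⊤ else ⊥ : AddSubgroup (R ⧸ (Ideal.span {b}).radical)).prod (deg b n)

/-- The natural map from the balanced associated graded ring to `R / √(b) × ICogr b`. -/
noncomputable def attaching {R : Type*} [CommRing R] (b : R) :
    Ogr (Ideal.span {b}) →+* (R ⧸ (Ideal.span {b}).radical) × ICogr b :=
  (Ogr.toRadical (Ideal.span {b})).prod (fromOgr b)

/-- The natural map from `R` to `ICogr b`, through the degree zero part of the balanced associated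
graded ring. -/
noncomputable def fromBase {R : Type*} [CommRing R] (b : R) : R →+* ICogr b :=
  (fromOgr b).comp (Ogr.fromBase (Ideal.span {b}))

/-- The family `e` of orthogonal idempotents with sum `1` splits the doubly graded ring `ICogr b`
as the product of the doubly graded rings `A i = e i * ICogr b`, and the part of `A i` of degree
zero for the grading that comes from `R` is concentrated in bidegree `(0, 0)`, and is the
isomorphic image of `k`. -/
structure IsSplitting {k R : Type*} [Field k] [CommRing R] [Algebra k R]
    (𝒜 : ℕ → Submodule k R) [SetLike.GradedMonoid 𝒜] {b : R} {d : ℕ} (hb : b ∈ 𝒜 d) {m : ℕ}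
    (e : Fin m → ICogr b) : Prop where
  idem : CompleteOrthogonalIdempotents e
  graded : ∀ i, Nonempty (GradedRing (cornerDeg (bideg 𝒜 hb) (idem.idem i)))
  splits : ∀ p (x : ICogr b), x ∈ bideg 𝒜 hb p ↔
    ∀ i, idem.ringEquivOfComm x i ∈ cornerDeg (bideg 𝒜 hb) (idem.idem i) p
  degree_zero : ∀ i (n : ℚ), n ≠ 0 → cornerDeg (bideg 𝒜 hb) (idem.idem i) (n, 0) = ⊥
  degree_zero_zero : ∀ i, ∃ φ : k →+* (idem.idem i).Corner,
    (∀ c, (φ c).1 = e i * fromBase b (algebraMap k R c)) ∧ Function.Injective φ ∧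
    Set.range φ = (cornerDeg (bideg 𝒜 hb) (idem.idem i) (0, 0) : Set (idem.idem i).Corner)

end ICogr

/-- The normalization of `Spec R` is finite over it: for every minimal prime `p` of `R`, the
integral closure of the domain `R / p` in its field of fractions is a finite module. -/
def HasFiniteNormalization (R : Type*) [CommRing R] : Prop :=
  ∀ p ∈ minimalPrimes R,
    Module.Finite (R ⧸ p) (integralClosure (R ⧸ p) (FractionRing (R ⧸ p)))

/-!
# The integral closure of the balanced associated graded ring of a principal ideal

Everything rests on a description of the filtration by integral dependence
(`mem_homGE_iff_isIntegralOverSpan`): for `n = P / Q ≥ 0` the order of `r` is at least `n` if and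
only if `r ^ Q` satisfies an equation of integral dependence on `(b ^ P)`. One direction feeds the
equation back into itself. For the other, integral dependence can be tested modulo the minimal
primes (`IsIntegralOverSpan.of_minimalPrimes`), and over a Noetherian domain `r / b ^ l` is integral
because otherwise its inverse `u` would be a non-unit with the powers `u ^ M` dividing arbitrarily
small powers of `r`; lengths over a one-dimensional localization bound such divisibility linearly
(`exists_forall_pow_dvd_pow_imp_le`). No valuations are needed.

Taking symbols in these equations shows that every homogeneous element of nonnegative degree of the
localization at the class of `b` is integral (`ICogr.isIntegral_of_mem_awayDeg`). Conversely, the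
lowest term of an integral element cannot have negative degree, since it would be nilpotent
(`isNilpotent_of_monic_of_neg`) while the localization has no homogeneous nilpotents. So
`ICogr b` is the part of nonnegative degree of the localization, which gives its grading and
the periodicity (`ICogr.bijOn_mul_bClass`). The natural map is injective because the elements of
positive order lie in every minimal prime containing `b`, while modulo the other minimal primes
powers of `b` can be cancelled (`mem_homGE_of_pow_mul_mem`).

Bijectivity in high degrees amounts to divisibility by the class of `b` in the balanced associated
graded ring in high degrees (`ICogr.bijOn_attaching_of_forall`). If that ring is Noetherian, its
elements of high degree lie in a high power of the ideal of elements of positive degree, which has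
the same radical as the class of `b`. If the normalizations of the `R / p` are finite, elements of
high order become divisible by a high power of `b` in the product of these normalizations, and by
finiteness all but a bounded part of the quotient comes from `R`
(`exists_mem_homGE_of_hasFiniteNormalization`).

In the graded case `R` is a finitely generated algebra over a perfect field, and its normalization
is finite: Noether normalization reduces this to polynomial rings, where a power of Frobenius
reduces a finite extension of the field of fractions to a separable one
(`isNoetherian_integralClosure_of_iterateFrobenius_finite`). The lowest homogeneous term of an
element has at least the order of that element, which gives the double grading. Comparing degrees in
equations of integral dependence shows that the part of degree zero for the grading of `R` is
concentrated in bidegree `(0, 0)` (`ICogr.bideg_zero_eq_zero`). That part is reduced, and finite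
over `k` since multiplication by a power of `b` embeds it into a quotient of a subspace of a
homogeneous component of `R`, so it is a power of `k`. Its primitive idempotents split `ICogr b`, and
any splitting consists of primitive idempotents of this part, whence uniqueness.
-/

/-! ### Integrality over a principal ideal -/

/-- In a Noetherian domain, divisibility of `r ^ j` by `u ^ M` bounds `M` linearly in `j`. The
bound is the ratio of the lengths of `A / r` and `A / u` after localizing at a minimal prime over
`u`, where the ring becomes one-dimensional by Krull's principal ideal theorem. -/
theorem exists_forall_pow_dvd_pow_imp_le {A : Type*} [CommRing A] [IsDomain A]
    [IsNoetherianRing A] {u r : A} (hu : ¬ IsUnit u) (hu0 : u ≠ 0) (hr : r ≠ 0) :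
    ∃ v : ℕ, ∀ j M : ℕ, u ^ M ∣ r ^ j → M ≤ v * j := by
  have hne : Ideal.span {u} ≠ ⊤ := by rwa [Ne, Ideal.span_singleton_eq_top]
  obtain ⟨P, hP⟩ := Ideal.nonempty_minimalPrimes hne
  have hPp : P.IsPrime := hP.1.1
  let B := Localization.AtPrime P
  have hdim : Ring.KrullDimLE 1 B := by
    rw [Ring.KrullDimLE, Order.krullDimLE_iff]
    change ringKrullDim B ≤ _
    rw [IsLocalization.AtPrime.ringKrullDim_eq_height P B]
    exact_mod_cast Ideal.height_le_one_of_isPrincipal_of_mem_minimalPrimes _ _ hP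
  have hinj : Function.Injective (algebraMap A B) :=
    IsLocalization.injective B P.primeCompl_le_nonZeroDivisors
  have hmem : ∀ {x : A}, x ≠ 0 → algebraMap A B x ∈ nonZeroDivisors B := fun hx =>
    mem_nonZeroDivisors_of_ne_zero fun h => hx (hinj (by rw [h, map_zero]))
  have hord : 1 ≤ Ring.ord B (algebraMap A B u) := by
    rw [Order.one_le_iff_ne_zero, Ring.ord, Ne, Module.length_eq_zero_iff]
    intro h
    rw [Submodule.Quotient.subsingleton_iff, Ideal.span_singleton_eq_top,
      IsLocalization.AtPrime.isUnit_to_map_iff B P] at h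
    exact h (hP.1.2 (Ideal.mem_span_singleton_self u))
  obtain ⟨v, hv⟩ := ENat.ne_top_iff_exists.1 (Ring.ord_ne_top (hmem hr))
  refine ⟨v, fun j M ⟨d, hd⟩ => ?_⟩
  have hd0 : d ≠ 0 := by
    rintro rfl
    exact pow_ne_zero j hr (by rw [hd, mul_zero])
  have h1 := congrArg (fun x => Ring.ord B (algebraMap A B x)) hd
  simp only [map_pow, map_mul] at h1
  rw [Ring.ord_mul B (hmem hd0), Ring.ord_pow (hmem hr), Ring.ord_pow (hmem hu0), ← hv] at h1
  have h2 : (M : ℕ∞) ≤ j • (v : ℕ∞) := by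
    rw [h1]
    refine le_trans ?_ le_self_add
    simpa using mul_le_mul' (le_refl (M : ℕ∞)) hord
  rw [nsmul_eq_mul] at h2
  rw [mul_comm]
  exact_mod_cast h2

/-- If for every `t` some power `r ^ m` is divisible by a power `b ^ M` with `M / m ≥ l - 1 / t`,
then `x = r / b ^ l` is integral. Otherwise `u = x⁻¹` is not a unit of the ring `D[u]`, in which
`b ^ l = u r`, and large powers of `u` would divide small powers of `r`, against
`exists_forall_pow_dvd_pow_imp_le`. -/
theorem isIntegral_div_of_pow_dvd_pow {D K : Type*} [CommRing D] [IsDomain D] [IsNoetherianRing D]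
    [Field K] [Algebra D K] (hinj : Function.Injective (algebraMap D K)) {b r : D} {l : ℕ}
    (hb : b ≠ 0)
    (H : ∀ t : ℕ, ∃ m M : ℕ, 0 < m ∧ m * l * t ≤ M * t + m ∧ b ^ M ∣ r ^ m) :
    IsIntegral D (algebraMap D K r / algebraMap D K (b ^ l)) := by
  rcases eq_or_ne r 0 with rfl | hr
  · simpa using isIntegral_zero
  rcases Nat.eq_zero_or_pos l with rfl | hl
  · simpa using isIntegral_algebraMap
  have hne : ∀ {x : D}, x ≠ 0 → algebraMap D K x ≠ 0 := fun hx h =>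
    hx (hinj (by rw [h, map_zero]))
  have hbl : algebraMap D K (b ^ l) ≠ 0 := hne (pow_ne_zero _ hb)
  set x := algebraMap D K r / algebraMap D K (b ^ l) with hx
  have hx0 : x ≠ 0 := div_ne_zero (hne hr) hbl
  let E := Algebra.adjoin D {x⁻¹}
  have hEN : IsNoetherianRing E := by
    have : Algebra.FiniteType D E :=
      (Subalgebra.fg_iff_finiteType _).1 ⟨{x⁻¹}, by simp [E]⟩
    exact Algebra.FiniteType.isNoetherianRing D E
  let u : E := ⟨x⁻¹, Algebra.subset_adjoin rfl⟩
  have hu0 : u ≠ 0 := fun h => inv_ne_zero hx0 (congrArg Subtype.val h)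
  have hr0 : algebraMap D E r ≠ 0 := fun h => hne hr (congrArg Subtype.val h)
  have hbu : algebraMap D E (b ^ l) = u * algebraMap D E r := by
    refine Subtype.ext ?_
    change algebraMap D K (b ^ l) = x⁻¹ * algebraMap D K r
    rw [hx]
    field_simp [hne hr]
  by_cases hunit : IsUnit u
  · refine isIntegral_of_isIntegral_adjoin_of_mul_eq_one x x⁻¹ (inv_mul_cancel₀ hx0) ?_
    obtain ⟨w, hw⟩ := hunit.exists_right_inv
    have h1 : x⁻¹ * w.1 = 1 := congrArg Subtype.val hw
    have h2 : w.1 = x := by field_simp at h1; exact h1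
    have h3 : w.1 ∈ Algebra.adjoin D {x⁻¹} := w.2
    rw [h2] at h3
    exact isIntegral_algebraMap (x := (⟨x, h3⟩ : Algebra.adjoin D {x⁻¹}))
  -- otherwise large powers of the non-unit `u` divide small powers of `r`
  exfalso
  obtain ⟨v, hv⟩ := exists_forall_pow_dvd_pow_imp_le hunit hu0 hr0
  obtain ⟨m, M, hm, hle, d, hd⟩ := H (v + 2)
  have key : algebraMap D E r ^ (m * l) =
      u ^ M * algebraMap D E r ^ M * algebraMap D E d ^ l := by
    rw [← mul_pow, ← hbu, ← map_pow, ← map_pow, ← map_pow, ← map_mul, pow_mul, hd]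
    ring_nf
  rcases le_or_gt (m * l) M with h | h
  · obtain ⟨j, rfl⟩ := Nat.exists_eq_add_of_le h
    refine hunit (isUnit_of_dvd_one (a := u) ?_)
    have h3 : u ^ (m * l + j) ∣ 1 := by
      refine ⟨algebraMap D E r ^ j * algebraMap D E d ^ l, ?_⟩
      refine mul_left_cancel₀ (pow_ne_zero (m * l) hr0) ?_
      rw [mul_one]
      nth_rewrite 1 [key]
      ring
    exact (dvd_pow_self u (by positivity)).trans h3
  · obtain ⟨j, hj⟩ := Nat.exists_eq_add_of_le h.le
    have h3 : u ^ M ∣ algebraMap D E r ^ j := by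
      refine ⟨algebraMap D E d ^ l, ?_⟩
      refine mul_left_cancel₀ (pow_ne_zero M hr0) ?_
      rw [← pow_add, ← hj, key]
      ring
    have h4 := hv j M h3
    have h5 : m ≤ m * l := Nat.le_mul_of_pos_right m hl
    rw [hj] at hle h5
    -- `m ≤ M + j`, `j * (v + 2) ≤ m` and `M ≤ v * j` are incompatible with `0 < m`
    nlinarith

/-- The element `r` is integral over the ideal `(c)`: it satisfies an equation
`r ^ n + a₁ c r ^ (n - 1) + ⋯ + aₙ c ^ n = 0`. -/
def IsIntegralOverSpan {R : Type*} [CommRing R] (c r : R) : Prop :=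
  ∃ f : Polynomial R, f.Monic ∧ (f.scaleRoots c).eval r = 0

theorem Polynomial.Monic.mul_scaleRoots {R : Type*} [CommRing R] {f g : Polynomial R}
    (hf : f.Monic) (hg : g.Monic) (c : R) :
    (f * g).scaleRoots c = f.scaleRoots c * g.scaleRoots c := by
  nontriviality R
  exact Polynomial.mul_scaleRoots' _ _ _ (by rw [hf, hg]; simp)

namespace IsIntegralOverSpan

variable {R : Type*} [CommRing R] {c r : R}

/-- Integrality over a principal ideal can be tested modulo the minimal primes. -/
theorem of_minimalPrimes [IsNoetherianRing R]
    (h : ∀ p ∈ minimalPrimes R, ∃ f : Polynomial R, f.Monic ∧ (f.scaleRoots c).eval r ∈ p) :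
    IsIntegralOverSpan c r := by
  classical
  choose! f hf hfp using h
  have hfin := minimalPrimes.finite_of_isNoetherianRing R
  have hprod : ∀ s : Finset (Ideal R), (∀ p ∈ s, p ∈ minimalPrimes R) →
      (∏ p ∈ s, f p).Monic ∧
        ((∏ p ∈ s, f p).scaleRoots c).eval r = ∏ p ∈ s, ((f p).scaleRoots c).eval r := by
    intro s
    induction s using Finset.induction_on with
    | empty => simp
    | insert p s hps ih =>
      intro hs
      obtain ⟨h1, h2⟩ := ih fun q hq => hs q (Finset.mem_insert_of_mem hq)
      have hp := hf p (hs p (Finset.mem_insert_self p s))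
      rw [Finset.prod_insert hps, Finset.prod_insert hps, hp.mul_scaleRoots h1,
        Polynomial.eval_mul, h2]
      exact ⟨hp.mul h1, rfl⟩
  obtain ⟨h1, h2⟩ := hprod hfin.toFinset fun p hp => by simpa using hp
  have hnil : IsNilpotent (∏ p ∈ hfin.toFinset, ((f p).scaleRoots c).eval r) := by
    rw [← mem_nilradical, nilradical, ← Ideal.sInf_minimalPrimes, Submodule.mem_sInf]
    intro p hp
    exact Ideal.mem_of_dvd p (Finset.dvd_prod_of_mem _ (by simpa using hp)) (hfp p hp)
  obtain ⟨n, hn⟩ := hnil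
  have hpow : ∀ n : ℕ, (((∏ p ∈ hfin.toFinset, f p) ^ n).scaleRoots c).eval r =
      (∏ p ∈ hfin.toFinset, ((f p).scaleRoots c).eval r) ^ n := by
    intro n
    induction n with
    | zero => simp
    | succ n ih =>
      rw [pow_succ, (h1.pow n).mul_scaleRoots h1, Polynomial.eval_mul, ih, h2, pow_succ]
  exact ⟨_, h1.pow n, by rw [hpow, hn]⟩

/-- If the image of `r` in an extension of `R / p` is divisible by the image of `c`, with an
integral quotient, then `r` satisfies an equation of integral dependence on `(c)` modulo `p`. -/
theorem exists_eval_mem_of_isIntegral {p : Ideal R} {S : Type*} [CommRing S] [Algebra (R ⧸ p) S]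
    (hinj : Function.Injective (algebraMap (R ⧸ p) S)) {w : S} (hw : IsIntegral (R ⧸ p) w)
    (h : algebraMap (R ⧸ p) S (Ideal.Quotient.mk p r) =
      algebraMap (R ⧸ p) S (Ideal.Quotient.mk p c) * w) :
    ∃ f : Polynomial R, f.Monic ∧ (f.scaleRoots c).eval r ∈ p := by
  obtain ⟨g, hg, hgw⟩ := hw
  obtain ⟨f, hfg, -, hf⟩ := Polynomial.lifts_and_natDegree_eq_and_monic
    (Polynomial.map_surjective _ (Ideal.Quotient.mk_surjective (I := p)) g) hg
  refine ⟨f, hf, ?_⟩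
  rw [← Ideal.Quotient.eq_zero_iff_mem]
  refine hinj ?_
  rw [map_zero]
  by_cases hp : p = ⊤
  · rw [Ideal.Quotient.eq_zero_iff_mem.2 (by rw [hp]; trivial), map_zero]
  have : Nontrivial (R ⧸ p) := Ideal.Quotient.nontrivial_iff.2 hp
  have h1 : Ideal.Quotient.mk p ((f.scaleRoots c).eval r) =
      (g.scaleRoots (Ideal.Quotient.mk p c)).eval (Ideal.Quotient.mk p r) := by
    rw [← hfg, ← Polynomial.map_scaleRoots _ _ _ (by rw [hf]; simp), Polynomial.eval_map,
      Polynomial.eval₂_hom]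
  rw [h1, ← Polynomial.eval₂_hom, h, Polynomial.scaleRoots_eval₂_mul, hgw, mul_zero]

/-- In a Noetherian ring, `r` is integral over `(b ^ l)` if for every `t` some power `r ^ m` is
divisible by a power `b ^ M` with `M / m ≥ l - 1 / t`. -/
theorem of_pow_dvd_pow [IsNoetherianRing R] {b : R} {l : ℕ}
    (H : ∀ t : ℕ, ∃ m M : ℕ, 0 < m ∧ m * l * t ≤ M * t + m ∧ b ^ M ∣ r ^ m) :
    IsIntegralOverSpan (b ^ l) r := by
  refine of_minimalPrimes fun p hp => ?_
  have hpp : p.IsPrime := hp.1.1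
  rcases Nat.eq_zero_or_pos l with rfl | hl
  · exact ⟨Polynomial.X - Polynomial.C r, Polynomial.monic_X_sub_C r, by simp⟩
  by_cases hb : Ideal.Quotient.mk p b = 0
  · -- modulo `p` the element `b` vanishes, and `r` is nilpotent
    refine ⟨Polynomial.X, Polynomial.monic_X, ?_⟩
    obtain ⟨m, M, hm, hle, hdvd⟩ := H 2
    have hM : 0 < M := by
      by_contra h0
      obtain rfl : M = 0 := by omega
      have := Nat.le_mul_of_pos_right m hl
      omega
    have h1 : r ^ m ∈ p :=
      Ideal.mem_of_dvd p hdvd (Ideal.pow_mem_of_mem p (Ideal.Quotient.eq_zero_iff_mem.1 hb) M hM)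
    have h2 := hpp.mem_of_pow_mem m h1
    have h3 : (Polynomial.X : Polynomial R).scaleRoots (b ^ l) = Polynomial.X := by
      simpa using Polynomial.X_add_C_scaleRoots (0 : R) (b ^ l)
    rw [h3]
    simpa using h2
  · have hinj : Function.Injective (algebraMap (R ⧸ p) (FractionRing (R ⧸ p))) :=
      IsFractionRing.injective _ _
    refine exists_eval_mem_of_isIntegral hinj
      (isIntegral_div_of_pow_dvd_pow hinj (b := Ideal.Quotient.mk p b)
        (r := Ideal.Quotient.mk p r) (l := l) hb fun t => ?_) ?_
    · obtain ⟨m, M, hm, hle, hdvd⟩ := H t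
      exact ⟨m, M, hm, hle, by simpa using map_dvd (Ideal.Quotient.mk p) hdvd⟩
    · rw [map_pow]
      refine (mul_div_cancel₀ _ ?_).symm
      rw [map_pow]
      exact pow_ne_zero _ fun h => hb (hinj (by rw [h, map_zero]))

end IsIntegralOverSpan

/-! ### Arithmetic of the homogenized order function -/

section HomOrderArithmetic

variable {R : Type*} [CommRing R] (I : Ideal R)

theorem homOrder_pow (r : R) {k : ℕ} (hk : k ≠ 0) :
    homOrder I (r ^ k) = k * homOrder I r := by
  have hk' : (k : ℝ≥0∞) ≠ 0 := by exact_mod_cast hk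
  have h1 : Tendsto (fun n : ℕ => k * n) atTop atTop :=
    tendsto_id.const_mul_atTop' (Nat.pos_of_ne_zero hk)
  have h2 := ENNReal.Tendsto.const_mul (a := (k : ℝ≥0∞)) ((tendsto_homOrder I r).comp h1)
    (Or.inr (ENNReal.natCast_ne_top k))
  refine tendsto_nhds_unique (tendsto_homOrder I (r ^ k)) (h2.congr fun n => ?_)
  simp only [Function.comp_apply]
  rw [← pow_mul, Nat.cast_mul, ← mul_div_assoc,
    ENNReal.mul_div_mul_left _ _ hk' (ENNReal.natCast_ne_top k)]

variable {I} {r : R} {n : ℚ}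

theorem mem_homGE_iff_ofReal (hn : 0 ≤ n) :
    r ∈ homGE I n ↔ ENNReal.ofReal n ≤ homOrder I r := by
  rw [mem_homGE, ← EReal.coe_ennreal_le_coe_ennreal_iff, EReal.coe_ennreal_ofReal,
    max_eq_left (by exact_mod_cast hn)]

theorem mem_homGT_iff_ofReal (hn : 0 ≤ n) :
    r ∈ homGT I n ↔ ENNReal.ofReal n < homOrder I r := by
  rw [mem_homGT, ← EReal.coe_ennreal_lt_coe_ennreal_iff, EReal.coe_ennreal_ofReal,
    max_eq_left (by exact_mod_cast hn)]

theorem homGT_le_homGE : homGT I n ≤ homGE I n := fun _ h =>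
  (mem_homGE I).2 ((mem_homGT I).1 h).le

theorem homGE_antitone {m : ℚ} (h : m ≤ n) : homGE I n ≤ homGE I m := fun _ hr =>
  (mem_homGE I).2 (le_trans (by exact_mod_cast h) ((mem_homGE I).1 hr))

theorem homGE_le_homGT {m : ℚ} (h : m < n) : homGE I n ≤ homGT I m := fun _ hr =>
  (mem_homGT I).2 (lt_of_lt_of_le (by exact_mod_cast h) ((mem_homGE I).1 hr))

theorem mem_homGE_of_nonpos (hn : n ≤ 0) (r : R) : r ∈ homGE I n :=
  homGE_antitone hn (mem_homGE_zero I r)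

theorem pow_mem_homGE_iff {k : ℕ} (hk : k ≠ 0) : r ^ k ∈ homGE I (k * n) ↔ r ∈ homGE I n := by
  rcases le_total n 0 with hn | hn
  · exact iff_of_true (mem_homGE_of_nonpos (by
      exact mul_nonpos_of_nonneg_of_nonpos (by positivity) hn) _) (mem_homGE_of_nonpos hn _)
  rw [mem_homGE_iff_ofReal hn, mem_homGE_iff_ofReal (by positivity), homOrder_pow I r hk]
  push_cast
  rw [ENNReal.ofReal_mul (by positivity), ENNReal.ofReal_natCast,
    ENNReal.mul_le_mul_iff_right (by exact_mod_cast hk) (ENNReal.natCast_ne_top k)]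

theorem pow_mem_homGT_iff {k : ℕ} (hk : k ≠ 0) : r ^ k ∈ homGT I (k * n) ↔ r ∈ homGT I n := by
  rcases lt_or_ge n 0 with hn | hn
  · refine iff_of_true (mem_homGT_of_neg I ?_ _) (mem_homGT_of_neg I hn _)
    exact mul_neg_of_pos_of_neg (by positivity) hn
  rw [mem_homGT_iff_ofReal hn, mem_homGT_iff_ofReal (by positivity), homOrder_pow I r hk]
  push_cast
  rw [ENNReal.ofReal_mul (by positivity), ENNReal.ofReal_natCast,
    ENNReal.mul_lt_mul_iff_right (by exact_mod_cast hk) (ENNReal.natCast_ne_top k)]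

theorem pow_mem_homGE (hr : r ∈ homGE I n) (k : ℕ) : r ^ k ∈ homGE I (k * n) := by
  rcases eq_or_ne k 0 with rfl | hk
  · exact mem_homGE_of_nonpos (by simp) _
  · exact (pow_mem_homGE_iff hk).2 hr

theorem mem_homGT_iff_exists : r ∈ homGT I n ↔ ∃ m, n < m ∧ r ∈ homGE I m := by
  constructor
  · intro h
    obtain ⟨m, h1, h2⟩ := EReal.lt_iff_exists_rat_btwn.1 ((mem_homGT I).1 h)
    exact ⟨m, by exact_mod_cast h1, h2.le⟩
  · rintro ⟨m, hm, hr⟩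
    exact homGE_le_homGT hm hr

theorem mem_homGT_of_isNilpotent (hr : IsNilpotent r) (n : ℚ) : r ∈ homGT I n := by
  obtain ⟨k, hk⟩ := hr
  refine (pow_mem_homGT_iff k.succ_ne_zero).1 ?_
  rw [pow_succ, hk, zero_mul]
  exact zero_mem _

theorem mem_homGT_zero_iff : r ∈ homGT I 0 ↔ r ∈ I.radical := by
  refine ⟨fun h => homGT_zero_le_radical I h, fun ⟨k, hk⟩ => ?_⟩
  have h1 : r ^ (k + 1) ∈ homGE I 1 := mem_homGE_one I (by
    rw [pow_succ]
    exact I.mul_mem_right _ hk)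
  have h2 := homGE_le_homGT (m := 0) one_pos h1
  rw [← mul_zero ((k + 1 : ℕ) : ℚ)] at h2
  exact (pow_mem_homGT_iff k.succ_ne_zero).1 h2

end HomOrderArithmetic

/-! ### The filtration of a principal ideal through integral dependence -/

section Principal

variable {R : Type*} [CommRing R] {b r : R} {n : ℚ}

theorem pow_mem_homGE_span (b : R) (l : ℕ) : b ^ l ∈ homGE (Ideal.span {b}) l := by
  simpa using pow_mem_homGE (mem_homGE_one _ (Ideal.mem_span_singleton_self b)) l

/-- If the order `h` of `r` were less than `l`, the equation of integral dependence would turn a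
lower bound close to `h` into a larger one. -/
theorem mem_homGE_of_isIntegralOverSpan {l : ℕ} (h : IsIntegralOverSpan (b ^ l) r) :
    r ∈ homGE (Ideal.span {b}) l := by
  set I := Ideal.span {b} with hI
  obtain ⟨f, hf, hfr⟩ := h
  rcases eq_or_ne f.natDegree 0 with hk | hk
  · rw [hf.natDegree_eq_zero.1 hk] at hfr
    have h1 : (1 : R) = 0 := by simpa using hfr
    rw [← mul_one r, h1, mul_zero]
    exact zero_mem _
  set k := f.natDegree with hkdef
  by_contra hlt
  rw [mem_homGE_iff_ofReal (by positivity), not_le] at hlt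
  push_cast at hlt
  rw [ENNReal.ofReal_natCast] at hlt
  have htop : homOrder I r ≠ ∞ := ne_top_of_lt hlt
  set h := (homOrder I r).toReal with hh
  have hmem : ∀ m : ℚ, r ∈ homGE I m ↔ (m : ℝ) ≤ h := by
    intro m
    rw [mem_homGE, ← ENNReal.ofReal_toReal htop, EReal.coe_ennreal_ofReal,
      max_eq_left ENNReal.toReal_nonneg, EReal.coe_le_coe_iff]
  have hl : h < l := by
    have := (ENNReal.toReal_lt_toReal htop (ENNReal.natCast_ne_top l)).2 hlt
    simpa using this
  have hkpos : (0 : ℝ) < k := by positivity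
  -- a rational `s` slightly below `h`, so close that the equation of integral dependence
  -- improves the bound `s` to a bound larger than `h`
  obtain ⟨s, hs1, hs2⟩ := exists_rat_btwn (show h - (l - h) / k < h by
    have : 0 < (l - h) / k := div_pos (by linarith) hkpos
    linarith)
  have hrs : r ∈ homGE I s := (hmem s).2 hs2.le
  have hsl : s ≤ l := by
    have : (s : ℝ) ≤ (l : ℝ) := by linarith
    exact_mod_cast this
  have hkey : r ^ k ∈ homGE I (l + (k - 1) * s) := by
    rw [Polynomial.eval_eq_sum_range, Polynomial.natDegree_scaleRoots, ← hkdef,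
      Finset.sum_range_succ] at hfr
    have h1 : r ^ k = - ∑ i ∈ Finset.range k, (f.scaleRoots (b ^ l)).coeff i * r ^ i := by
      rw [Polynomial.coeff_scaleRoots, hkdef, hf.coeff_natDegree] at hfr
      simp only [Nat.sub_self, pow_zero, mul_one, one_mul] at hfr
      exact eq_neg_of_add_eq_zero_right hfr
    rw [h1]
    refine neg_mem (sum_mem fun i hi => ?_)
    have hik : i < k := Finset.mem_range.1 hi
    rw [Polynomial.coeff_scaleRoots, mul_assoc]
    refine Ideal.mul_mem_left _ _ ?_
    refine homGE_antitone ?_ (mul_mem_homGE I (pow_mem_homGE (pow_mem_homGE_span b l) (k - i))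
      (pow_mem_homGE hrs i))
    rw [Nat.cast_sub hik.le]
    have h2 : (i : ℚ) + 1 ≤ k := by exact_mod_cast hik
    nlinarith
  have hkey2 : r ∈ homGE I ((l + (k - 1) * s) / k) := by
    refine (pow_mem_homGE_iff hk).1 ?_
    rwa [mul_div_cancel₀ _ (by exact_mod_cast hk)]
  have h3 := (hmem _).1 hkey2
  push_cast at h3
  rw [div_le_iff₀ hkpos] at h3
  have h4 : (h - s) * k < l - h := by
    rw [← lt_div_iff₀ hkpos]
    linarith
  nlinarith

/-- In a Noetherian ring, `homOrder` is at least `l` exactly on the integral closure of the ideal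
`(b ^ l)`. -/
theorem mem_homGE_natCast_iff [IsNoetherianRing R] {l : ℕ} :
    r ∈ homGE (Ideal.span {b}) l ↔ IsIntegralOverSpan (b ^ l) r := by
  refine ⟨fun h => IsIntegralOverSpan.of_pow_dvd_pow fun t => ?_,
    mem_homGE_of_isIntegralOverSpan⟩
  rcases Nat.eq_zero_or_pos (l * t) with h0 | h0
  · exact ⟨1, 0, one_pos, by rw [mul_assoc, h0]; omega, by simp⟩
  have ht : 0 < t := Nat.pos_of_mul_pos_left h0
  rw [mem_homGE_iff_ofReal (by positivity)] at h
  push_cast at h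
  rw [ENNReal.ofReal_natCast] at h
  have ht0 : (t : ℝ≥0∞) ≠ 0 := by exact_mod_cast ht.ne'
  have hlt : ((l * t - 1 : ℕ) : ℝ≥0∞) / t < homOrder (Ideal.span {b}) r := by
    refine lt_of_lt_of_le ?_ h
    rw [ENNReal.div_lt_iff (Or.inl ht0) (Or.inl (ENNReal.natCast_ne_top t))]
    exact_mod_cast (by omega : l * t - 1 < l * t)
  obtain ⟨m, hm, hm0⟩ := (((tendsto_homOrder _ r).eventually_const_lt hlt).and
    (eventually_gt_atTop 0)).exists
  have hdvd : ∀ M : ℕ, (M : ℕ∞) ≤ adicOrder (Ideal.span {b}) (r ^ m) → b ^ M ∣ r ^ m := by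
    intro M hM
    rw [le_adicOrder_iff, Ideal.span_singleton_pow, Ideal.mem_span_singleton] at hM
    exact hM
  refine ⟨m, ?_⟩
  rcases hq : adicOrder (Ideal.span {b}) (r ^ m) with _ | M
  · refine ⟨m * l, hm0, by omega, hdvd _ ?_⟩
    rw [hq]
    exact le_top
  · refine ⟨M, hm0, ?_, hdvd _ hq.ge⟩
    rw [hq] at hm
    change _ < ((M : ℕ∞) : ℝ≥0∞) / (m : ℝ≥0∞) at hm
    have hm0' : (m : ℝ≥0∞) ≠ 0 := by exact_mod_cast hm0.ne'
    rw [ENNReal.lt_div_iff_mul_lt (Or.inl hm0') (Or.inl (ENNReal.natCast_ne_top m)),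
      ← ENNReal.mul_div_right_comm, ENNReal.div_lt_iff (Or.inl ht0)
      (Or.inl (ENNReal.natCast_ne_top t)), ENat.toENNReal_coe] at hm
    have h1 : (l * t - 1) * m < M * t := by exact_mod_cast hm
    have h2 : m * l * t = (l * t - 1) * m + m := by
      obtain ⟨u, hu⟩ : ∃ u, l * t = u + 1 := ⟨l * t - 1, by omega⟩
      rw [mul_assoc, hu, Nat.add_sub_cancel]
      ring
    omega

theorem mem_homGE_iff_isIntegralOverSpan [IsNoetherianRing R] (hn : 0 ≤ n) :
    r ∈ homGE (Ideal.span {b}) n ↔ IsIntegralOverSpan (b ^ n.num.toNat) (r ^ n.den) := by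
  rw [← mem_homGE_natCast_iff, ← pow_mem_homGE_iff n.den_ne_zero, Rat.den_mul_eq_num]
  have h : ((n.num.toNat : ℕ) : ℚ) = n.num := by
    exact_mod_cast Int.toNat_of_nonneg (Rat.num_nonneg.2 hn)
  rw [h]

/-- On the radical of `(b)`, multiplication by a power of `b` shifts the filtration strictly:
modulo the minimal primes that do not contain `b` the factor can be cancelled, and the elements of
the radical vanish modulo the others. -/
theorem mem_homGE_of_pow_mul_mem [IsNoetherianRing R] {l : ℕ}
    (hr : r ∈ (Ideal.span {b}).radical) (h : b ^ l * r ∈ homGE (Ideal.span {b}) (n + l)) :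
    r ∈ homGE (Ideal.span {b}) n := by
  rcases le_total n 0 with hn | hn
  · exact mem_homGE_of_nonpos hn r
  set P := n.num.toNat with hP
  set Q := n.den with hQ
  have hPn : ((P : ℕ) : ℚ) = Q * n := by
    rw [hQ, Rat.den_mul_eq_num]
    exact_mod_cast Int.toNat_of_nonneg (Rat.num_nonneg.2 hn)
  have h1 : b ^ (l * Q) * r ^ Q ∈ homGE (Ideal.span {b}) ((l * Q + P : ℕ) : ℚ) := by
    have h2 := pow_mem_homGE h Q
    rw [mul_pow, ← pow_mul] at h2
    convert h2 using 2
    push_cast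
    rw [hPn]
    ring
  obtain ⟨f, hf, hfr⟩ := mem_homGE_natCast_iff.1 h1
  rw [mem_homGE_iff_isIntegralOverSpan hn]
  refine IsIntegralOverSpan.of_minimalPrimes fun p hp => ?_
  have hpp : p.IsPrime := hp.1.1
  by_cases hb : b ∈ p
  · refine ⟨Polynomial.X, Polynomial.monic_X, ?_⟩
    have h3 : (Polynomial.X : Polynomial R).scaleRoots (b ^ P) = Polynomial.X := by
      simpa using Polynomial.X_add_C_scaleRoots (0 : R) (b ^ P)
    rw [h3, Polynomial.eval_X]
    refine Ideal.pow_mem_of_mem p ?_ _ n.den_pos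
    exact (hpp.radical_le_iff.2 ((Ideal.span_singleton_le_iff_mem p).2 hb)) hr
  · refine ⟨f, hf, ?_⟩
    rw [pow_add, mul_comm (b ^ (l * Q)) (b ^ P), Polynomial.scaleRoots_mul,
      Polynomial.scaleRoots_eval_mul] at hfr
    have h4 : (b ^ (l * Q)) ^ (f.scaleRoots (b ^ P)).natDegree *
        (f.scaleRoots (b ^ P)).eval (r ^ Q) ∈ p := by
      rw [hfr]
      exact zero_mem p
    refine (hpp.mem_or_mem h4).resolve_left fun h5 => hb ?_
    exact hpp.mem_of_pow_mem _ (hpp.mem_of_pow_mem _ h5)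

theorem mem_homGT_of_pow_mul_mem [IsNoetherianRing R] {l : ℕ}
    (hr : r ∈ (Ideal.span {b}).radical) (h : b ^ l * r ∈ homGT (Ideal.span {b}) (n + l)) :
    r ∈ homGT (Ideal.span {b}) n := by
  obtain ⟨m, hm, h1⟩ := mem_homGT_iff_exists.1 h
  refine mem_homGT_iff_exists.2 ⟨m - l, by linarith, mem_homGE_of_pow_mul_mem hr (l := l) ?_⟩
  rwa [sub_add_cancel]

end Principal

/-! ### Graded decompositions -/

section Graded

variable {ι S : Type*}

/-- The subgroups `𝒮 i` are independent: if finitely many elements `x i ∈ 𝒮 i` have sum zero, then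
all of them vanish. -/
def SumIndep [AddCommGroup S] (𝒮 : ι → AddSubgroup S) : Prop :=
  ∀ (F : Finset ι) (x : ι → S), (∀ i, x i ∈ 𝒮 i) → ∑ i ∈ F, x i = 0 → ∀ i ∈ F, x i = 0

theorem exists_sum_eq_of_mem_biSup [AddCommGroup S] {𝒮 : ι → AddSubgroup S} {T : Set ι} {s : S}
    (hs : s ∈ ⨆ i ∈ T, 𝒮 i) :
    ∃ (F : Finset ι) (x : ι → S), ↑F ⊆ T ∧ (∀ i, x i ∈ 𝒮 i) ∧ (∀ i ∉ F, x i = 0) ∧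
      ∑ i ∈ F, x i = s := by
  classical
  rw [iSup_subtype'] at hs
  induction hs using AddSubgroup.iSup_induction' with
  | hp i s hs =>
    refine ⟨{i.1}, Pi.single i.1 s, by simp, fun j => ?_, fun j hj => ?_, by simp⟩
    · by_cases h : j = i.1
      · subst h
        simpa using hs
      · rw [Pi.single_eq_of_ne h]
        exact zero_mem _
    · exact Pi.single_eq_of_ne (by simpa using hj) _
  | h1 => exact ⟨∅, 0, by simp, fun i => zero_mem _, by simp, by simp⟩
  | hadd s t _ _ hs ht =>
    obtain ⟨F, x, hF, hx, hx0, rfl⟩ := hs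
    obtain ⟨G, y, hG, hy, hy0, rfl⟩ := ht
    refine ⟨F ∪ G, x + y, by simp [hF, hG], fun i => add_mem (hx i) (hy i), fun i hi => ?_, ?_⟩
    · rw [Finset.notMem_union] at hi
      simp [hx0 i hi.1, hy0 i hi.2]
    · simp only [Pi.add_apply, Finset.sum_add_distrib]
      rw [Finset.sum_subset (Finset.subset_union_left (s₂ := G)) fun i _ h => hx0 i h,
        Finset.sum_subset (Finset.subset_union_right (s₁ := F)) fun i _ h => hy0 i h]

theorem exists_sum_eq_of_mem_iSup [AddCommGroup S] {𝒮 : ι → AddSubgroup S} {s : S}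
    (hs : s ∈ ⨆ i, 𝒮 i) :
    ∃ (F : Finset ι) (x : ι → S), (∀ i, x i ∈ 𝒮 i) ∧ (∀ i ∉ F, x i = 0) ∧
      ∑ i ∈ F, x i = s := by
  rw [← iSup_univ] at hs
  obtain ⟨F, x, -, h⟩ := exists_sum_eq_of_mem_biSup hs
  exact ⟨F, x, h⟩

theorem SumIndep.eq_zero_of_mem_biSup [AddCommGroup S] {𝒮 : ι → AddSubgroup S}
    (h : SumIndep 𝒮) {T : Set ι} {i : ι} (hi : i ∉ T) {s : S} (hs : s ∈ 𝒮 i)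
    (hsT : s ∈ ⨆ j ∈ T, 𝒮 j) : s = 0 := by
  classical
  obtain ⟨F, x, hF, hx, -, rfl⟩ := exists_sum_eq_of_mem_biSup hsT
  have hiF : i ∉ F := fun h => hi (hF h)
  have h1 := h (insert i F) (Function.update x i (-∑ i ∈ F, x i)) (fun j => by
    by_cases hj : j = i
    · subst hj
      simpa using hs
    · rw [Function.update_of_ne hj]
      exact hx j) (by
    rw [Finset.sum_insert hiF, Function.update_self]
    have h2 : ∑ j ∈ F, Function.update x i (-∑ i ∈ F, x i) j = ∑ j ∈ F, x j :=
      Finset.sum_congr rfl fun j hj => Function.update_of_ne (ne_of_mem_of_not_mem hj hiF) _ _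
    rw [h2]
    exact neg_add_cancel _) i (Finset.mem_insert_self i F)
  rw [Function.update_self] at h1
  exact neg_eq_zero.1 h1

theorem SumIndep.eq_of_sum_eq [AddCommGroup S] {𝒮 : ι → AddSubgroup S} (h : SumIndep 𝒮)
    {F : Finset ι} {x : ι → S} (hx : ∀ i, x i ∈ 𝒮 i) {i : ι} (hi : i ∈ F) {s : S}
    (hs : s ∈ 𝒮 i) (hsum : ∑ i ∈ F, x i = s) : x i = s := by
  classical
  have h1 := h F (x - Pi.single i s) (fun j => by
    by_cases hj : j = i
    · subst hj
      simpa using sub_mem (hx j) hs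
    · simpa [Pi.single_eq_of_ne hj] using hx j) (by
    simp only [Pi.sub_apply, Finset.sum_sub_distrib]
    rw [Finset.sum_pi_single', if_pos hi, hsum, sub_self]) i hi
  simpa [sub_eq_zero] using h1

theorem SumIndep.comap [AddCommGroup S] {𝒮 : ι → AddSubgroup S} (h : SumIndep 𝒮) {T : Type*}
    [AddCommGroup T] {φ : T →+ S} (hφ : Function.Injective φ) :
    SumIndep fun i => (𝒮 i).comap φ := by
  intro F x hx hsum i hi
  refine hφ ?_
  rw [map_zero]
  exact h F (fun i => φ (x i)) hx (by rw [← map_sum, hsum, map_zero]) i hi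

theorem nonempty_gradedRing [DecidableEq ι] [AddMonoid ι] [Ring S] (𝒮 : ι → AddSubgroup S)
    [SetLike.GradedMonoid 𝒮] (hind : SumIndep 𝒮) (hspan : ∀ s, s ∈ ⨆ i, 𝒮 i) :
    Nonempty (GradedRing 𝒮) := by
  classical
  have h : DirectSum.IsInternal 𝒮 := by
    constructor
    · rw [injective_iff_map_eq_zero]
      intro x hx
      rw [DirectSum.coeAddMonoidHom_eq_dfinsuppSum, DFinsupp.sum] at hx
      refine DFinsupp.ext fun i => ?_
      by_cases hi : i ∈ DFinsupp.support x
      · exact Subtype.ext (hind _ (fun i => (x i : S)) (fun i => (x i).2) hx i hi)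
      · simpa using hi
    · intro s
      obtain ⟨F, x, hx, -, rfl⟩ := exists_sum_eq_of_mem_iSup (hspan s)
      refine ⟨∑ i ∈ F, DirectSum.of (fun i => 𝒮 i) i ⟨x i, hx i⟩, ?_⟩
      rw [map_sum]
      exact Finset.sum_congr rfl fun i _ => DirectSum.coeAddMonoidHom_of _ _ _
  exact ⟨{ (inferInstance : SetLike.GradedMonoid 𝒮), h.chooseDecomposition with }⟩

theorem mul_mem_biSup [AddMonoid ι] [Ring S] {𝒮 : ι → AddSubgroup S}
    [SetLike.GradedMonoid 𝒮] {T U V : Set ι} (hTU : ∀ i ∈ T, ∀ j ∈ U, i + j ∈ V) {s t : S}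
    (hs : s ∈ ⨆ i ∈ T, 𝒮 i) (ht : t ∈ ⨆ i ∈ U, 𝒮 i) : s * t ∈ ⨆ i ∈ V, 𝒮 i := by
  obtain ⟨F, x, hF, hx, -, rfl⟩ := exists_sum_eq_of_mem_biSup hs
  obtain ⟨G, y, hG, hy, -, rfl⟩ := exists_sum_eq_of_mem_biSup ht
  rw [Finset.sum_mul_sum]
  exact sum_mem fun i hi => sum_mem fun j hj =>
    AddSubgroup.mem_iSup_of_mem (i + j) (AddSubgroup.mem_iSup_of_mem (hTU i (hF hi) j (hG hj))
      (SetLike.GradedMul.mul_mem (hx i) (hy j)))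

theorem mem_biSup_of_mem [AddCommGroup S] {𝒮 : ι → AddSubgroup S} {T : Set ι} {i : ι}
    (hi : i ∈ T) {s : S} (hs : s ∈ 𝒮 i) : s ∈ ⨆ i ∈ T, 𝒮 i :=
  AddSubgroup.mem_iSup_of_mem i (AddSubgroup.mem_iSup_of_mem hi hs)

/-- The lowest term of a power is the power of the lowest term. -/
theorem add_pow_sub_pow_mem_biSup [AddCommMonoid ι] [LinearOrder ι]
    [IsOrderedCancelAddMonoid ι] [CommRing S] {𝒮 : ι → AddSubgroup S} [SetLike.GradedMonoid 𝒮]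
    {a : ι} {s w : S} (hs : s ∈ 𝒮 a) (hw : w ∈ ⨆ i ∈ Set.Ioi a, 𝒮 i) (k : ℕ) :
    (s + w) ^ k - s ^ k ∈ ⨆ i ∈ Set.Ioi (k • a), 𝒮 i := by
  induction k with
  | zero => simp
  | succ k ih =>
    have h : (s + w) ^ (k + 1) - s ^ (k + 1) =
        ((s + w) ^ k - s ^ k) * (s + w) + s ^ k * w := by ring
    rw [h]
    have hsw : s + w ∈ ⨆ i ∈ Set.Ici a, 𝒮 i :=
      add_mem (mem_biSup_of_mem Set.self_mem_Ici hs)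
        (biSup_mono (f := 𝒮) (fun i (hi : i ∈ Set.Ioi a) => Set.Ioi_subset_Ici_self hi) hw)
    have hsk : s ^ k ∈ ⨆ i ∈ Set.Ici (k • a), 𝒮 i :=
      mem_biSup_of_mem Set.self_mem_Ici (SetLike.pow_mem_graded k hs)
    refine add_mem (mul_mem_biSup ?_ ih hsw) (mul_mem_biSup ?_ hsk hw)
    · intro i hi j hj
      rw [Set.mem_Ioi, succ_nsmul]
      exact add_lt_add_of_lt_of_le hi hj
    · intro i hi j hj
      rw [Set.mem_Ioi, succ_nsmul]
      exact add_lt_add_of_le_of_lt hi hj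

/-- If an element whose lowest term `s` has negative degree satisfies a monic equation with
coefficients in nonnegative degrees, then `s` is nilpotent: compare the terms of lowest degree. -/
theorem isNilpotent_of_monic_of_neg [AddCommGroup ι] [LinearOrder ι] [IsOrderedAddMonoid ι]
    [CommRing S] {𝒮 : ι → AddSubgroup S} [SetLike.GradedMonoid 𝒮] (hind : SumIndep 𝒮) {a : ι}
    (ha : a < 0) {s w : S} (hs : s ∈ 𝒮 a) (hw : w ∈ ⨆ i ∈ Set.Ioi a, 𝒮 i)
    {A : Type*} [CommRing A] [Algebra A S] (hA : ∀ c : A, algebraMap A S c ∈ ⨆ i ∈ Set.Ici 0, 𝒮 i)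
    (h : IsIntegral A (s + w)) : IsNilpotent s := by
  obtain ⟨f, hf, hfs⟩ := h
  rw [Polynomial.eval₂_eq_sum_range, Finset.sum_range_succ, hf.coeff_natDegree, map_one,
    one_mul] at hfs
  set k := f.natDegree
  refine ⟨k, hind.eq_zero_of_mem_biSup (T := Set.Ioi (k • a)) (by simp)
    (SetLike.pow_mem_graded k hs) ?_⟩
  have h1 : s ^ k = -((s + w) ^ k - s ^ k) -
      ∑ i ∈ Finset.range k, algebraMap A S (f.coeff i) * (s + w) ^ i := by
    rw [eq_sub_iff_add_eq, eq_neg_iff_add_eq_zero, ← hfs]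
    ring
  rw [h1]
  refine sub_mem (neg_mem (add_pow_sub_pow_mem_biSup hs hw k)) (sum_mem fun i hi => ?_)
  have h2 : (s + w) ^ i ∈ ⨆ j ∈ Set.Ici (i • a), 𝒮 j := by
    rw [← sub_add_cancel ((s + w) ^ i) (s ^ i)]
    refine add_mem (biSup_mono (f := 𝒮)
      (fun j (hj : j ∈ Set.Ioi (i • a)) => Set.Ioi_subset_Ici_self hj)
      (add_pow_sub_pow_mem_biSup hs hw i)) ?_
    exact mem_biSup_of_mem Set.self_mem_Ici (SetLike.pow_mem_graded i hs)
  refine mul_mem_biSup ?_ (hA _) h2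
  intro x hx y hy
  have h3 : k • a < i • a := by
    obtain ⟨j, hj⟩ := Nat.exists_eq_add_of_lt (Finset.mem_range.1 hi)
    rw [hj, add_assoc, add_nsmul]
    exact add_lt_of_neg_right _ (nsmul_neg ha (by omega))
  exact h3.trans_le (le_add_of_nonneg_of_le hx hy)

end Graded

/-! ### Graded localizations -/

section AwayDeg

variable {ι S : Type*} [CommRing S]

instance awayDeg.instGradedMonoid [AddCommMonoid ι] (𝒮 : ι → AddSubgroup S)
    [SetLike.GradedMonoid 𝒮] {δ : ι} {f : S} (hf : f ∈ 𝒮 δ) :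
    SetLike.GradedMonoid (awayDeg 𝒮 hf) where
  one_mem := ⟨0, 1, by simpa using SetLike.GradedOne.one_mem (A := 𝒮), by simp⟩
  mul_mem i j x y := by
    rintro ⟨l, s, hs, hx⟩ ⟨m, t, ht, hy⟩
    refine ⟨l + m, s * t, ?_, ?_⟩
    · have := SetLike.GradedMul.mul_mem hs ht
      rwa [add_add_add_comm, ← add_smul] at this
    · rw [map_mul, ← hx, ← hy, pow_add, map_mul]
      ring

theorem isUnit_algebraMap_away (f : S) (l : ℕ) :
    IsUnit (algebraMap S (Localization.Away f) (f ^ l)) := by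
  rw [map_pow]
  exact (IsLocalization.Away.algebraMap_isUnit f).pow l

theorem algebraMap_away_eq_zero_iff {f s : S} :
    algebraMap S (Localization.Away f) s = 0 ↔ ∃ m : ℕ, f ^ m * s = 0 := by
  rw [IsLocalization.map_eq_zero_iff (Submonoid.powers f)]
  constructor
  · rintro ⟨⟨_, m, rfl⟩, h⟩
    exact ⟨m, h⟩
  · rintro ⟨m, h⟩
    exact ⟨⟨_, m, rfl⟩, h⟩

theorem sumIndep_awayDeg [AddCommMonoid ι] [IsCancelAdd ι] {𝒮 : ι → AddSubgroup S}
    [SetLike.GradedMonoid 𝒮] (h : SumIndep 𝒮) {δ : ι} {f : S} (hf : f ∈ 𝒮 δ) :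
    SumIndep (awayDeg 𝒮 hf) := by
  classical
  intro F x hx hsum i hi
  choose l s hs hxs using hx
  -- bring the fractions to the common denominator `f ^ L`
  let L := ∑ i ∈ F, l i
  have hL : ∀ i ∈ F, l i ≤ L := fun i hi => Finset.single_le_sum (fun _ _ => Nat.zero_le _) hi
  let t : ι → S := fun i => s i * f ^ (L - l i)
  have ht : ∀ i ∈ F, x i * algebraMap S (Localization.Away f) (f ^ L) =
      algebraMap S (Localization.Away f) (t i) := by
    intro i hi
    rw [map_mul, ← hxs, mul_assoc, ← map_mul, ← pow_add, Nat.add_sub_cancel' (hL i hi)]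
  have htd : ∀ i ∈ F, t i ∈ 𝒮 (i + L • δ) := by
    intro i hi
    have := SetLike.GradedMul.mul_mem (hs i) (SetLike.pow_mem_graded (L - l i) hf)
    rwa [add_assoc, ← add_smul, Nat.add_sub_cancel' (hL i hi)] at this
  have h1 : algebraMap S (Localization.Away f) (∑ i ∈ F, t i) = 0 := by
    rw [map_sum, ← Finset.sum_congr rfl ht, ← Finset.sum_mul, hsum, zero_mul]
  obtain ⟨m, hm⟩ := algebraMap_away_eq_zero_iff.1 h1
  rw [Finset.mul_sum] at hm
  have hinj : Function.Injective fun i : ι => i + (m + L) • δ := add_left_injective _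
  let u : ι → S := Function.extend (fun i : ι => i + (m + L) • δ)
    (fun i => if i ∈ F then f ^ m * t i else 0) 0
  have hu : ∀ i ∈ F, u (i + (m + L) • δ) = f ^ m * t i := fun i hi =>
    (hinj.extend_apply _ _ i).trans (if_pos hi)
  have h2 := h (F.map ⟨_, hinj⟩) u (fun j => by
    by_cases hj : ∃ i, i + (m + L) • δ = j
    · obtain ⟨i, rfl⟩ := hj
      by_cases hi : i ∈ F
      · rw [hu i hi]
        have := SetLike.GradedMul.mul_mem (SetLike.pow_mem_graded m hf) (htd i hi)
        rwa [add_left_comm, ← add_smul] at this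
      · have h3 : u (i + (m + L) • δ) = 0 := (hinj.extend_apply _ _ i).trans (if_neg hi)
        rw [h3]
        exact zero_mem _
    · have h3 : u j = 0 := Function.extend_apply' _ _ _ hj
      rw [h3]
      exact zero_mem _) (by
    rw [Finset.sum_map]
    exact (Finset.sum_congr rfl fun i hi => hu i hi).trans hm) (i + (m + L) • δ)
    (Finset.mem_map.2 ⟨i, hi, rfl⟩)
  rw [hu i hi] at h2
  have h3 := algebraMap_away_eq_zero_iff.2 ⟨m, h2⟩
  rw [← ht i hi] at h3
  exact (isUnit_algebraMap_away f L).mul_left_eq_zero.1 h3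

theorem mem_iSup_awayDeg [AddCommGroup ι] {𝒮 : ι → AddSubgroup S} [SetLike.GradedMonoid 𝒮]
    (hspan : ∀ s, s ∈ ⨆ i, 𝒮 i) {δ : ι} {f : S} (hf : f ∈ 𝒮 δ) (x : Localization.Away f) :
    x ∈ ⨆ i, awayDeg 𝒮 hf i := by
  obtain ⟨l, s, hx⟩ := IsLocalization.Away.surj f x
  obtain ⟨u, hu⟩ := isUnit_algebraMap_away f l
  rw [← map_pow, ← hu] at hx
  rw [← Units.eq_mul_inv_iff_mul_eq] at hx
  obtain ⟨F, y, hy, -, rfl⟩ := exists_sum_eq_of_mem_iSup (hspan s)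
  rw [hx, map_sum, Finset.sum_mul]
  refine sum_mem fun i _ => AddSubgroup.mem_iSup_of_mem (i - l • δ) ⟨l, y i, ?_, ?_⟩
  · rw [sub_add_cancel]
    exact hy i
  · rw [← hu, Units.inv_mul_cancel_right]

end AwayDeg

/-! ### The balanced associated graded ring -/

namespace Ogr

section

variable {R : Type*} [CommRing R] (I : Ideal R)

theorem of_injective (n : ℚ) : Function.Injective (of I n) :=
  DirectSum.of_injective (β := OgrPiece I) n

theorem symb_eq_zero_iff {n : ℚ} {r : R} (hr : r ∈ homGE I n) :
    symb I n r hr = 0 ↔ r ∈ homGT I n := by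
  refine ⟨fun h => ?_, symb_eq_zero_of_mem I hr⟩
  have h1 : OgrPiece.mk I n ⟨r, hr⟩ = 0 := by
    refine of_injective I n ?_
    rw [map_zero]
    exact h
  rw [OgrPiece.mk_eq_zero] at h1
  exact h1

theorem symb_sum {ι : Type*} (F : Finset ι) (n : ℚ) (r : ι → R) (hr : ∀ i, r i ∈ homGE I n) :
    ∑ i ∈ F, symb I n (r i) (hr i) = symb I n (∑ i ∈ F, r i) (sum_mem fun i _ => hr i) := by
  classical
  induction F using Finset.induction_on with
  | empty =>
    rw [Finset.sum_empty]
    exact (symb_eq_zero_of_mem I _ (by simp)).symm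
  | insert i F hi ih =>
    rw [Finset.sum_insert hi, ih, symb_add]
    exact symb_congr I rfl (Finset.sum_insert hi).symm _ _

theorem symb_pow (n : ℚ) (r : R) (hr : r ∈ homGE I n) (k : ℕ) :
    symb I n r hr ^ k = symb I (k * n) (r ^ k) (pow_mem_homGE hr k) := by
  induction k with
  | zero =>
    rw [pow_zero, one_eq_symb]
    exact symb_congr I (by simp) (pow_zero r).symm _ _
  | succ k ih =>
    rw [pow_succ, ih, symb_mul]
    exact symb_congr I (by push_cast; ring) (pow_succ r k).symm _ _

theorem fromBase_mul_symb (a : R) (n : ℚ) (r : R) (hr : r ∈ homGE I n) :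
    fromBase I a * symb I n r hr = symb I n (a * r) (Ideal.mul_mem_left _ _ hr) := by
  change symb I 0 a _ * _ = _
  rw [symb_mul]
  exact symb_congr I (zero_add n) rfl _ _

theorem sumIndep_deg : SumIndep (deg I) := by
  intro F x hx hsum i hi
  choose y hy using hx
  have h1 : (∑ i ∈ F, DirectSum.of (OgrPiece I) i (y i) : ⨁ n, OgrPiece I n) = 0 := by
    refine Eq.trans ?_ hsum
    exact Finset.sum_congr rfl fun i _ => hy i
  have h2 := congrArg (fun z : ⨁ n, OgrPiece I n => z i) h1
  simp only [DirectSum.zero_apply] at h2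
  rw [DirectSum.sum_apply, Finset.sum_eq_single i
    (fun j _ hj => DirectSum.of_eq_of_ne _ _ _ hj.symm) (fun h => absurd hi h),
    DirectSum.of_eq_same] at h2
  rw [← hy i, h2, map_zero]

theorem mem_iSup_deg (x : Ogr I) : x ∈ ⨆ n, deg I n := by
  induction x using DirectSum.induction_on with
  | zero => exact zero_mem _
  | of n y => exact AddSubgroup.mem_iSup_of_mem n ⟨y, rfl⟩
  | add x y hx hy => exact add_mem hx hy

theorem nonempty_gradedRing_deg : Nonempty (GradedRing (deg I)) :=
  nonempty_gradedRing _ (sumIndep_deg I) (mem_iSup_deg I)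

theorem eq_zero_of_mem_deg_of_neg {n : ℚ} (hn : n < 0) {x : Ogr I} (hx : x ∈ deg I n) : x = 0 := by
  obtain ⟨r, hr, rfl⟩ := (mem_deg_iff I).1 hx
  exact symb_eq_zero_of_mem I hr (mem_homGT_of_neg I hn r)

theorem toRadical_symb_zero (r : R) (hr : r ∈ homGE I 0) :
    toRadical I (symb I 0 r hr) = Ideal.Quotient.mk I.radical r := by
  have h : toRadical I (symb I 0 r hr) = toRadicalPiece I 0 (OgrPiece.mk I 0 ⟨r, hr⟩) :=
    DirectSum.toAddMonoid_of _ _ _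
  rw [h, toRadicalPiece_zero]

theorem toRadical_of_ne {n : ℚ} (hn : n ≠ 0) {x : Ogr I} (hx : x ∈ deg I n) :
    toRadical I x = 0 := by
  obtain ⟨y, rfl⟩ := hx
  have h : toRadical I (of I n y) = toRadicalPiece I n y := DirectSum.toAddMonoid_of _ _ _
  rw [h, toRadicalPiece_of_ne I hn]

end

section Principal

variable {R : Type*} [CommRing R] {b : R}

theorem bClass_pow (b : R) (l : ℕ) :
    bClass b ^ l = symb (Ideal.span {b}) l (b ^ l) (pow_mem_homGE_span b l) := by
  rw [bClass, symb_pow]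
  exact symb_congr _ (mul_one _) rfl _ _

theorem pow_mul_mem_homGE {n : ℚ} {r : R} (hr : r ∈ homGE (Ideal.span {b}) n) (l : ℕ) :
    b ^ l * r ∈ homGE (Ideal.span {b}) (n + l) := by
  rw [add_comm]
  exact mul_mem_homGE _ (pow_mem_homGE_span b l) hr

theorem bClass_pow_mul_symb {n : ℚ} {r : R} (hr : r ∈ homGE (Ideal.span {b}) n) (l : ℕ) :
    bClass b ^ l * symb _ n r hr = symb _ (n + l) (b ^ l * r) (pow_mul_mem_homGE hr l) := by
  rw [bClass_pow, symb_mul]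
  exact symb_congr _ (add_comm _ _) rfl _ _

/-- The symbol of an element integral over `(b ^ l)` is integral over the ideal generated by
`bClass b ^ l`: take the symbols of the equation of integral dependence. -/
theorem isIntegralOverSpan_symb {l : ℕ} {r : R} (h : IsIntegralOverSpan (b ^ l) r)
    (hr : r ∈ homGE (Ideal.span {b}) l) :
    IsIntegralOverSpan (bClass b ^ l) (symb (Ideal.span {b}) l r hr) := by
  set I := Ideal.span {b}
  obtain ⟨f, hf, hfr⟩ := h
  refine ⟨f.map (fromBase I), hf.map _, ?_⟩
  rcases subsingleton_or_nontrivial (Ogr I) with hs | hs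
  · exact Subsingleton.elim _ _
  have hdeg : (f.map (fromBase I)).natDegree = f.natDegree := hf.natDegree_map _
  rw [Polynomial.eval_eq_sum_range, Polynomial.natDegree_scaleRoots] at hfr ⊢
  rw [hdeg]
  set k := f.natDegree
  have hterm : ∀ i : ℕ, (f.scaleRoots (b ^ l)).coeff (min i k) * r ^ (min i k) ∈
      homGE I (k * l) := by
    intro i
    rw [Polynomial.coeff_scaleRoots, mul_assoc]
    refine Ideal.mul_mem_left _ _ ?_
    have h1 := mul_mem_homGE I (pow_mem_homGE (pow_mem_homGE_span b l) (k - min i k))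
      (pow_mem_homGE hr (min i k))
    rwa [← add_mul, ← Nat.cast_add, Nat.sub_add_cancel (min_le_right i k)] at h1
  have hsum := symb_sum I (Finset.range (k + 1)) (k * l : ℚ) _ hterm
  have hmin : ∀ i ∈ Finset.range (k + 1), min i k = i := fun i hi =>
    min_eq_left (Nat.lt_succ_iff.1 (Finset.mem_range.1 hi))
  have hz : symb I (k * l : ℚ) (∑ i ∈ Finset.range (k + 1),
      (f.scaleRoots (b ^ l)).coeff (min i k) * r ^ (min i k))
      (sum_mem fun i _ => hterm i) = 0 := by
    refine symb_eq_zero_of_mem I _ ?_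
    rw [Finset.sum_congr rfl fun i hi => by rw [hmin i hi], hfr]
    exact zero_mem _
  rw [← hz, ← hsum]
  refine Finset.sum_congr rfl fun i hi => ?_
  rw [Polynomial.coeff_scaleRoots, Polynomial.coeff_map, hdeg, bClass_pow, symb_pow, symb_pow,
    mul_assoc, symb_mul, fromBase_mul_symb]
  refine symb_congr I ?_ ?_ _ _
  · rw [← add_mul, ← Nat.cast_add, Nat.sub_add_cancel (Nat.lt_succ_iff.1 (Finset.mem_range.1 hi))]
  · rw [hmin i hi, Polynomial.coeff_scaleRoots, mul_assoc]

end Principal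

end Ogr

/-! ### The localization at the class of `b` -/

namespace ICogr

section

variable {R : Type*} [CommRing R] {b : R}

/-- The localization map from the balanced associated graded ring. -/
noncomputable abbrev toAway (b : R) :
    Ogr (Ideal.span {b}) →+* Localization.Away (Ogr.bClass b) :=
  algebraMap (Ogr (Ideal.span {b})) (Localization.Away (Ogr.bClass b))

/-- The homogeneous elements of degree `n` of the localization at the class of `b`. -/
noncomputable abbrev locDeg (b : R) (n : ℚ) : AddSubgroup (Localization.Away (Ogr.bClass b)) :=
  awayDeg (Ogr.deg (Ideal.span {b})) (Ogr.bClass_mem_deg b) n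

theorem mem_awayDeg_iff {n : ℚ} {x : Localization.Away (Ogr.bClass b)} :
    x ∈ locDeg b n ↔ ∃ (l : ℕ) (r : R) (hr : r ∈ homGE (Ideal.span {b}) (n + l)),
      x * toAway b (Ogr.bClass b ^ l) = toAway b (Ogr.symb _ (n + l) r hr) := by
  constructor
  · rintro ⟨l, s, hs, hx⟩
    rw [nsmul_one] at hs
    obtain ⟨r, hr, rfl⟩ := (Ogr.mem_deg_iff _).1 hs
    exact ⟨l, r, hr, hx⟩
  · rintro ⟨l, r, hr, hx⟩
    refine ⟨l, _, ?_, hx⟩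
    rw [nsmul_one]
    exact Ogr.symb_mem_deg _ _ _ _

theorem algebraMap_symb_eq_zero_iff {n : ℚ} {r : R} (hr : r ∈ homGE (Ideal.span {b}) n) :
    toAway b (Ogr.symb _ n r hr) = 0 ↔ ∃ m : ℕ, b ^ m * r ∈ homGT (Ideal.span {b}) (n + m) := by
  rw [algebraMap_away_eq_zero_iff]
  refine exists_congr fun m => ?_
  rw [Ogr.bClass_pow_mul_symb, Ogr.symb_eq_zero_iff]

theorem algebraMap_mem_awayDeg {n : ℚ} {s : Ogr (Ideal.span {b})}
    (hs : s ∈ Ogr.deg (Ideal.span {b}) n) : toAway b s ∈ locDeg b n :=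
  ⟨0, s, by simpa using hs, by simp⟩

theorem sumIndep_awayDeg : SumIndep (locDeg b) := _root_.sumIndep_awayDeg (Ogr.sumIndep_deg _) _

/-- The localization has no homogeneous nilpotents, since `homOrder` is homogeneous. -/
theorem eq_zero_of_pow_eq_zero {n : ℚ} {x : Localization.Away (Ogr.bClass b)} (hx : x ∈ locDeg b n)
    (h : IsNilpotent x) : x = 0 := by
  obtain ⟨k, hk⟩ := h
  obtain ⟨l, r, hr, hxr⟩ := mem_awayDeg_iff.1 hx
  have h1 : toAway b (Ogr.symb _ (n + l) r hr ^ (k + 1)) = 0 := by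
    rw [map_pow, ← hxr, mul_pow, pow_succ, hk, zero_mul, zero_mul]
  rw [Ogr.symb_pow, algebraMap_symb_eq_zero_iff] at h1
  obtain ⟨m, hm⟩ := h1
  have h2 : toAway b (Ogr.symb _ (n + l) r hr) = 0 := by
    rw [algebraMap_symb_eq_zero_iff]
    refine ⟨m, (pow_mem_homGT_iff k.succ_ne_zero).1 ?_⟩
    have h3 := mul_mem_homGT_right (Ideal.span {b}) (pow_mem_homGE_span b (m * k)) hm
    have h4 : (b ^ m * r) ^ (k + 1) = b ^ (m * k) * (b ^ m * r ^ (k + 1)) := by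
      rw [mul_pow, ← mul_assoc, ← pow_mul, ← pow_add, Nat.mul_succ]
    have h5 : ((k + 1 : ℕ) : ℚ) * (n + l + m) = (m * k : ℕ) + ((k + 1 : ℕ) * (n + l) + m) := by
      push_cast
      ring
    rw [Nat.succ_eq_add_one, h4, h5]
    exact h3
  rw [h2] at hxr
  exact (isUnit_algebraMap_away _ l).mul_left_eq_zero.1 hxr

/-- Homogeneous elements of nonnegative degree are integral: if `x = r / b ^ l` has degree `P / Q`,
then `r ^ Q` is integral over `(b ^ (P + l Q))`, and dividing the equation for its symbol by powers
of `b` gives one for `x ^ Q`. -/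
theorem isIntegral_of_mem_awayDeg [IsNoetherianRing R] {n : ℚ} (hn : 0 ≤ n)
    {x : Localization.Away (Ogr.bClass b)} (hx : x ∈ locDeg b n) :
    IsIntegral (Ogr (Ideal.span {b})) x := by
  obtain ⟨l, r, hr, hxr⟩ := mem_awayDeg_iff.1 hx
  set P := n.num.toNat
  set Q := n.den with hQ
  have hPn : ((P : ℕ) : ℚ) = Q * n := by
    rw [hQ, Rat.den_mul_eq_num]
    exact_mod_cast Int.toNat_of_nonneg (Rat.num_nonneg.2 hn)
  have hdeg : (Q : ℚ) * (n + l) = (P + l * Q : ℕ) := by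
    push_cast
    rw [hPn]
    ring
  have hrQ : r ^ Q ∈ homGE (Ideal.span {b}) ((P + l * Q : ℕ) : ℚ) := by
    rw [← hdeg]
    exact pow_mem_homGE hr Q
  obtain ⟨f, hf, hfr⟩ := Ogr.isIntegralOverSpan_symb (mem_homGE_natCast_iff.1 hrQ) hrQ
  have hxQ : toAway b (Ogr.symb _ _ (r ^ Q) hrQ) = toAway b (Ogr.bClass b ^ (l * Q)) * x ^ Q := by
    rw [pow_mul (Ogr.bClass b), map_pow, mul_comm (_ ^ Q), ← mul_pow, hxr, ← map_pow, Ogr.symb_pow]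
    exact congrArg (toAway b) (Ogr.symb_congr _ hdeg.symm rfl _ _)
  refine IsIntegral.of_pow n.den_pos ⟨f.scaleRoots (Ogr.bClass b ^ P),
    (Polynomial.monic_scaleRoots_iff _).2 hf, ?_⟩
  rw [pow_add, Polynomial.scaleRoots_mul] at hfr
  have h1 := congrArg (toAway b) hfr
  rw [← Polynomial.eval₂_hom, hxQ, Polynomial.scaleRoots_eval₂_mul, map_zero, ← map_pow,
    ← pow_mul] at h1
  exact (isUnit_algebraMap_away _ _).mul_right_eq_zero.1 h1

theorem algebraMap_mem_biSup (c : Ogr (Ideal.span {b})) :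
    toAway b c ∈ ⨆ n ∈ Set.Ici (0 : ℚ), locDeg b n := by
  obtain ⟨F, x, hx, -, rfl⟩ := exists_sum_eq_of_mem_iSup (Ogr.mem_iSup_deg _ c)
  rw [map_sum]
  refine sum_mem fun n _ => ?_
  rcases lt_or_ge n 0 with hn | hn
  · rw [Ogr.eq_zero_of_mem_deg_of_neg _ hn (hx n), map_zero]
    exact zero_mem _
  · exact mem_biSup_of_mem (T := Set.Ici 0) hn (algebraMap_mem_awayDeg (hx n))

/-- An integral element has no terms of negative degree: such a term of lowest degree would be
nilpotent. -/
theorem mem_biSup_of_isIntegral [IsNoetherianRing R] {x : Localization.Away (Ogr.bClass b)}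
    (hx : IsIntegral (Ogr (Ideal.span {b})) x) : x ∈ ⨆ n ∈ Set.Ici (0 : ℚ), locDeg b n := by
  classical
  obtain ⟨F, y, hy, -, rfl⟩ := exists_sum_eq_of_mem_iSup
    (mem_iSup_awayDeg (Ogr.mem_iSup_deg _) (Ogr.bClass_mem_deg b) x)
  induction F using Finset.induction_on_min with
  | empty => simp
  | insert a F hF ih =>
    have haF : a ∉ F := fun h => lt_irrefl a (hF a h)
    rw [Finset.sum_insert haF] at hx ⊢
    rcases lt_or_ge a 0 with ha | ha
    · have h0 : y a = 0 := eq_zero_of_pow_eq_zero (hy a)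
        (isNilpotent_of_monic_of_neg sumIndep_awayDeg ha (hy a)
          (sum_mem fun i hi => mem_biSup_of_mem (T := Set.Ioi a) (hF i hi) (hy i))
          algebraMap_mem_biSup hx)
      rw [h0, zero_add] at hx ⊢
      exact ih hx
    · have h1 : y a + ∑ i ∈ F, y i - y a = ∑ i ∈ F, y i := by ring
      refine add_mem (mem_biSup_of_mem (T := Set.Ici 0) ha (hy a)) (ih ?_)
      rw [← h1]
      exact hx.sub (isIntegral_of_mem_awayDeg ha (hy a))

/-! ### The integral closure: grading, periodicity, injectivity -/

instance : SetLike.GradedMonoid (deg b) where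
  one_mem := SetLike.GradedOne.one_mem (A := locDeg b)
  mul_mem _ _ _ _ hx hy := SetLike.GradedMul.mul_mem (A := locDeg b) hx hy

theorem sumIndep_deg : SumIndep (deg b) :=
  sumIndep_awayDeg.comap (φ := (ICogr b).val.toRingHom.toAddMonoidHom) Subtype.val_injective

theorem deg_eq_zero_of_neg [IsNoetherianRing R] {n : ℚ} (hn : n < 0) {x : ICogr b}
    (hx : x ∈ deg b n) : x = 0 :=
  Subtype.ext (sumIndep_awayDeg.eq_zero_of_mem_biSup (T := Set.Ici 0) (by simpa using hn)
    hx (mem_biSup_of_isIntegral x.2))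

theorem mem_iSup_deg [IsNoetherianRing R] (x : ICogr b) : x ∈ ⨆ n, deg b n := by
  obtain ⟨F, y, hF, hy, -, hsum⟩ := exists_sum_eq_of_mem_biSup (mem_biSup_of_isIntegral x.2)
  have h : x = ∑ i ∈ F.attach, ⟨y i, isIntegral_of_mem_awayDeg (hF i.2) (hy i)⟩ := by
    refine Subtype.ext ?_
    rw [← hsum, ← Finset.sum_attach]
    simp
  rw [h]
  exact sum_mem fun i _ => AddSubgroup.mem_iSup_of_mem i.1 (hy i.1)

theorem nonempty_gradedRing_deg [IsNoetherianRing R] : Nonempty (GradedRing (deg b)) :=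
  nonempty_gradedRing _ sumIndep_deg mem_iSup_deg

theorem fromOgr_mem_deg {n : ℚ} {x : Ogr (Ideal.span {b})}
    (hx : x ∈ Ogr.deg (Ideal.span {b}) n) : fromOgr b x ∈ deg b n :=
  algebraMap_mem_awayDeg hx

theorem attaching_mem_prodDeg {n : ℚ} {x : Ogr (Ideal.span {b})}
    (hx : x ∈ Ogr.deg (Ideal.span {b}) n) : attaching b x ∈ prodDeg b n := by
  refine ⟨?_, fromOgr_mem_deg hx⟩
  by_cases hn : n = 0
  · rw [if_pos hn]
    trivial
  · rw [if_neg hn]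
    exact Ogr.toRadical_of_ne _ hn hx

/-- In positive degrees the classes are those of elements of the radical of `(b)`, on which
multiplication by powers of `b` is strict for the filtration; so the localization map is injective
there, and only the component of degree zero needs the factor `R / √(b)`. -/
theorem attaching_injective [IsNoetherianRing R] : Function.Injective (attaching b) := by
  rw [injective_iff_map_eq_zero]
  intro x hx
  obtain ⟨F, y, hy, -, rfl⟩ := exists_sum_eq_of_mem_iSup (Ogr.mem_iSup_deg _ x)
  obtain ⟨h1, h2⟩ := Prod.mk.inj hx
  have h3 : ∀ n ∈ F, toAway b (y n) = 0 := by
    refine sumIndep_awayDeg F (fun n => toAway b (y n)) (fun n => algebraMap_mem_awayDeg (hy n)) ?_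
    rw [← map_sum]
    exact congrArg Subtype.val h2
  refine Finset.sum_eq_zero fun n hn => ?_
  have hyn := hy n
  have h3n := h3 n hn
  rcases lt_trichotomy n 0 with h | rfl | h
  · exact Ogr.eq_zero_of_mem_deg_of_neg _ h hyn
  · rw [map_sum, Finset.sum_eq_single (0 : ℚ)
      (fun i _ hi => Ogr.toRadical_of_ne _ hi (hy i)) (fun h => absurd hn h)] at h1
    obtain ⟨r, hr, hry⟩ := (Ogr.mem_deg_iff _).1 hyn
    rw [← hry, Ogr.toRadical_symb_zero] at h1
    rw [← hry, Ogr.symb_eq_zero_iff, mem_homGT_zero_iff]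
    exact Ideal.Quotient.eq_zero_iff_mem.1 h1
  · obtain ⟨r, hr, hry⟩ := (Ogr.mem_deg_iff _).1 hyn
    rw [← hry, algebraMap_symb_eq_zero_iff] at h3n
    obtain ⟨m, hm⟩ := h3n
    rw [← hry, Ogr.symb_eq_zero_iff]
    exact mem_homGT_of_pow_mul_mem (mem_homGT_zero_iff.1 (homGE_le_homGT h hr)) hm

theorem bijOn_mul_bClass [IsNoetherianRing R] {n : ℚ} (hn : 0 ≤ n) :
    Set.BijOn (fun x : ICogr b => fromOgr b (Ogr.bClass b) * x) (deg b n) (deg b (n + 1)) := by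
  refine ⟨fun x hx => ?_, fun x _ y _ hxy => ?_, fun y hy => ?_⟩
  · have := SetLike.GradedMul.mul_mem (A := deg b) (fromOgr_mem_deg (Ogr.bClass_mem_deg b)) hx
    rwa [add_comm] at this
  · have h1 := congrArg Subtype.val hxy
    have hu := isUnit_algebraMap_away (Ogr.bClass b) 1
    rw [pow_one] at hu
    exact Subtype.ext (hu.mul_left_cancel h1)
  · obtain ⟨u, hu⟩ := isUnit_algebraMap_away (Ogr.bClass b) 1
    rw [pow_one] at hu
    obtain ⟨l, s, hs, hys⟩ := hy
    have hx : (↑u⁻¹ * y.1 : Localization.Away (Ogr.bClass b)) ∈ locDeg b n := by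
      refine ⟨l + 1, s, ?_, ?_⟩
      · rwa [add_nsmul, one_nsmul, ← add_assoc, add_right_comm]
      · rw [pow_succ', map_mul, ← hu]
        have h2 : (↑u⁻¹ * y.1) * ((u : Localization.Away (Ogr.bClass b)) *
            toAway b (Ogr.bClass b ^ l)) = (↑u⁻¹ * u) * (y.1 * toAway b (Ogr.bClass b ^ l)) := by
          ring
        rw [h2, Units.inv_mul, one_mul]
        exact hys
    refine ⟨⟨_, isIntegral_of_mem_awayDeg hn hx⟩, hx, Subtype.ext ?_⟩
    change toAway b (Ogr.bClass b) * (↑u⁻¹ * y.1) = y.1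
    rw [← hu, Units.mul_inv_cancel_left]

/-- The natural map is bijective in high degrees as soon as every element of high degree of the
balanced associated graded ring is a multiple of `bClass b`. -/
theorem bijOn_attaching_of_forall [IsNoetherianRing R] {N : ℚ} (hN : 0 < N)
    (h : ∀ n, N ≤ n → ∀ x ∈ Ogr.deg (Ideal.span {b}) (n + 1),
      ∃ y ∈ Ogr.deg (Ideal.span {b}) n, x = Ogr.bClass b * y) {n : ℚ} (hn : N ≤ n) :
    Set.BijOn (attaching b) (Ogr.deg (Ideal.span {b}) n) (prodDeg b n) := by
  refine ⟨fun x hx => attaching_mem_prodDeg hx, attaching_injective.injOn, fun z hz => ?_⟩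
  obtain ⟨hz1, l, s, hs, hzs⟩ := hz
  rw [if_neg (hN.trans_le hn).ne'] at hz1
  have key : ∀ (l : ℕ) (s : Ogr (Ideal.span {b})), s ∈ Ogr.deg (Ideal.span {b}) (n + l • 1) →
      ∃ y ∈ Ogr.deg (Ideal.span {b}) n, s = Ogr.bClass b ^ l * y := by
    intro l
    induction l with
    | zero => exact fun s hs => ⟨s, by simpa using hs, by simp⟩
    | succ l ih =>
      intro s hs
      rw [add_nsmul, one_nsmul, ← add_assoc] at hs
      obtain ⟨t, ht, rfl⟩ := h _ (hn.trans (by simp)) s hs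
      obtain ⟨y, hy, rfl⟩ := ih t ht
      exact ⟨y, hy, by ring⟩
  obtain ⟨y, hy, rfl⟩ := key l s hs
  refine ⟨y, hy, Prod.ext ?_ (Subtype.ext ?_)⟩
  · exact (Ogr.toRadical_of_ne _ (hN.trans_le hn).ne' hy).trans hz1.symm
  · rw [map_mul, mul_comm] at hzs
    exact ((isUnit_algebraMap_away _ l).mul_left_cancel hzs).symm

end

end ICogr

/-! ### Divisibility by the class of `b` in high degrees -/

namespace IsIntegralOverSpan

variable {R : Type*} [CommRing R] {c r : R}

theorem map (h : IsIntegralOverSpan c r) {S : Type*} [CommRing S] (φ : R →+* S) :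
    IsIntegralOverSpan (φ c) (φ r) := by
  obtain ⟨f, hf, hfr⟩ := h
  refine ⟨f.map φ, hf.map φ, ?_⟩
  rcases subsingleton_or_nontrivial S with hs | hs
  · exact Subsingleton.elim _ _
  · rw [← Polynomial.map_scaleRoots _ _ _ (by rw [hf]; simp), Polynomial.eval_map,
      Polynomial.eval₂_hom, hfr, map_zero]

theorem mem_radical (h : IsIntegralOverSpan c r) : r ∈ (Ideal.span {c}).radical := by
  obtain ⟨f, hf, hfr⟩ := h
  refine ⟨f.natDegree, ?_⟩
  rw [Polynomial.eval_eq_sum_range, Polynomial.natDegree_scaleRoots, Finset.sum_range_succ,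
    Polynomial.coeff_scaleRoots, hf.coeff_natDegree, Nat.sub_self, pow_zero, one_mul,
    one_mul] at hfr
  rw [eq_neg_of_add_eq_zero_right hfr]
  refine neg_mem (sum_mem fun i hi => Ideal.mul_mem_right _ _ ?_)
  rw [Polynomial.coeff_scaleRoots]
  exact Ideal.mul_mem_left _ _ (Ideal.pow_mem_of_mem _ (Ideal.mem_span_singleton_self c) _
    (Nat.sub_pos_of_lt (Finset.mem_range.1 hi)))

/-- Principal ideals of an integral closure in a field are integrally closed. -/
theorem dvd_of_integralClosure {D K : Type*} [CommRing D] [Field K] [Algebra D K]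
    {c z : integralClosure D K} (h : IsIntegralOverSpan c z) : c ∣ z := by
  obtain ⟨f, hf, hfz⟩ := h
  rcases eq_or_ne c 0 with rfl | hc
  · have h1 := mem_radical ⟨f, hf, hfz⟩
    obtain ⟨k, hk⟩ := h1
    rw [Ideal.mem_span_singleton, zero_dvd_iff] at hk
    exact zero_dvd_iff.2 (IsReduced.eq_zero z ⟨k, hk⟩)
  · have hc' : (c : K) ≠ 0 := fun h => hc (Subtype.ext h)
    have hint : IsIntegral (integralClosure D K) ((z : K) / c) := by
      refine ⟨f, hf, ?_⟩
      have h1 : Polynomial.eval₂ (algebraMap (integralClosure D K) K)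
          (algebraMap (integralClosure D K) K c * ((z : K) / c)) (f.scaleRoots c) = 0 := by
        have h2 : algebraMap (integralClosure D K) K c * ((z : K) / c) =
            algebraMap (integralClosure D K) K z := mul_div_cancel₀ _ hc'
        rw [h2, Polynomial.eval₂_hom, hfz, map_zero]
      rw [Polynomial.scaleRoots_eval₂_mul] at h1
      exact (mul_eq_zero.1 h1).resolve_left (pow_ne_zero _ hc')
    have hint' : IsIntegral D ((z : K) / c) := isIntegral_trans _ hint
    exact ⟨⟨_, hint'⟩, Subtype.ext (mul_div_cancel₀ _ hc').symm⟩

end IsIntegralOverSpan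

/-- In a Noetherian module, the powers of `b` that carry an element into a given submodule are
bounded. -/
theorem exists_forall_pow_smul_mem {R M : Type*} [CommRing R] [AddCommGroup M] [Module R M]
    [IsNoetherian R M] (N : Submodule R M) (b : R) :
    ∃ c : ℕ, ∀ (m : ℕ) (y : M), b ^ m • y ∈ N → b ^ c • y ∈ N := by
  let f : ℕ →o Submodule R M :=
    { toFun := fun m => N.comap (LinearMap.lsmul R M (b ^ m))
      monotone' := by
        intro i j hij y hy
        obtain ⟨k, rfl⟩ := Nat.exists_eq_add_of_le' hij
        change b ^ (k + i) • y ∈ N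
        rw [pow_add, mul_smul]
        exact N.smul_mem _ hy }
  obtain ⟨c, hc⟩ := monotone_stabilizes_iff_noetherian.2 ‹_› f
  refine ⟨c, fun m y hy => ?_⟩
  rcases le_total c m with h | h
  · have h1 : y ∈ f m := hy
    rw [← hc m h] at h1
    exact h1
  · exact f.monotone h hy

section HighDegrees

variable {R : Type*} [CommRing R] [IsNoetherianRing R] (b : R)

theorem Ogr.mem_radical_of_mem_deg {n : ℚ} (hn : 0 < n) {x : Ogr (Ideal.span {b})}
    (hx : x ∈ deg (Ideal.span {b}) n) : x ∈ (Ideal.span {bClass b}).radical := by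
  obtain ⟨r, hr, rfl⟩ := (mem_deg_iff _).1 hx
  obtain ⟨P, hP⟩ : ∃ P : ℕ, (P : ℤ) = n.num := ⟨_, Int.toNat_of_nonneg (Rat.num_nonneg.2 hn.le)⟩
  have hPn : (n.den : ℚ) * n = P := by
    rw [Rat.den_mul_eq_num, ← hP, Int.cast_natCast]
  have hP0 : P ≠ 0 := by
    rintro rfl
    exact (Rat.num_pos.2 hn).ne hP
  have hrQ : r ^ n.den ∈ homGE (Ideal.span {b}) (P : ℚ) := hPn ▸ pow_mem_homGE hr n.den
  have h1 := (isIntegralOverSpan_symb (mem_homGE_natCast_iff.1 hrQ) hrQ).mem_radical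
  rw [← Ideal.span_singleton_pow, Ideal.radical_pow _ hP0] at h1
  have h2 : symb (Ideal.span {b}) P (r ^ n.den) hrQ = symb _ n r hr ^ n.den := by
    rw [symb_pow]
    exact symb_congr _ hPn.symm rfl _ _
  rw [h2] at h1
  exact Ideal.mem_radical_of_pow_mem h1

/-- If the balanced associated graded ring is Noetherian, the ideal of elements of positive degree
is generated by finitely many homogeneous elements, so that one of its powers is contained in the
ideal generated by `bClass b`, and contains all elements of high degree. -/
theorem Ogr.exists_forall_eq_mul_of_isNoetherianRing [IsNoetherianRing (Ogr (Ideal.span {b}))] :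
    ∃ N : ℚ, 0 < N ∧ ∀ n, N ≤ n → ∀ x ∈ deg (Ideal.span {b}) (n + 1),
      ∃ y ∈ deg (Ideal.span {b}) n, x = bClass b * y := by
  classical
  obtain ⟨inst⟩ := nonempty_gradedRing_deg (Ideal.span {b})
  let U : Set (Ogr (Ideal.span {b})) := {x | ∃ n : ℚ, 0 < n ∧ x ∈ deg (Ideal.span {b}) n}
  obtain ⟨T, hTU, hT⟩ := Submodule.fg_span_iff_fg_span_finset_subset U |>.1
    (IsNoetherian.noetherian (Submodule.span (Ogr (Ideal.span {b})) U))
  let J := Ideal.span (T : Set (Ogr (Ideal.span {b})))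
  have hUJ : ∀ x ∈ U, x ∈ J := fun x hx => by
    change x ∈ Submodule.span _ _
    rw [← hT]
    exact Submodule.subset_span hx
  have hJ : J ≤ (Ideal.span {bClass b}).radical := by
    refine Ideal.span_le.2 fun t ht => ?_
    obtain ⟨n, hn, htn⟩ := hTU ht
    exact mem_radical_of_mem_deg b hn htn
  obtain ⟨e, he⟩ := Ideal.exists_pow_le_of_le_radical_of_fg hJ (IsNoetherian.noetherian J)
  choose! d hd0 hd using fun t (ht : t ∈ T) => hTU ht
  let D : ℚ := 1 + ∑ t ∈ T, d t
  have hD : ∀ t ∈ T, d t ≤ D := fun t ht =>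
    (Finset.single_le_sum (fun t ht => (hd0 t ht).le) ht).trans (by simp [D])
  have hD0 : 0 < D := add_pos_of_pos_of_nonneg one_pos (Finset.sum_nonneg fun t ht => (hd0 t ht).le)
  have key : ∀ (e : ℕ) (n : ℚ), e * D < n → ∀ x ∈ deg (Ideal.span {b}) n, x ∈ J ^ e := by
    intro e
    induction e with
    | zero => simp
    | succ e ih =>
      intro n hn x hx
      push_cast at hn
      have hn0 : 0 < n := lt_of_le_of_lt (by positivity) hn
      obtain ⟨a, ha⟩ := Submodule.mem_span_finset'.1 (hUJ x ⟨n, hn0, hx⟩)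
      have h1 := congrArg (fun z => (DirectSum.decompose (deg (Ideal.span {b})) z n :
        Ogr (Ideal.span {b}))) ha
      simp only [DirectSum.decompose_of_mem_same _ hx] at h1
      rw [← h1, DirectSum.decompose_sum, DirectSum.sum_apply, AddSubgroup.val_finsetSum]
      refine sum_mem fun t _ => ?_
      have h2 := DirectSum.coe_decompose_mul_add_of_right_mem (deg (Ideal.span {b}))
        (a := a t) (i := n - d t) (hd t t.2)
      rw [sub_add_cancel] at h2
      rw [smul_eq_mul, h2, pow_succ]
      refine Ideal.mul_mem_mul (ih (n - d t) ?_ _ (SetLike.coe_mem _)) (Ideal.subset_span t.2)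
      have := hD t t.2
      linarith
  refine ⟨e * D + 1, by positivity, fun n hn x hx => ?_⟩
  obtain ⟨a, ha⟩ := Ideal.mem_span_singleton'.1 (he (key e (n + 1) (by linarith) x hx))
  refine ⟨DirectSum.decompose (deg (Ideal.span {b})) a n, SetLike.coe_mem _, ?_⟩
  rw [mul_comm, ← DirectSum.coe_decompose_mul_add_of_right_mem (deg (Ideal.span {b}))
    (bClass_mem_deg b), ha, DirectSum.decompose_of_mem_same _ hx]

/-- If `R` has finite normalization, an element `r` of high order becomes divisible by a high
power of `b` in the normalization; since the normalization is a finite module, almost the whole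
quotient comes from an element `s` of `R`, up to nilpotents. -/
theorem exists_mem_homGE_of_hasFiniteNormalization (hR : HasFiniteNormalization R) :
    ∃ N : ℚ, 0 < N ∧ ∀ n, N ≤ n → ∀ r ∈ homGE (Ideal.span {b}) (n + 1),
      ∃ s ∈ homGE (Ideal.span {b}) n, IsNilpotent (r - b * s) := by
  classical
  have hfin : Finite (minimalPrimes R) := minimalPrimes.finite_of_isNoetherianRing R
  let S : minimalPrimes R → Type _ := fun p =>
    integralClosure (R ⧸ p.1) (FractionRing (R ⧸ p.1))
  have hprime : ∀ p : minimalPrimes R, p.1.IsPrime := fun p => p.2.1.1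
  let _ : ∀ p, CommRing (S p) := fun p =>
    inferInstanceAs (CommRing (integralClosure (R ⧸ p.1) (FractionRing (R ⧸ p.1))))
  let _ : ∀ p, Algebra (R ⧸ p.1) (S p) := fun p =>
    inferInstanceAs (Algebra (R ⧸ p.1) (integralClosure (R ⧸ p.1) (FractionRing (R ⧸ p.1))))
  have hdom : ∀ p, IsDomain (S p) := fun p =>
    inferInstanceAs (IsDomain (integralClosure (R ⧸ p.1) (FractionRing (R ⧸ p.1))))
  let φ : ∀ p, R →+* S p := fun p => (algebraMap (R ⧸ p.1) (S p)).comp (Ideal.Quotient.mk p.1)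
  let _ : ∀ p, Algebra R (S p) := fun p => (φ p).toAlgebra
  have htower : ∀ p, IsScalarTower R (R ⧸ p.1) (S p) := fun p =>
    IsScalarTower.of_algebraMap_eq fun _ => rfl
  have hSfin : ∀ p, Module.Finite R (S p) := fun p => by
    have : Module.Finite (R ⧸ p.1) (S p) := hR p.1 p.2
    exact Module.Finite.trans (R ⧸ p.1) (S p)
  have hinj : ∀ p, Function.Injective (algebraMap (R ⧸ p.1) (S p)) := fun p x y hxy =>
    IsFractionRing.injective (R ⧸ p.1) (FractionRing (R ⧸ p.1)) (congrArg Subtype.val hxy)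
  have hker : ∀ p x, φ p x = 0 ↔ x ∈ p.1 := fun p x => by
    rw [← Ideal.Quotient.eq_zero_iff_mem, ← map_eq_zero_iff _ (hinj p)]
    rfl
  have hdvd : ∀ (p) (l : ℕ) (r : R), r ∈ homGE (Ideal.span {b}) l → φ p b ^ l ∣ φ p r := by
    intro p l r hr
    rw [← map_pow]
    exact ((mem_homGE_natCast_iff.1 hr).map (φ p)).dvd_of_integralClosure
  obtain ⟨c, hc⟩ := exists_forall_pow_smul_mem (LinearMap.range (Algebra.linearMap R (∀ p, S p))) b
  refine ⟨c + 2, by positivity, fun n hn r hr => ?_⟩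
  have hn0 : 0 ≤ n := le_trans (by positivity) hn
  have hrc : r ∈ homGE (Ideal.span {b}) ((c + 2 : ℕ) : ℚ) :=
    homGE_antitone (by push_cast; linarith) hr
  choose y hy using fun p => hdvd p _ r hrc
  obtain ⟨s, hs⟩ := hc (c + 2) y ⟨r, funext fun p => (hy p).trans (by
    rw [← map_pow]
    rfl)⟩
  have hs' : ∀ p, φ p s = φ p b ^ c * y p := fun p => by
    rw [← map_pow]
    exact congrFun hs p
  have hrs : ∀ p, φ p r = φ p b ^ 2 * φ p s := fun p => by
    rw [hy p, hs' p]
    ring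
  -- the spare factor `b` makes `b * s` vanish modulo the minimal primes that contain `b`, where
  -- `s` is not controlled
  refine ⟨b * s, ?_, ?_⟩
  · rw [mem_homGE_iff_isIntegralOverSpan hn0]
    refine IsIntegralOverSpan.of_minimalPrimes fun p hp => ?_
    set P := n.num.toNat
    have hPn : (n.den : ℚ) * (n + 1) = (P + n.den : ℕ) := by
      rw [mul_add, Rat.den_mul_eq_num]
      push_cast
      rw [mul_one, add_left_inj]
      exact_mod_cast (Int.toNat_of_nonneg (Rat.num_nonneg.2 hn0)).symm
    have h1 : r ^ n.den ∈ homGE (Ideal.span {b}) ((P + n.den : ℕ) : ℚ) :=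
      hPn ▸ pow_mem_homGE hr n.den
    obtain ⟨w, hw⟩ : φ ⟨p, hp⟩ b ^ P ∣ φ ⟨p, hp⟩ ((b * s) ^ n.den) := by
      by_cases hb : φ ⟨p, hp⟩ b = 0
      · rw [map_pow, map_mul, hb, zero_mul, zero_pow n.den_ne_zero]
        exact dvd_zero _
      · have h2 := hdvd ⟨p, hp⟩ _ _ h1
        have h3 : φ ⟨p, hp⟩ (r ^ n.den) =
            φ ⟨p, hp⟩ ((b * s) ^ n.den) * φ ⟨p, hp⟩ b ^ n.den := by
          rw [map_pow, map_pow, hrs, map_mul]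
          ring
        rw [h3, pow_add] at h2
        exact (mul_dvd_mul_iff_right (pow_ne_zero _ hb)).1 h2
    refine IsIntegralOverSpan.exists_eval_mem_of_isIntegral (hinj ⟨p, hp⟩) (w := w) ?_ ?_
    · exact integralClosure.isIntegral (R := R ⧸ p) (A := FractionRing (R ⧸ p)) w
    · rw [map_pow (Ideal.Quotient.mk p) b]
      exact hw.trans (by rw [map_pow]; rfl)
  · rw [← mem_nilradical, nilradical, ← Ideal.sInf_minimalPrimes, Submodule.mem_sInf]
    intro p hp
    rw [← hker ⟨p, hp⟩, map_sub, map_mul, map_mul, hrs]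
    ring

theorem Ogr.exists_forall_eq_mul_of_hasFiniteNormalization (hR : HasFiniteNormalization R) :
    ∃ N : ℚ, 0 < N ∧ ∀ n, N ≤ n → ∀ x ∈ deg (Ideal.span {b}) (n + 1),
      ∃ y ∈ deg (Ideal.span {b}) n, x = bClass b * y := by
  obtain ⟨N, hN, h⟩ := exists_mem_homGE_of_hasFiniteNormalization b hR
  refine ⟨N, hN, fun n hn x hx => ?_⟩
  obtain ⟨r, hr, rfl⟩ := (mem_deg_iff _).1 hx
  obtain ⟨s, hs, hrs⟩ := h n hn r hr
  refine ⟨_, symb_mem_deg _ n s hs, ?_⟩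
  have h1 := bClass_pow_mul_symb hs 1
  rw [pow_one] at h1
  have hbs : b * s ∈ homGE (Ideal.span {b}) (n + 1) := by
    simpa using pow_mul_mem_homGE hs 1
  have h2 : symb _ (n + (1 : ℕ)) (b ^ 1 * s) (pow_mul_mem_homGE hs 1) =
      symb _ (n + 1) (b * s) hbs :=
    symb_congr _ (by simp) (by simp) _ _
  have h3 : r = b * s + (r - b * s) := by ring
  rw [h1, h2, symb_congr _ rfl h3 hr (by rwa [← h3]),
    ← symb_add _ _ _ _ hbs (homGT_le_homGE (mem_homGT_of_isNilpotent hrs _)),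
    symb_eq_zero_of_mem _ (homGT_le_homGE (mem_homGT_of_isNilpotent hrs _))
      (mem_homGT_of_isNilpotent hrs _), add_zero]

theorem ICogr.exists_forall_bijOn_attaching
    (h : IsNoetherianRing (Ogr (Ideal.span {b})) ∨ HasFiniteNormalization R) :
    ∃ N : ℚ, ∀ n : ℚ, N ≤ n →
      Set.BijOn (ICogr.attaching b) (Ogr.deg (Ideal.span {b}) n) (ICogr.prodDeg b n) := by
  obtain ⟨N, hN, h⟩ : ∃ N : ℚ, 0 < N ∧ ∀ n, N ≤ n → ∀ x ∈ Ogr.deg (Ideal.span {b}) (n + 1),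
      ∃ y ∈ Ogr.deg (Ideal.span {b}) n, x = Ogr.bClass b * y := by
    rcases h with h | h
    · exact Ogr.exists_forall_eq_mul_of_isNoetherianRing b
    · exact Ogr.exists_forall_eq_mul_of_hasFiniteNormalization b h
  exact ⟨N, fun n hn => bijOn_attaching_of_forall hN h hn⟩

end HighDegrees

/-! ### Finiteness of normalization over a perfect field -/

/-- If `B` embeds into `C` by an additive map that is semilinear along a finite ring homomorphism
from the Noetherian ring `A` to `C`, then `B` is a Noetherian `A`-module. -/
theorem isNoetherian_of_semilinear_of_finite {A B C : Type*} [CommRing A] [IsNoetherianRing A]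
    [AddCommGroup B] [Module A B] [CommRing C] {f : A →+* C} (hf : f.Finite) (θ : B →+ C)
    (hθ : ∀ a x, θ (a • x) = f a * θ x) (hinj : Function.Injective θ) : IsNoetherian A B := by
  let _ : Algebra A C := f.toAlgebra
  have : Module.Finite A C := hf
  exact isNoetherian_of_injective
    ({ θ with map_smul' := fun a x => (hθ a x).trans (Algebra.smul_def a (θ x)).symm } : B →ₗ[A] C)
    hinj

theorem MvPolynomial.iterateFrobenius_finite {σ k : Type*} [Finite σ] [Field k] [PerfectField k]
    (p : ℕ) [ExpChar k p] [ExpChar (MvPolynomial σ k) p] (e : ℕ) :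
    (iterateFrobenius (MvPolynomial σ k) p e).Finite := by
  refine RingHom.IsIntegral.to_finite (fun x => ?_) ?_
  · refine ⟨Polynomial.X ^ p ^ e - Polynomial.C x,
      Polynomial.monic_X_pow_sub_C x (expChar_pow_pos k p e).ne', ?_⟩
    simp [iterateFrobenius_def]
  · have hcomp : (iterateFrobenius (MvPolynomial σ k) p e).comp MvPolynomial.C =
        (MvPolynomial.C (σ := σ)).comp (iterateFrobenius k p e) := by
      ext x
      simp [iterateFrobenius_def]
    refine RingHom.FiniteType.of_comp_finiteType (f := MvPolynomial.C) ?_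
    rw [hcomp]
    exact (RingHom.finiteType_algebraMap.2 inferInstance).comp
      (RingHom.FiniteType.of_surjective _ (bijective_iterateFrobenius k p e).2)

/-- Let `A` be a Noetherian integrally closed domain with fraction field `F`, whose iterated
Frobenius endomorphisms are finite. Then the integral closure of `A` in a finite extension `L` of
`F` is a Noetherian module. Some power `q` of the characteristic exponent carries `L` into its
subextension `M` separable over `F`, so `x ↦ x ^ q` maps this integral closure injectively into the
one of `A` in `M`. The latter is finite over `A`, also when `A` acts through `a ↦ a ^ q`. -/
theorem isNoetherian_integralClosure_of_iterateFrobenius_finite (A F L : Type*) [CommRing A]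
    [IsDomain A] [IsNoetherianRing A] [IsIntegrallyClosed A] [Field F] [Algebra A F]
    [IsFractionRing A F] [Field L] [Algebra A L] [Algebra F L] [IsScalarTower A F L]
    [FiniteDimensional F L] (p : ℕ) [ExpChar A p]
    (hFrob : ∀ e, (iterateFrobenius A p e).Finite) : IsNoetherian A (integralClosure A L) := by
  have hpF : ExpChar F p := expChar_of_injective_algebraMap (IsFractionRing.injective A F) p
  have hpL : ExpChar L p := expChar_of_injective_algebraMap (algebraMap F L).injective p
  let M := separableClosure F L
  have htower : IsScalarTower A M L := IsScalarTower.of_algebraMap_eq fun _ => rfl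
  have hpM : ExpChar M p := expChar_of_injective_algebraMap (algebraMap F M).injective p
  obtain ⟨e, he⟩ := (IsPurelyInseparable.hasExponent_iff' (K := M) L p).1 inferInstance
  have hCfin : Module.Finite A (integralClosure A M) := IsIntegralClosure.finite A F M _
  let ι : integralClosure A M →+* L :=
    (algebraMap M L).comp (algebraMap (integralClosure A M) M)
  have hι : Function.Injective ι := (algebraMap M L).injective.comp Subtype.val_injective
  have hιA : ∀ a : A, ι (algebraMap A (integralClosure A M) a) = algebraMap A L a := fun a =>
    (IsScalarTower.algebraMap_apply A M L a).symm
  have hBC : ∀ x : integralClosure A L, ∃ y : integralClosure A M, ι y = x.1 ^ p ^ e := by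
    intro x
    obtain ⟨y, hy⟩ := he x.1
    have hx : IsIntegral A (x.1 ^ p ^ e) := IsIntegral.pow x.2 _
    rw [← hy, isIntegral_algebraMap_iff (algebraMap M L).injective] at hx
    exact ⟨⟨y, hx⟩, hy⟩
  choose θ hθ using hBC
  let Θ : integralClosure A L →+ integralClosure A M :=
    { toFun := θ
      map_zero' := hι (by
        rw [hθ, RingHom.map_zero]
        exact zero_pow (expChar_pow_pos L p e).ne')
      map_add' := fun x y => hι (by
        rw [hθ, RingHom.map_add, hθ, hθ]
        exact add_pow_expChar_pow _ _ _ _) }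
  have hfin : ((algebraMap A (integralClosure A M)).comp (iterateFrobenius A p e)).Finite :=
    RingHom.Finite.comp (RingHom.finite_algebraMap.2 hCfin) (hFrob e)
  refine isNoetherian_of_semilinear_of_finite hfin Θ (fun a x => hι ?_) fun x y hxy => ?_
  · change ι (θ (a • x)) = ι (algebraMap A _ (iterateFrobenius A p e a) * θ x)
    rw [hθ, RingHom.map_mul, hθ, hιA, iterateFrobenius_def, RingHom.map_pow, ← mul_pow]
    congr 1
    exact Algebra.smul_def a x.1
  · have h1 : x.1 ^ p ^ e = y.1 ^ p ^ e := by
      rw [← hθ, ← hθ]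
      exact congrArg ι hxy
    exact Subtype.ext (iterateFrobenius_inj L p e h1)

/-- The integral closure of a finitely generated domain over a perfect field in its field of
fractions is a finite module, by Noether normalization. -/
theorem finite_integralClosure_fractionRing_of_finiteType (k D : Type*) [Field k] [PerfectField k]
    [CommRing D] [IsDomain D] [Algebra k D] [Algebra.FiniteType k D] :
    Module.Finite D (integralClosure D (FractionRing D)) := by
  obtain ⟨s, g, hg, hgfin⟩ := exists_finite_inj_algHom_of_fg k D
  let A := MvPolynomial (Fin s) k
  let L := FractionRing D
  let F := FractionRing A
  let _ : Algebra A D := g.toRingHom.toAlgebra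
  have hAD : Module.Finite A D := hgfin
  have hADinj : Function.Injective (algebraMap A D) := hg
  have htower : IsScalarTower A D L := inferInstance
  have hALinj : Function.Injective (algebraMap A L) := by
    rw [IsScalarTower.algebraMap_eq A D L]
    exact (IsFractionRing.injective D L).comp hADinj
  have hfaith : FaithfulSMul A L := (faithfulSMul_iff_algebraMap_injective A L).2 hALinj
  let _ : Algebra F L := FractionRing.liftAlgebra A L
  have htower2 : IsScalarTower A F L := FractionRing.isScalarTower_liftAlgebra A L
  have hfaithD : FaithfulSMul A D := (faithfulSMul_iff_algebraMap_injective A D).2 hADinj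
  have halgL : Algebra.IsAlgebraic A L :=
    (IsFractionRing.isAlgebraic_iff' A D L).1 inferInstance
  have halg : Algebra.IsAlgebraic F L := (IsFractionRing.comap_isAlgebraic_iff (A := A)).1 halgL
  have hess : Algebra.EssFiniteType A L := Algebra.EssFiniteType.comp A D L
  have hess2 : Algebra.EssFiniteType F L := Algebra.EssFiniteType.of_comp A F L
  have hfd : FiniteDimensional F L := by
    obtain ⟨S, hS⟩ := IntermediateField.fg_top F L
    have h1 : FiniteDimensional F (IntermediateField.adjoin F (S : Set L)) :=
      IntermediateField.finiteDimensional_adjoin fun x _ => (halg.isAlgebraic x).isIntegral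
    rw [hS] at h1
    exact IntermediateField.topEquiv.toLinearEquiv.finiteDimensional
  obtain ⟨p, hp⟩ := ExpChar.exists k
  have hpA : ExpChar A p := expChar_of_injective_algebraMap (MvPolynomial.C_injective (Fin s) k) p
  have hN : IsNoetherian A (integralClosure A L) :=
    isNoetherian_integralClosure_of_iterateFrobenius_finite A F L p
      (MvPolynomial.iterateFrobenius_finite p)
  let j : integralClosure D L →ₗ[A] integralClosure A L :=
    { toFun := fun x => ⟨x.1, isIntegral_trans (R := A) x.1 x.2⟩
      map_add' := fun _ _ => rfl
      map_smul' := fun _ _ => rfl }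
  have hB : IsNoetherian A (integralClosure D L) :=
    isNoetherian_of_injective j fun x y hxy => Subtype.ext
      (congrArg (fun z : integralClosure A L => z.1) hxy)
  have hBfin : Module.Finite A (integralClosure D L) := inferInstance
  exact Module.Finite.of_restrictScalars_finite A D _

theorem hasFiniteNormalization_of_finiteType (k R : Type*) [Field k] [PerfectField k]
    [CommRing R] [Algebra k R] [Algebra.FiniteType k R] : HasFiniteNormalization R := by
  intro p hp
  have : p.IsPrime := hp.1.1
  exact finite_integralClosure_fractionRing_of_finiteType k (R ⧸ p)

/-! ### Noetherian graded algebras over a field -/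

section GradedAlgebra

variable {k R : Type*} [Field k] [CommRing R] [Algebra k R] (𝒜 : ℕ → Submodule k R)
  [GradedAlgebra 𝒜]

/-- The homogeneous components as additive subgroups. -/
abbrev addDeg (𝒜 : ℕ → Submodule k R) (j : ℕ) : AddSubgroup R := (𝒜 j).toAddSubgroup

instance : SetLike.GradedMonoid (addDeg 𝒜) where
  one_mem := SetLike.GradedOne.one_mem (A := 𝒜)
  mul_mem _ _ _ _ hx hy := SetLike.GradedMul.mul_mem (A := 𝒜) hx hy

theorem decompose_eq_zero_of_mem_biSup {T : Set ℕ} {j : ℕ} (hj : j ∉ T) {x : R}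
    (hx : x ∈ ⨆ i ∈ T, addDeg 𝒜 i) : (DirectSum.decompose 𝒜 x j : R) = 0 := by
  obtain ⟨F, y, hF, hy, -, rfl⟩ := exists_sum_eq_of_mem_biSup hx
  rw [DirectSum.decompose_sum, DirectSum.sum_apply, AddSubmonoidClass.coe_finsetSum]
  exact Finset.sum_eq_zero fun i hi =>
    DirectSum.decompose_of_mem_ne 𝒜 (hy i) (fun h => hj (h ▸ hF hi))

variable [IsNoetherianRing R]

/-- A Noetherian graded algebra whose degree zero part is the base field is finitely generated:
homogeneous generators of the ideal of elements of positive degree generate the algebra. -/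
theorem finiteType_of_isNoetherianRing (h0 : Function.Bijective (algebraMap k (𝒜 0))) :
    Algebra.FiniteType k R := by
  classical
  let U : Set R := {x | ∃ n, 0 < n ∧ x ∈ 𝒜 n}
  obtain ⟨T, hTU, hT⟩ := Submodule.fg_span_iff_fg_span_finset_subset U |>.1
    (IsNoetherian.noetherian (Submodule.span R U))
  choose! d hd0 hd using fun t (ht : t ∈ T) => hTU ht
  have key : ∀ (n : ℕ) (x : R), x ∈ 𝒜 n → x ∈ Algebra.adjoin k (T : Set R) := by
    intro n
    induction n using Nat.strong_induction_on with
    | _ n ih =>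
      intro x hx
      rcases Nat.eq_zero_or_pos n with rfl | hn
      · obtain ⟨c, hc⟩ := h0.2 ⟨x, hx⟩
        have : algebraMap k R c = x := congrArg Subtype.val hc
        rw [← this]
        exact Subalgebra.algebraMap_mem _ c
      · have hxU : x ∈ Submodule.span R (T : Set R) := by
          rw [← hT]
          exact Submodule.subset_span ⟨n, hn, hx⟩
        obtain ⟨a, ha⟩ := Submodule.mem_span_finset'.1 hxU
        have h1 := congrArg (fun z => (DirectSum.decompose 𝒜 z n : R)) ha
        simp only [DirectSum.decompose_of_mem_same _ hx] at h1
        rw [← h1, DirectSum.decompose_sum, DirectSum.sum_apply, AddSubmonoidClass.coe_finsetSum]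
        refine sum_mem fun t _ => ?_
        rw [smul_eq_mul, DirectSum.coe_decompose_mul_of_right_mem 𝒜 n (hd t t.2)]
        split_ifs with hle
        · refine mul_mem (ih (n - d t) ?_ _ (SetLike.coe_mem _)) (Algebra.subset_adjoin t.2)
          have := hd0 t t.2
          omega
        · exact zero_mem _
  refine ⟨T, eq_top_iff.2 fun x _ => ?_⟩
  rw [← DirectSum.sum_support_decompose 𝒜 x]
  exact sum_mem fun i _ => key i _ (SetLike.coe_mem _)

theorem finite_component (h0 : Function.Bijective (algebraMap k (𝒜 0))) (j : ℕ) :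
    Module.Finite k (𝒜 j) := by
  classical
  obtain ⟨T, hTU, hT⟩ := Submodule.fg_span_iff_fg_span_finset_subset (𝒜 j : Set R) |>.1
    (IsNoetherian.noetherian (Submodule.span R (𝒜 j : Set R)))
  refine Module.Finite.iff_fg.2 ⟨T, le_antisymm (Submodule.span_le.2 hTU) fun x hx => ?_⟩
  have hxT : x ∈ Submodule.span R (T : Set R) := by
    rw [← hT]
    exact Submodule.subset_span hx
  obtain ⟨a, ha⟩ := Submodule.mem_span_finset'.1 hxT
  have h1 := congrArg (fun z => (DirectSum.decompose 𝒜 z j : R)) ha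
  simp only [DirectSum.decompose_of_mem_same _ hx] at h1
  rw [← h1, DirectSum.decompose_sum, DirectSum.sum_apply, AddSubmonoidClass.coe_finsetSum]
  refine sum_mem fun t _ => ?_
  rw [smul_eq_mul, DirectSum.coe_decompose_mul_of_right_mem 𝒜 j (hTU t.2), if_pos le_rfl]
  obtain ⟨c, hc⟩ := h0.2 (DirectSum.decompose 𝒜 (a t) 0)
  have h2 : algebraMap k R c = DirectSum.decompose 𝒜 (a t) 0 := congrArg Subtype.val hc
  rw [Nat.sub_self, ← h2, ← Algebra.smul_def]
  exact Submodule.smul_mem _ _ (Submodule.subset_span t.2)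

end GradedAlgebra

/-! ### The filtration of a principal homogeneous ideal -/

theorem homOrder_le_homOrder {R : Type*} [CommRing R] (I : Ideal R) {r s : R}
    (h : ∀ m M : ℕ, r ^ m ∈ I ^ M → s ^ m ∈ I ^ M) : homOrder I r ≤ homOrder I s := by
  refine le_of_tendsto_of_tendsto' (tendsto_homOrder I r) (tendsto_homOrder I s) fun m => ?_
  gcongr
  refine le_adicOrder_of_forall I fun M hM => h m M ?_
  exact (le_adicOrder_iff I _ M).1 hM

section HomogeneousFiltration

variable {k R : Type*} [Field k] [CommRing R] [Algebra k R] {𝒜 : ℕ → Submodule k R}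
  [GradedAlgebra 𝒜] {b : R} {d : ℕ}

/-- The lowest homogeneous term of `r` has at least the order of `r`, since the lowest term of
`r ^ m` is its `m`-th power and the powers of `(b)` are homogeneous ideals. -/
theorem homOrder_add_le_homOrder (hb : b ∈ 𝒜 d) {j : ℕ} {s w : R} (hs : s ∈ 𝒜 j)
    (hw : w ∈ ⨆ i ∈ Set.Ioi j, addDeg 𝒜 i) :
    homOrder (Ideal.span {b}) (s + w) ≤ homOrder (Ideal.span {b}) s := by
  refine homOrder_le_homOrder _ fun m M h => ?_
  have hhom : (Ideal.span {b} ^ M).IsHomogeneous 𝒜 := by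
    rw [Ideal.span_singleton_pow]
    refine Ideal.homogeneous_span 𝒜 _ fun x hx => ?_
    rw [Set.mem_singleton_iff] at hx
    rw [hx]
    exact ⟨M • d, SetLike.pow_mem_graded M hb⟩
  have h1 := hhom (m • j) h
  have h2 : (s + w) ^ m = s ^ m + ((s + w) ^ m - s ^ m) := by ring
  rw [h2, DirectSum.decompose_add, DirectSum.add_apply, Submodule.coe_add,
    DirectSum.decompose_of_mem_same 𝒜 (SetLike.pow_mem_graded m hs),
    decompose_eq_zero_of_mem_biSup 𝒜 (T := Set.Ioi (m • j)) (by simp)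
      (add_pow_sub_pow_mem_biSup (𝒮 := addDeg 𝒜) hs hw m), add_zero] at h1
  exact h1

theorem mem_homGE_of_sum_mem (hb : b ∈ 𝒜 d) {n : ℚ} {F : Finset ℕ} {r : ℕ → R}
    (hr : ∀ j, r j ∈ 𝒜 j) (h : ∑ j ∈ F, r j ∈ homGE (Ideal.span {b}) n) :
    ∀ j ∈ F, r j ∈ homGE (Ideal.span {b}) n := by
  classical
  induction F using Finset.induction_on_min with
  | empty => simp
  | insert a F hF ih =>
    have haF : a ∉ F := fun h => lt_irrefl a (hF a h)
    rw [Finset.sum_insert haF] at h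
    have ha : r a ∈ homGE (Ideal.span {b}) n := by
      rw [mem_homGE] at h ⊢
      refine h.trans (EReal.coe_ennreal_le_coe_ennreal_iff.2
        (homOrder_add_le_homOrder hb (hr a) (sum_mem fun i hi => ?_)))
      exact mem_biSup_of_mem (𝒮 := addDeg 𝒜) (T := Set.Ioi a) (hF i hi) (hr i)
    have h2 : ∑ j ∈ F, r j ∈ homGE (Ideal.span {b}) n := by
      have := sub_mem h ha
      rwa [add_sub_cancel_left] at this
    intro j hj
    rcases Finset.mem_insert.1 hj with rfl | hj
    · exact ha
    · exact ih h2 j hj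

theorem mem_homGT_of_sum_mem (hb : b ∈ 𝒜 d) {n : ℚ} {F : Finset ℕ} {r : ℕ → R}
    (hr : ∀ j, r j ∈ 𝒜 j) (h : ∑ j ∈ F, r j ∈ homGT (Ideal.span {b}) n) :
    ∀ j ∈ F, r j ∈ homGT (Ideal.span {b}) n := by
  obtain ⟨m, hm, h1⟩ := mem_homGT_iff_exists.1 h
  exact fun j hj => homGE_le_homGT hm (mem_homGE_of_sum_mem hb hr h1 j hj)

/-- A homogeneous element integral over `(b ^ l)` whose degree is smaller than that of `b ^ l` is
nilpotent: in its equation of integral dependence all terms but the first have larger degree. -/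
theorem isNilpotent_of_mem_homGE_of_lt [IsNoetherianRing R] (hb : b ∈ 𝒜 d) {j l : ℕ} {r : R}
    (hr : r ∈ 𝒜 j) (h : r ∈ homGE (Ideal.span {b}) l) (hj : j < l * d) : IsNilpotent r := by
  obtain ⟨f, hf, hfr⟩ := mem_homGE_natCast_iff.1 h
  rw [Polynomial.eval_eq_sum_range, Polynomial.natDegree_scaleRoots, Finset.sum_range_succ,
    Polynomial.coeff_scaleRoots, hf.coeff_natDegree, Nat.sub_self, pow_zero, one_mul,
    one_mul] at hfr
  set m := f.natDegree
  refine ⟨m, ?_⟩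
  have h1 := congrArg (fun z => (DirectSum.decompose 𝒜 z (m • j) : R)) hfr
  simp only [DirectSum.decompose_add, DirectSum.add_apply, Submodule.coe_add,
    DirectSum.decompose_of_mem_same 𝒜 (SetLike.pow_mem_graded m hr), DirectSum.decompose_zero,
    DirectSum.zero_apply, Submodule.coe_zero] at h1
  rw [DirectSum.decompose_sum, DirectSum.sum_apply, AddSubmonoidClass.coe_finsetSum,
    Finset.sum_eq_zero, zero_add] at h1
  · exact h1
  intro i hi
  have him : i < m := Finset.mem_range.1 hi
  rw [Polynomial.coeff_scaleRoots, mul_assoc]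
  refine DirectSum.coe_decompose_mul_of_right_mem_of_not_le 𝒜
    (SetLike.GradedMul.mul_mem (SetLike.pow_mem_graded (m - i) (SetLike.pow_mem_graded l hb))
      (SetLike.pow_mem_graded i hr)) ?_
  obtain ⟨t, ht⟩ := Nat.exists_eq_add_of_lt him
  have h3 : m - i = t + 1 := by omega
  rw [h3, ht]
  simp only [smul_eq_mul]
  rw [not_le]
  have h4 : (t + 1) * j < (t + 1) * (l * d) := Nat.mul_lt_mul_of_pos_left hj (by omega)
  calc (i + t + 1) * j = (t + 1) * j + i * j := by ring
    _ < _ := by omega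

end HomogeneousFiltration

/-! ### The double grading -/

section Bigraded

variable {k R : Type*} [Field k] [CommRing R] [Algebra k R] {𝒜 : ℕ → Submodule k R}
  [GradedAlgebra 𝒜] {b : R} {d : ℕ}

/-- For fixed `n` the independence holds because the homogeneous components of an element of
`homGT (b) n` belong to `homGT (b) n`. -/
theorem Ogr.sumIndep_bideg (hb : b ∈ 𝒜 d) : SumIndep (bideg 𝒜 (Ideal.span {b})) := by
  classical
  intro F x hx hsum p hp
  -- replace the index set by a product
  let y : ℚ × ℕ → Ogr (Ideal.span {b}) := fun p => if p ∈ F then x p else 0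
  have hy : ∀ p, y p ∈ bideg 𝒜 (Ideal.span {b}) p := fun p => by
    by_cases h : p ∈ F
    · simpa [y, h] using hx p
    · simp [y, h]
  have hysum : ∑ n ∈ F.image Prod.fst, ∑ j ∈ F.image Prod.snd, y (n, j) = 0 := by
    rw [← Finset.sum_product, ← hsum]
    refine ((Finset.sum_subset Finset.subset_product fun p _ h => if_neg h).symm.trans ?_)
    exact Finset.sum_congr rfl fun p h => if_pos h
  choose r hr hr𝒜 hrs using hy
  have h1 : ∑ j ∈ F.image Prod.snd, y (p.1, j) = 0 :=
    sumIndep_deg (Ideal.span {b}) _ (fun n => ∑ j ∈ F.image Prod.snd, y (n, j))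
      (fun n => sum_mem fun j _ => by
        rw [← hrs (n, j)]
        exact symb_mem_deg _ _ _ _) hysum p.1 (Finset.mem_image_of_mem _ hp)
  have h2 : ∑ j ∈ F.image Prod.snd, symb (Ideal.span {b}) p.1 (r (p.1, j)) (hr (p.1, j)) = 0 := by
    rw [← h1]
    exact Finset.sum_congr rfl fun j _ => hrs (p.1, j)
  rw [symb_sum, symb_eq_zero_iff] at h2
  have h3 := mem_homGT_of_sum_mem hb (r := fun j => r (p.1, j)) (fun j => hr𝒜 (p.1, j)) h2 p.2
    (Finset.mem_image_of_mem _ hp)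
  have h4 : x p = y p := (if_pos hp).symm
  rw [h4, ← hrs p, symb_eq_zero_iff]
  exact h3

namespace ICogr

instance instGradedMonoidBideg (hb : b ∈ 𝒜 d) : SetLike.GradedMonoid (bideg 𝒜 hb) where
  one_mem := SetLike.GradedOne.one_mem
    (A := awayDeg (Ogr.bideg 𝒜 (Ideal.span {b})) (Ogr.bClass_mem_bideg 𝒜 hb))
  mul_mem _ _ _ _ hx hy := SetLike.GradedMul.mul_mem
    (A := awayDeg (Ogr.bideg 𝒜 (Ideal.span {b})) (Ogr.bClass_mem_bideg 𝒜 hb)) hx hy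

theorem sumIndep_bideg (hb : b ∈ 𝒜 d) : SumIndep (bideg 𝒜 hb) :=
  (_root_.sumIndep_awayDeg (Ogr.sumIndep_bideg hb) (Ogr.bClass_mem_bideg 𝒜 hb)).comap
    (φ := (ICogr b).val.toRingHom.toAddMonoidHom) Subtype.val_injective

theorem mem_bideg_iff (hb : b ∈ 𝒜 d) {n : ℚ} {j : ℕ} {x : ICogr b} :
    x ∈ bideg 𝒜 hb (n, j) ↔ ∃ (l : ℕ) (r : R) (hr : r ∈ homGE (Ideal.span {b}) (n + l)),
      r ∈ 𝒜 (j + l * d) ∧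
        x.1 * toAway b (Ogr.bClass b ^ l) = toAway b (Ogr.symb _ (n + l) r hr) := by
  constructor
  · rintro ⟨l, s, ⟨r, hr, hrd, rfl⟩, hx⟩
    simp only [Prod.smul_mk, Prod.mk_add_mk, nsmul_one, smul_eq_mul] at hr hrd
    refine ⟨l, r, hr, hrd, hx.trans (congrArg (toAway b) ?_)⟩
    exact Ogr.symb_congr _ (by simp) rfl _ _
  · rintro ⟨l, r, hr, hrd, hx⟩
    refine ⟨l, _, ⟨r, ?_, ?_, ?_⟩, hx⟩
    · simpa using hr
    · simpa using hrd
    · exact Ogr.symb_congr _ (by simp) rfl _ _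

theorem mem_deg_of_mem_bideg (hb : b ∈ 𝒜 d) {n : ℚ} {j : ℕ} {x : ICogr b}
    (hx : x ∈ bideg 𝒜 hb (n, j)) : x ∈ deg b n := by
  obtain ⟨l, r, hr, -, hx⟩ := (mem_bideg_iff hb).1 hx
  exact mem_awayDeg_iff.2 ⟨l, r, hr, hx⟩

theorem fromBase_mem_bideg (hb : b ∈ 𝒜 d) (c : k) :
    fromBase b (algebraMap k R c) ∈ bideg 𝒜 hb 0 := by
  refine (mem_bideg_iff (n := 0) (j := 0) hb).2 ⟨0, algebraMap k R c, ?_, ?_, ?_⟩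
  · exact mem_homGE_of_nonpos (by simp) _
  · simpa using SetLike.algebraMap_mem_graded 𝒜 c
  · rw [pow_zero, map_one, mul_one]
    exact congrArg (toAway b) (Ogr.symb_congr _ (by simp) rfl _ _)

theorem eq_zero_of_isNilpotent {n : ℚ} {x : ICogr b} (hx : x ∈ deg b n) (h : IsNilpotent x) :
    x = 0 :=
  Subtype.ext (eq_zero_of_pow_eq_zero hx (h.map (ICogr b).val))

/-- The `k`-algebra structure of the integral closure, through the degree zero part of the
balanced associated graded ring. -/
noncomputable abbrev baseAlgebra (k : Type*) [Field k] {R : Type*} [CommRing R] [Algebra k R]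
    (b : R) : Algebra k (ICogr b) :=
  ((fromBase b).comp (algebraMap k R)).toAlgebra

attribute [local instance] baseAlgebra

/-- The part of bidegree `(0, 0)`. -/
noncomputable def bidegZero (hb : b ∈ 𝒜 d) : Subalgebra k (ICogr b) where
  carrier := bideg 𝒜 hb 0
  add_mem' := add_mem
  mul_mem' {x y} hx hy := by
    have := SetLike.GradedMul.mul_mem (A := bideg 𝒜 hb) hx hy
    rwa [add_zero] at this
  algebraMap_mem' c := fromBase_mem_bideg hb c

theorem isReduced_bidegZero (hb : b ∈ 𝒜 d) : IsReduced (bidegZero hb) :=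
  ⟨fun x hx => Subtype.ext (eq_zero_of_isNilpotent (mem_deg_of_mem_bideg (n := 0) (j := 0) hb x.2)
    (hx.map (bidegZero hb).val))⟩

variable [IsNoetherianRing R]

/-- An element `r / b ^ l` is the sum of the `r_j / b ^ l` with `r_j` the homogeneous components of
`r`. Those with `j < l * d`, which would have negative second degree, vanish. -/
theorem mem_iSup_bideg (hb : b ∈ 𝒜 d) (x : ICogr b) : x ∈ ⨆ p, bideg 𝒜 hb p := by
  classical
  suffices h : ∀ n, ∀ x ∈ deg b n, x ∈ ⨆ p, bideg 𝒜 hb p from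
    (iSup_le (f := deg b) h) (mem_iSup_deg x)
  intro n x hx
  rcases lt_or_ge n 0 with hn | hn
  · rw [deg_eq_zero_of_neg hn hx]
    exact zero_mem _
  obtain ⟨l, r, hr, hxr⟩ := mem_awayDeg_iff.1 hx
  obtain ⟨u, hu⟩ := isUnit_algebraMap_away (Ogr.bClass b) l
  let c : ℕ → R := fun j => DirectSum.decompose 𝒜 r j
  have hc : ∀ j, c j ∈ 𝒜 j := fun j => SetLike.coe_mem _
  have hrc : ∑ j ∈ (DirectSum.decompose 𝒜 r).support, c j = r :=
    DirectSum.sum_support_decompose 𝒜 r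
  have hcE : ∀ j, c j ∈ homGE (Ideal.span {b}) (n + l) := by
    intro j
    by_cases hj : j ∈ (DirectSum.decompose 𝒜 r).support
    · exact mem_homGE_of_sum_mem hb hc (hrc.symm ▸ hr) j hj
    · have h0 : c j = 0 := by
        have := DFinsupp.notMem_support_iff.1 hj
        simp [c, this]
      rw [h0]
      exact zero_mem _
  -- the homogeneous components of `r` give the components of `x = r / b ^ l`
  let z : ℕ → Localization.Away (Ogr.bClass b) := fun j =>
    toAway b (Ogr.symb _ _ (c j) (hcE j)) * ↑u⁻¹
  have hzu : ∀ j, z j * toAway b (Ogr.bClass b ^ l) = toAway b (Ogr.symb _ _ (c j) (hcE j)) :=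
    fun j => by
      rw [← hu]
      exact Units.inv_mul_cancel_right _ _
  have hzint : ∀ j, IsIntegral (Ogr (Ideal.span {b})) (z j) := fun j =>
    isIntegral_of_mem_awayDeg hn (mem_awayDeg_iff.2 ⟨l, c j, hcE j, hzu j⟩)
  have hxz : x = ∑ j ∈ (DirectSum.decompose 𝒜 r).support, ⟨z j, hzint j⟩ := by
    refine Subtype.ext ?_
    rw [AddSubmonoidClass.coe_finsetSum]
    change x.1 = ∑ j ∈ _, z j
    have hxr' : x.1 * toAway b (Ogr.bClass b ^ l) = toAway b (Ogr.symb _ (n + l) r hr) := hxr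
    rw [← Finset.sum_mul, ← map_sum, Ogr.symb_sum, Units.eq_mul_inv_iff_mul_eq, hu]
    exact hxr'.trans (congrArg (toAway b) (Ogr.symb_congr _ rfl hrc.symm _ _))
  rw [hxz]
  refine sum_mem fun j _ => ?_
  rcases lt_or_ge j (l * d) with hj | hj
  · have hnil := isNilpotent_of_mem_homGE_of_lt hb (hc j)
      (homGE_antitone (le_add_of_nonneg_left hn) (hcE j)) hj
    have h0 : (⟨z j, hzint j⟩ : ICogr b) = 0 := by
      refine Subtype.ext ?_
      change toAway b _ * _ = 0
      rw [Ogr.symb_eq_zero_of_mem _ _ (mem_homGT_of_isNilpotent hnil _), map_zero, zero_mul]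
    rw [h0]
    exact zero_mem _
  · refine AddSubgroup.mem_iSup_of_mem (n, j - l * d) ((mem_bideg_iff hb).2
      ⟨l, c j, hcE j, ?_, hzu j⟩)
    rw [Nat.sub_add_cancel hj]
    exact hc j

theorem nonempty_gradedRing_bideg (hb : b ∈ 𝒜 d) : Nonempty (GradedRing (bideg 𝒜 hb)) :=
  nonempty_gradedRing _ (sumIndep_bideg hb) (mem_iSup_bideg hb)

/-- For the grading that comes from `R`, the part of degree zero is concentrated in degree zero
for the filtration. For an element `r / b ^ l` of bidegree `(n, 0)` with `n = P / Q > 0`, the power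
`r ^ Q` is integral over `(b ^ (P + l Q))`, and if `b` has positive degree then that of `r ^ Q` is
too small for this, so that `r` is nilpotent. -/
theorem bideg_zero_eq_zero (h0 : Function.Bijective (algebraMap k (𝒜 0))) (hb : b ∈ 𝒜 d) {n : ℚ}
    (hn : n ≠ 0) {x : ICogr b} (hx : x ∈ bideg 𝒜 hb (n, 0)) : x = 0 := by
  rcases lt_or_gt_of_ne hn with hn | hn
  · exact deg_eq_zero_of_neg hn (mem_deg_of_mem_bideg hb hx)
  obtain ⟨l, r, hr, hrd, hxr⟩ := (mem_bideg_iff hb).1 hx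
  suffices h : ∃ m : ℕ, b ^ m * r ∈ homGT (Ideal.span {b}) (n + l + m) by
    rw [← algebraMap_symb_eq_zero_iff hr] at h
    change toAway b _ = 0 at h
    rw [h] at hxr
    exact Subtype.ext ((isUnit_algebraMap_away _ l).mul_left_eq_zero.1 hxr)
  rcases Nat.eq_zero_or_pos d with rfl | hd
  · -- here `b` is zero or a unit
    obtain ⟨c, hc⟩ := h0.2 ⟨b, hb⟩
    have hcb : algebraMap k R c = b := congrArg Subtype.val hc
    rcases eq_or_ne c 0 with rfl | hc0
    · refine ⟨1, ?_⟩
      rw [← hcb, map_zero, zero_pow one_ne_zero, zero_mul]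
      exact zero_mem _
    · have hunit : IsUnit b := hcb ▸ (IsUnit.mk0 c hc0).map (algebraMap k R)
      obtain ⟨L, hL⟩ := exists_nat_gt (n + l)
      obtain ⟨v, hv⟩ := (hunit.pow L).exists_right_inv
      refine ⟨0, ?_⟩
      rw [Nat.cast_zero, add_zero, ← one_mul (b ^ 0 * r), ← hv]
      exact homGE_le_homGT hL (Ideal.mul_mem_right _ _ (Ideal.mul_mem_right _ _
        (pow_mem_homGE_span b L)))
  · refine ⟨0, ?_⟩
    rw [pow_zero, one_mul]
    refine mem_homGT_of_isNilpotent ?_ _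
    obtain ⟨P, hP⟩ : ∃ P : ℕ, (P : ℤ) = n.num :=
      ⟨_, Int.toNat_of_nonneg (Rat.num_nonneg.2 hn.le)⟩
    have hPn : (n.den : ℚ) * n = P := by
      rw [Rat.den_mul_eq_num, ← hP, Int.cast_natCast]
    have hP0 : 0 < P := by
      have := Rat.num_pos.2 hn
      omega
    have h1 : r ^ n.den ∈ homGE (Ideal.span {b}) ((P + n.den * l : ℕ) : ℚ) := by
      have := pow_mem_homGE hr n.den
      rwa [mul_add, hPn, ← Nat.cast_mul, ← Nat.cast_add] at this
    have h2 := isNilpotent_of_mem_homGE_of_lt hb (SetLike.pow_mem_graded n.den hrd) h1 (by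
      have := Nat.mul_pos hP0 hd
      rw [zero_add, smul_eq_mul, add_mul, ← mul_assoc]
      omega)
    obtain ⟨m, hm⟩ := h2
    exact ⟨n.den * m, by rw [pow_mul, hm]⟩

/-- Where the natural map is surjective in degree `N`, multiplication by `bClass b ^ N` embeds the
part of bidegree `(0, 0)` into the image of the homogeneous elements of `R` of degree `N * d`. -/
theorem finite_bidegZero (h0 : Function.Bijective (algebraMap k (𝒜 0))) (hb : b ∈ 𝒜 d)
    {N : ℕ} (hN : ∀ z ∈ deg b N, ∃ y ∈ Ogr.deg (Ideal.span {b}) N, fromOgr b y = z) :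
    Module.Finite k (bidegZero hb) := by
  classical
  let W : Submodule k R := 𝒜 (N * d) ⊓ (homGE (Ideal.span {b}) (N : ℚ)).restrictScalars k
  have hfin := finite_component 𝒜 h0 (N * d)
  have hW : Module.Finite k W := Submodule.finiteDimensional_of_le inf_le_left
  have hWE : ∀ r : W, r.1 ∈ homGE (Ideal.span {b}) (N : ℚ) := fun r => r.2.2
  let g : W →ₗ[k] ICogr b :=
    { toFun := fun r => fromOgr b (Ogr.symb _ N r.1 (hWE r))
      map_add' := fun r s => by
        rw [← map_add]
        exact congrArg (fromOgr b) (Ogr.symb_add _ _ _ _ (hWE r) (hWE s)).symm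
      map_smul' := fun c r => by
        rw [RingHom.id_apply, Algebra.smul_def]
        change _ = fromOgr b (Ogr.fromBase _ (algebraMap k R c)) * _
        rw [← map_mul]
        exact congrArg (fromOgr b) ((Ogr.symb_congr _ rfl (Algebra.smul_def c r.1) _ _).trans
          (Ogr.fromBase_mul_symb _ _ _ _ (hWE r)).symm) }
  have hbN : fromOgr b (Ogr.bClass b ^ N) ∈ bideg 𝒜 hb (N, N * d) := by
    refine (mem_bideg_iff hb).2 ⟨0, b ^ N, ?_, ?_, ?_⟩
    · simpa using pow_mem_homGE_span b N
    · simpa using SetLike.pow_mem_graded N hb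
    · rw [pow_zero, map_one, mul_one]
      change toAway b _ = _
      rw [Ogr.bClass_pow]
      exact congrArg (toAway b) (Ogr.symb_congr _ (by simp) rfl _ _)
  have hrange : ∀ x : bidegZero hb, fromOgr b (Ogr.bClass b ^ N) * x.1 ∈ LinearMap.range g := by
    intro x
    have hx := SetLike.GradedMul.mul_mem (A := bideg 𝒜 hb) hbN x.2
    rw [add_zero] at hx
    obtain ⟨y, hy, hyx⟩ := hN _ (mem_deg_of_mem_bideg hb hx)
    obtain ⟨r, hr, rfl⟩ := (Ogr.mem_deg_iff _).1 hy
    -- only the homogeneous component of degree `N * d` of the preimage `r` matters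
    let F := insert (N * d) (DirectSum.decompose 𝒜 r).support
    let c : ℕ → R := fun j => DirectSum.decompose 𝒜 r j
    have hc : ∀ j, c j ∈ 𝒜 j := fun j => SetLike.coe_mem _
    have hc0 : ∀ j ∉ (DirectSum.decompose 𝒜 r).support, c j = 0 := fun j hj => by
      have := DFinsupp.notMem_support_iff.1 hj
      simp [c, this]
    have hrc : ∑ j ∈ F, c j = r := by
      refine Eq.trans ?_ (DirectSum.sum_support_decompose 𝒜 r)
      exact (Finset.sum_subset (Finset.subset_insert _ _) fun j _ hj => hc0 j hj).symm
    have hcE : ∀ j, c j ∈ homGE (Ideal.span {b}) (N : ℚ) := by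
      intro j
      by_cases hj : j ∈ F
      · exact mem_homGE_of_sum_mem hb hc (hrc.symm ▸ hr) j hj
      · rw [hc0 j fun h => hj (Finset.mem_insert_of_mem h)]
        exact zero_mem _
    refine ⟨⟨c (N * d), hc _, hcE _⟩, ?_⟩
    have hinj : Function.Injective fun j : ℕ => ((N : ℚ), j) := fun i j hij => (Prod.mk.inj hij).2
    let w : ℚ × ℕ → ICogr b := fun p =>
      if p.1 = N then fromOgr b (Ogr.symb _ N (c p.2) (hcE p.2)) else 0
    have hw : ∀ j, w (N, j) = fromOgr b (Ogr.symb _ N (c j) (hcE j)) := fun j => if_pos rfl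
    have h1 := (sumIndep_bideg hb).eq_of_sum_eq (F := F.map ⟨_, hinj⟩) (x := w)
      (i := ((N : ℚ), N * d)) (fun p => ?_) ?_ hx ?_
    · rw [← h1, hw]
      rfl
    · obtain ⟨n, j⟩ := p
      by_cases hn : n = N
      · subst hn
        rw [hw]
        refine (mem_bideg_iff hb).2 ⟨0, c j, ?_, ?_, ?_⟩
        · simpa using hcE j
        · simpa using hc j
        · rw [pow_zero, map_one, mul_one]
          exact congrArg (toAway b) (Ogr.symb_congr _ (by simp) rfl _ _)
      · have : w (n, j) = 0 := if_neg hn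
        rw [this]
        exact zero_mem _
    · exact Finset.mem_map.2 ⟨N * d, Finset.mem_insert_self _ _, rfl⟩
    · rw [Finset.sum_map, ← hyx]
      refine (Finset.sum_congr rfl fun j _ => hw j).trans ?_
      rw [← map_sum, Ogr.symb_sum]
      exact congrArg (fromOgr b) (Ogr.symb_congr _ rfl hrc _ _)
  let μ : bidegZero hb →ₗ[k] LinearMap.range g :=
    { toFun := fun x => ⟨_, hrange x⟩
      map_add' := fun x y => Subtype.ext (mul_add _ _ _)
      map_smul' := fun c x => Subtype.ext (mul_smul_comm _ _ _) }
  refine Module.Finite.of_injective μ fun x y hxy => Subtype.ext (Subtype.ext ?_)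
  have h1 : fromOgr b (Ogr.bClass b ^ N) * x.1 = fromOgr b (Ogr.bClass b ^ N) * y.1 :=
    congrArg Subtype.val hxy
  exact (isUnit_algebraMap_away (Ogr.bClass b) N).mul_left_cancel (congrArg Subtype.val h1)

end ICogr

end Bigraded

/-! ### Complete families of orthogonal idempotents -/

/-- A finite reduced algebra over an algebraically closed field is a finite power of the field,
expressed through its idempotents. -/
theorem exists_completeOrthogonalIdempotents (k H : Type*) [Field k] [IsAlgClosed k] [CommRing H]
    [Algebra k H] [Module.Finite k H] [IsReduced H] :
    ∃ (m : ℕ) (e : Fin m → H), CompleteOrthogonalIdempotents e ∧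
      ∀ i, e i ≠ 0 ∧ ∀ x, ∃ c : k, e i * x = e i * algebraMap k H c := by
  classical
  have : IsArtinianRing H := IsArtinianRing.of_finite k H
  have : Fintype (MaximalSpectrum H) := Fintype.ofFinite _
  let ψ := (IsArtinianRing.equivPi H).toRingEquiv
  let τ := (Fintype.equivFin (MaximalSpectrum H)).symm
  let e : MaximalSpectrum H → H := fun M => ψ.symm (Pi.single M 1)
  have he : CompleteOrthogonalIdempotents e :=
    (CompleteOrthogonalIdempotents.single fun M : MaximalSpectrum H => H ⧸ M.asIdeal).map
      ψ.symm.toRingHom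
  have hψe : ∀ M, ψ (e M) = Pi.single M 1 := fun M => ψ.apply_symm_apply _
  have hfield : ∀ M : MaximalSpectrum H, IsDomain (H ⧸ M.asIdeal) := fun M =>
    have := M.isMaximal
    inferInstance
  refine ⟨_, e ∘ τ, (CompleteOrthogonalIdempotents.equiv τ).2 he,
    fun i => ⟨fun h => ?_, fun x => ?_⟩⟩
  · have h1 := hψe (τ i)
    change e (τ i) = 0 at h
    rw [h, map_zero] at h1
    have h2 := congrFun h1 (τ i)
    rw [Pi.single_eq_same] at h2
    exact zero_ne_one h2
  · have := hfield (τ i)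
    obtain ⟨c, hc⟩ := (IsAlgClosed.algebraMap_bijective_of_isIntegral
      (k := k) (K := H ⧸ (τ i).asIdeal)).2 (Ideal.Quotient.mk _ x)
    refine ⟨c, ψ.injective ?_⟩
    change ψ (e (τ i) * x) = ψ (e (τ i) * _)
    rw [map_mul, map_mul, hψe]
    funext M
    rw [Pi.mul_apply, Pi.mul_apply]
    by_cases hM : M = τ i
    · subst hM
      exact congrArg _ hc.symm
    · rw [Pi.single_eq_of_ne hM, zero_mul, zero_mul]

/-- A scalar that acts on `e` as an idempotent acts as `0` or `1`. -/
theorem IsIdempotentElem.mul_eq_zero_or_eq {k S : Type*} [Field k] [CommRing S] (φ : k →+* S)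
    {e f : S} (he : IsIdempotentElem e) (hf : IsIdempotentElem f) {c : k}
    (h : e * f = e * φ c) : e * f = 0 ∨ e * f = e := by
  have h1 : e * φ (c * (c - 1)) = 0 := by
    have h2 : (e * f) * (e * f) = e * f := he.mul hf
    rw [h] at h2
    rw [map_mul, map_sub, map_one]
    linear_combination h2 - φ c * φ c * he.eq
  by_cases hc : c * (c - 1) = 0
  · rcases mul_eq_zero.1 hc with hc | hc
    · exact Or.inl (by rw [h, hc, map_zero, mul_zero])
    · exact Or.inr (by rw [h, sub_eq_zero.1 hc, map_one, mul_one])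
  · have h2 : e = 0 := ((IsUnit.mk0 _ hc).map φ).mul_left_eq_zero.1 h1
    exact Or.inl (by rw [h2, zero_mul])

theorem OrthogonalIdempotents.injective {S ι : Type*} [Semiring S] {e : ι → S}
    (he : OrthogonalIdempotents e) (he0 : ∀ i, e i ≠ 0) : Function.Injective e := by
  intro i j hij
  by_contra hne
  refine he0 i ?_
  have h := he.ortho hne
  change e i * e j = 0 at h
  rw [← hij, (he.idem i).eq] at h
  exact h

theorem CompleteOrthogonalIdempotents.exists_eq {S κ : Type*} [CommRing S] [Fintype κ] {e : S}
    {f : κ → S} (hf : CompleteOrthogonalIdempotents f) (he0 : e ≠ 0)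
    (hef : ∀ j, e * f j = 0 ∨ e * f j = e) (hfe : ∀ j, f j * e = 0 ∨ f j * e = f j) :
    ∃ j, f j = e := by
  by_contra! h
  refine he0 ?_
  rw [← mul_one e, ← hf.complete, Finset.mul_sum]
  refine Finset.sum_eq_zero fun j _ => (hef j).resolve_right fun h1 => ?_
  rcases hfe j with h2 | h2
  · exact he0 (by rw [← h1, mul_comm, h2])
  · exact h j (by rw [← h2, mul_comm, h1])

/-- A complete family of nonzero idempotents that are pairwise either orthogonal or equal to those
of another such family agrees with it up to reordering. -/
theorem CompleteOrthogonalIdempotents.exists_equiv {S ι κ : Type*} [CommRing S] [Fintype ι]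
    [Fintype κ] {e : ι → S} {f : κ → S} (he : CompleteOrthogonalIdempotents e)
    (hf : CompleteOrthogonalIdempotents f) (he0 : ∀ i, e i ≠ 0) (hf0 : ∀ j, f j ≠ 0)
    (hef : ∀ i j, e i * f j = 0 ∨ e i * f j = e i) (hfe : ∀ j i, f j * e i = 0 ∨ f j * e i = f j) :
    ∃ σ : ι ≃ κ, ∀ i, f (σ i) = e i := by
  choose s hs using fun i => hf.exists_eq (he0 i) (hef i) (hfe · i)
  choose t ht using fun j => he.exists_eq (hf0 j) (hfe j) (hef · j)
  exact ⟨⟨s, t, fun i => he.injective he0 (by rw [ht, hs]),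
    fun j => hf.injective hf0 (by rw [hs, ht])⟩, hs⟩

theorem nonempty_gradedRing_cornerDeg {ι S : Type*} [DecidableEq ι] [AddMonoid ι] [CommRing S]
    {𝒮 : ι → AddSubgroup S} [SetLike.GradedMonoid 𝒮] (hind : SumIndep 𝒮)
    (hspan : ∀ s, s ∈ ⨆ i, 𝒮 i) {e : S} (he : IsIdempotentElem e) (he0 : e ∈ 𝒮 0) :
    Nonempty (GradedRing (cornerDeg 𝒮 he)) := by
  have : SetLike.GradedMonoid (cornerDeg 𝒮 he) :=
    { one_mem := he0
      mul_mem := fun _ _ _ _ hx hy => SetLike.GradedMul.mul_mem (A := 𝒮) hx hy }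
  let val : he.Corner →+ S :=
    { toFun := fun x => x.1
      map_zero' := rfl
      map_add' := fun _ _ => rfl }
  let c : S →+ he.Corner :=
    { toFun := fun s => ⟨e * s * e, s, rfl⟩
      map_zero' := Subtype.ext (show e * 0 * e = 0 by rw [mul_zero, zero_mul])
      map_add' := fun s t => Subtype.ext
        (show e * (s + t) * e = e * s * e + e * t * e by rw [mul_add, add_mul]) }
  refine nonempty_gradedRing _ (hind.comap (φ := val) Subtype.val_injective) fun x => ?_
  have hx : c x.1 = x := Subtype.ext (by
    obtain ⟨h1, h2⟩ := (Subsemigroup.mem_corner_iff he).1 x.2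
    change e * x.1 * e = x.1
    rw [h1, h2])
  rw [← hx]
  have h1 : (⨆ i, 𝒮 i) ≤ (⨆ i, cornerDeg 𝒮 he i).comap c := by
    refine iSup_le fun i s hs => AddSubgroup.mem_iSup_of_mem i ?_
    have h2 := SetLike.GradedMul.mul_mem (A := 𝒮) (SetLike.GradedMul.mul_mem (A := 𝒮) he0 hs) he0
    rwa [zero_add, add_zero] at h2
  exact h1 (hspan x.1)

/-! ### The splitting of the doubly graded ring -/

namespace ICogr

variable {k R : Type*} [Field k] [CommRing R] [Algebra k R] {𝒜 : ℕ → Submodule k R}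
  [GradedAlgebra 𝒜] {b : R} {d : ℕ}

/-- Idempotents of bidegree `(0, 0)` that split the part of bidegree `(0, 0)` into copies of `k`
split the whole doubly graded ring. -/
theorem isSplitting_of_bidegZero [IsNoetherianRing R]
    (h0 : Function.Bijective (algebraMap k (𝒜 0))) (hb : b ∈ 𝒜 d) {m : ℕ} {e : Fin m → ICogr b}
    (he : CompleteOrthogonalIdempotents e) (hmem : ∀ i, e i ∈ bideg 𝒜 hb 0) (hne : ∀ i, e i ≠ 0)
    (hk : ∀ i, ∀ x ∈ bideg 𝒜 hb 0, ∃ c : k, e i * x = e i * fromBase b (algebraMap k R c)) :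
    IsSplitting 𝒜 hb e where
  idem := he
  graded i := nonempty_gradedRing_cornerDeg (sumIndep_bideg hb) (mem_iSup_bideg hb) _ (hmem i)
  splits p x := by
    have hcorner : ∀ i, x ∈ bideg 𝒜 hb p → e i * x * e i ∈ bideg 𝒜 hb p := fun i hx => by
      have h := SetLike.GradedMul.mul_mem (A := bideg 𝒜 hb)
        (SetLike.GradedMul.mul_mem (A := bideg 𝒜 hb) (hmem i) hx) (hmem i)
      rwa [zero_add, add_zero] at h
    refine ⟨fun hx i => hcorner i hx, fun hx => ?_⟩
    have h : ∑ i, e i * x * e i = x := by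
      have h1 : ∀ i, e i * x * e i = x * e i := fun i => by
        rw [mul_comm (e i) x, mul_assoc, (he.idem i).eq]
      rw [Finset.sum_congr rfl fun i _ => h1 i, ← Finset.mul_sum, he.complete, mul_one]
    rw [← h]
    exact sum_mem fun i _ => hx i
  degree_zero i n hn := (AddSubgroup.eq_bot_iff_forall _).2 fun x hx =>
    Subtype.ext (bideg_zero_eq_zero h0 hb hn hx)
  degree_zero_zero i := by
    have hcorner : ∀ x, e i * x * e i = e i * x := fun x => by
      rw [mul_comm (e i) x, mul_assoc, (he.idem i).eq]
    let φ : k →+* (he.idem i).Corner :=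
      { toFun := fun c => ⟨e i * fromBase b (algebraMap k R c), _, hcorner _⟩
        map_one' := Subtype.ext (show e i * _ = e i by
          rw [map_one, map_one, mul_one])
        map_mul' := fun c c' => Subtype.ext (by
          change _ = e i * _ * (e i * _)
          rw [map_mul, map_mul]
          linear_combination (-1 : ICogr b) * fromBase b (algebraMap k R c) *
            fromBase b (algebraMap k R c') * (he.idem i).eq)
        map_zero' := Subtype.ext (show e i * _ = 0 by
          rw [map_zero, map_zero, mul_zero])
        map_add' := fun c c' => Subtype.ext
          (show e i * _ = e i * _ + e i * _ by rw [map_add, map_add, mul_add]) }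
    have : Nontrivial (he.idem i).Corner := ⟨1, 0, fun h => hne i (congrArg Subtype.val h)⟩
    refine ⟨φ, fun c => rfl, φ.injective, Set.ext fun y => ⟨?_, fun hy => ?_⟩⟩
    · rintro ⟨c, rfl⟩
      have h := SetLike.GradedMul.mul_mem (A := bideg 𝒜 hb) (hmem i) (fromBase_mem_bideg hb c)
      rwa [add_zero] at h
    · obtain ⟨c, hc⟩ := hk i y.1 hy
      refine ⟨c, Subtype.ext ?_⟩
      change e i * _ = y.1
      rw [← hc]
      exact ((Subsemigroup.mem_corner_iff (he.idem i)).1 y.2).1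

/-- A splitting consists of nonzero idempotents of bidegree `(0, 0)` that cut out copies of `k`. -/
theorem IsSplitting.mem_bidegZero {hb : b ∈ 𝒜 d} {m : ℕ} {e : Fin m → ICogr b}
    (h : IsSplitting 𝒜 hb e) (i : Fin m) : e i ∈ bideg 𝒜 hb 0 ∧ e i ≠ 0 ∧
      ∀ x ∈ bideg 𝒜 hb 0, ∃ c : k, e i * x = e i * fromBase b (algebraMap k R c) := by
  obtain ⟨φ, hφ, hinj, hrange⟩ := h.degree_zero_zero i
  have hmem : e i ∈ bideg 𝒜 hb 0 := by
    have h1 : φ 1 ∈ (cornerDeg (bideg 𝒜 hb) (h.idem.idem i) (0, 0) : Set _) :=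
      hrange ▸ Set.mem_range_self 1
    have h2 : (φ 1).1 ∈ bideg 𝒜 hb 0 := h1
    rwa [hφ, map_one, map_one, mul_one] at h2
  refine ⟨hmem, fun h0 => ?_, fun x hx => ?_⟩
  · have h1 : φ 1 = φ 0 := Subtype.ext (by rw [hφ, hφ, h0, zero_mul, zero_mul])
    exact one_ne_zero (hinj h1)
  · have h1 := SetLike.GradedMul.mul_mem (A := bideg 𝒜 hb) hmem hx
    rw [add_zero] at h1
    let y : (h.idem.idem i).Corner := ⟨e i * x, x, by
      change e i * x * e i = _
      rw [mul_comm (e i) x, mul_assoc, (h.idem.idem i).eq]⟩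
    have h2 : y ∈ Set.range φ := by
      rw [hrange]
      exact h1
    obtain ⟨c, hc⟩ := h2
    exact ⟨c, by rw [← hφ, hc]⟩

theorem IsSplitting.exists_equiv {hb : b ∈ 𝒜 d} {m m' : ℕ} {e : Fin m → ICogr b}
    {e' : Fin m' → ICogr b} (h : IsSplitting 𝒜 hb e) (h' : IsSplitting 𝒜 hb e') :
    ∃ σ : Fin m ≃ Fin m', ∀ i, e' (σ i) = e i := by
  refine h.idem.exists_equiv h'.idem (fun i => (h.mem_bidegZero i).2.1)
    (fun j => (h'.mem_bidegZero j).2.1) (fun i j => ?_) fun j i => ?_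
  · obtain ⟨c, hc⟩ := (h.mem_bidegZero i).2.2 _ (h'.mem_bidegZero j).1
    exact (h.idem.idem i).mul_eq_zero_or_eq ((fromBase b).comp (algebraMap k R))
      (h'.idem.idem j) hc
  · obtain ⟨c, hc⟩ := (h'.mem_bidegZero j).2.2 _ (h.mem_bidegZero i).1
    exact (h'.idem.idem j).mul_eq_zero_or_eq ((fromBase b).comp (algebraMap k R))
      (h.idem.idem i) hc

attribute [local instance] baseAlgebra

/-- The part of bidegree `(0, 0)` is a finite reduced algebra over `k`, hence a power of `k`. -/
theorem exists_isSplitting [IsNoetherianRing R] [IsAlgClosed k]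
    (h0 : Function.Bijective (algebraMap k (𝒜 0))) (hb : b ∈ 𝒜 d)
    (hN : ∃ N : ℚ, ∀ n : ℚ, N ≤ n →
      Set.BijOn (attaching b) (Ogr.deg (Ideal.span {b}) n) (prodDeg b n)) :
    ∃ (m : ℕ) (e : Fin m → ICogr b), IsSplitting 𝒜 hb e := by
  obtain ⟨N, hN⟩ := hN
  obtain ⟨L, hL⟩ := exists_nat_ge N
  have hL' : N ≤ ((L + 1 : ℕ) : ℚ) := hL.trans (by exact_mod_cast L.le_succ)
  have hfin : Module.Finite k (bidegZero hb) := by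
    refine finite_bidegZero h0 hb (N := L + 1) fun z hz => ?_
    obtain ⟨y, hy, hyz⟩ := (hN _ hL').surjOn (show ((0, z) : _ × ICogr b) ∈ prodDeg b _ from
      ⟨zero_mem _, hz⟩)
    exact ⟨y, hy, congrArg Prod.snd hyz⟩
  have hred := isReduced_bidegZero hb
  obtain ⟨m, ε, hε, hεk⟩ := exists_completeOrthogonalIdempotents k (bidegZero hb)
  refine ⟨m, fun i => (ε i).1, isSplitting_of_bidegZero h0 hb
    (hε.map (f := (bidegZero hb).val.toRingHom)) (fun i => (ε i).2)
    (fun i h => (hεk i).1 (Subtype.ext h)) fun i x hx => ?_⟩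
  obtain ⟨c, hc⟩ := (hεk i).2 ⟨x, hx⟩
  exact ⟨c, congrArg Subtype.val hc⟩

/-- A Noetherian graded algebra with degree zero part `k` is finitely generated over the perfect
field `k`, and therefore has finite normalization. -/
theorem exists_forall_bijOn_attaching_of_gradedAlgebra [IsNoetherianRing R] [IsAlgClosed k]
    (𝒜 : ℕ → Submodule k R) [GradedAlgebra 𝒜] (h0 : Function.Bijective (algebraMap k (𝒜 0)))
    (b : R) : ∃ N : ℚ, ∀ n : ℚ, N ≤ n →
      Set.BijOn (attaching b) (Ogr.deg (Ideal.span {b}) n) (prodDeg b n) := by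
  have := finiteType_of_isNoetherianRing 𝒜 h0
  exact exists_forall_bijOn_attaching b (Or.inr (hasFiniteNormalization_of_finiteType k R))

end ICogr

theorem mainTheorem3 {R : Type*} [CommRing R] [IsNoetherianRing R] (b : R) :
    -- the gradings
    Nonempty (GradedRing (Ogr.deg (Ideal.span {b}))) ∧
    Nonempty (GradedRing (ICogr.deg b)) ∧
    -- the natural map is a graded injection
    Function.Injective (ICogr.attaching b) ∧
    (∀ n : ℚ, ∀ x ∈ Ogr.deg (Ideal.span {b}) n, ICogr.attaching b x ∈ ICogr.prodDeg b n) ∧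
    -- it is an isomorphism in high degrees
    ((IsNoetherianRing (Ogr (Ideal.span {b})) ∨ HasFiniteNormalization R) →
      ∃ N : ℚ, ∀ n : ℚ, N ≤ n →
        Set.BijOn (ICogr.attaching b) (Ogr.deg (Ideal.span {b}) n) (ICogr.prodDeg b n)) ∧
    -- periodicity
    (∀ n : ℚ, 0 ≤ n →
      Set.BijOn (fun x : ICogr b => ICogr.fromOgr b (Ogr.bClass b) * x)
        (ICogr.deg b n) (ICogr.deg b (n + 1))) ∧
    -- the graded case
    (∀ {k : Type*} [Field k] [IsAlgClosed k] [Algebra k R] (𝒜 : ℕ → Submodule k R)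
      [GradedAlgebra 𝒜], Function.Bijective (algebraMap k (𝒜 0)) →
      ∀ {d : ℕ} (hb : b ∈ 𝒜 d),
        (∃ N : ℚ, ∀ n : ℚ, N ≤ n →
          Set.BijOn (ICogr.attaching b) (Ogr.deg (Ideal.span {b}) n) (ICogr.prodDeg b n)) ∧
        Nonempty (GradedRing (ICogr.bideg 𝒜 hb)) ∧
        ∃ (m : ℕ) (e : Fin m → ICogr b), ICogr.IsSplitting 𝒜 hb e ∧
          ∀ (m' : ℕ) (e' : Fin m' → ICogr b), ICogr.IsSplitting 𝒜 hb e' →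
            ∃ σ : Fin m ≃ Fin m', ∀ i, e' (σ i) = e i) := by
  refine ⟨Ogr.nonempty_gradedRing_deg _, ICogr.nonempty_gradedRing_deg, ICogr.attaching_injective,
    fun n x hx => ICogr.attaching_mem_prodDeg hx, ICogr.exists_forall_bijOn_attaching b,
    fun n hn => ICogr.bijOn_mul_bClass hn, ?_⟩
  intro k _ _ _ 𝒜 _ h0 d hb
  have hN := ICogr.exists_forall_bijOn_attaching_of_gradedAlgebra 𝒜 h0 b
  obtain ⟨m, e, he⟩ := ICogr.exists_isSplitting h0 hb hN
  exact ⟨hN, ICogr.nonempty_gradedRing_bideg hb, m, e, he, fun m' e' he' => he.exists_equiv he'⟩
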